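/- **Setting.** Let $(X_1,\theta_1),(X_2,\theta_2),\dots$ be independent random pairs, each with density $q(x|\theta)g(\theta)$ on $\mathbb R^2$, where $g$ is a (prior) probability density carried by a parameter set $\Theta\subseteq\mathbb R$ and $q(\cdot|\theta)$ is a probability density for each $\theta\in\Theta$; only $X_1,\dots,X_n$ are observed. Put $$p(x)=\int q(x|\theta)g(\theta)\,d\theta,\qquad \Psi(x)=\int\theta q(x|\theta)g(\theta)\,d\theta,\qquad t(y)=\Psi(y)/p(y).$$ Assume that $\theta q(x|\theta)g(\theta)$ is integrable on $[a,b]\times\mathbb R$ for all real $a\le b$, that $p$ and $\Psi$ are essentially bounded, and fix a point $y$ with $p(y)>0$. $\|\cdot\|_\infty$ denotes the $L^\infty(\mathbb R)$ norm. **Wavelets.** Let $\varphi$ be a twice continuously differentiable scaling function with orthonormal integer translates, supported in $[M_1,M_2]$, such that $\int x^{i}\sum_{k\in\mathbb Z}\varphi(x-k)\varphi(z-k)\,dx=z^{i}$ for all real $z$ and all integers $0\le i\le s-1$. Put $\varphi_{m,k}(x)=2^{m/2}\varphi(2^mx-k)$ and $$K_{m,y}=\{k\in\mathbb Z:\ 2^my-M_2-s(M_2-M_1)\le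 k\le 2^my-M_1+s(M_2-M_1)\}.$$ Let $M=\max_m|K_{m,y}|$ and $C_\varphi=\sup_z\sum_k|\varphi(z-k)|$. For all sufficiently large $m$ and all $k\in K_{m,y}$ let $u_{m,k}\in L^2(\mathbb R)$ be a measurable function satisfying $$\int q(x|\theta)u_{m,k}(x)\,dx=\int\theta q(x|\theta)\varphi_{m,k}(x)\,dx\qquad\text{for all }\theta\in\Theta,$$ and let $\gamma_m=\bigl(\sum_{k\in K_{m,y}}\int u_{m,k}^2(x)\,dx\bigr)^{1/2}$. **Estimator.** For $j,k\in K_{m,y}$ let $\widehat B_{j,k}=n^{-1}\sum_{l=1}^n\varphi_{m,k}(X_l)\varphi_{m,j}(X_l)$, $\widehat c_j=n^{-1}\sum_{l=1}^n u_{m,j}(X_l)$, $\delta_m=2^{m/2}n^{-1/2}$, $\widehat B_{\delta_m}=\widehat B+\delta_mI$, $\widehat a=\widehat B_{\delta_m}^{-1}\widehat c$, and $\widehat t_m(y)=\sum_{k\in K_{m,y}}\widehat a_k\varphi_{m,k}(y)$. Put $\rho_{mn}^2=2^m(1+\gamma_m^2)n^{-1}\log n$. Let $m_1=m_1(n)$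 and $m_n$ be nonnegative integers with $2^{m_1}\asymp\log n$ and $2^{m_n}(\gamma_{m_n}^2+1)\asymp n/(\log n)^{2}$ as $n\to\infty$, and $\mathcal M=\{m\in\mathbb Z: m_1\le m\le m_n\}$. Lepski's choice of the resolution level is $$\widehat m=\min\Bigl\{m\in\mathcal M:\ |\widehat t_m(y)-\widehat t_j(y)|^2\le\lambda^2\bigl[\|\widehat B_{\delta_m}^{-1}\|^2+\|\widehat B_{\delta_j}^{-1}\|^2\bigr]^2\rho_{jn}^2\ \text{ for all } j\in\mathcal M,\ j\ge m\Bigr\}$$ (spectral norms), with $\lambda=16\,C_\varphi\|p\|_\infty^{1/2}\sqrt M\,D+1$, where $$D=\|p\|_\infty+\|\Psi\|_\infty\|\varphi\|_\infty M\sqrt M\,[1-\nu_1]^{-1/2}+16\|\Psi\|_\infty\|\varphi\|_\infty^2\|p\|_\infty^{3/2}M^3\sqrt M\,[1-\nu_2]^{-1}$$ and $\nu_1,\nu_2>0$ are any fixed numbers with $\nu_1+\nu_2<1$. **Theorem 3.** Let $1/2\le r\le s-1$ be real, and let $p$ and $\Psi$ be $r$ times continuously differentiable in a neighbourhood of $y$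 (for non-integer $r$: $\lfloor r\rfloor$ times continuously differentiable, with $\lfloor r\rfloor$-th derivative Hölder of exponent $r-\lfloor r\rfloor$). Suppose that for some constants $\alpha\in\mathbb R$, $C_\gamma$, $C_u$ and all sufficiently large $m$, $$\gamma_m^2\le C_\gamma2^{\alpha m}\qquad\text{and}\qquad\|u_{m,k}\|_\infty\le C_u2^{m/2}\gamma_m\quad\text{for all }k\in K_{m,y}.$$ Then, for all sufficiently large $n$, the risk $\mathbb E|\widehat t_{\widehat m}(y)-t(y)|^2$ is finite, and as $n\to\infty$ $$\mathbb E\,|\widehat t_{\widehat m}(y)-t(y)|^2=O\Bigl(n^{-\frac{2r}{2r+1+\max(\alpha,0)}}\log n\Bigr).$$ -/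

import Mathlib

open MeasureTheory ProbabilityTheory Filter Topology Asymptotics

noncomputable section

namespace WaveletEB

/-- Marginal density of an observation: `p(x) = ∫ q(x|θ) g(θ) dθ`, with `q x θ = q(x|θ)`. -/
def marginal (q : ℝ → ℝ → ℝ) (g : ℝ → ℝ) (x : ℝ) : ℝ :=
  ∫ θ, q x θ * g θ

/-- `Ψ(x) = ∫ θ q(x|θ) g(θ) dθ`. -/
def bayesNum (q : ℝ → ℝ → ℝ) (g : ℝ → ℝ) (x : ℝ) : ℝ :=
  ∫ θ, θ * q x θ * g θ

/-- The Bayes estimator `t(y) = Ψ(y) / p(y)`. -/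
def bayesEst (q : ℝ → ℝ → ℝ) (g : ℝ → ℝ) (y : ℝ) : ℝ :=
  bayesNum q g y / marginal q g y

/-- The `L^∞(ℝ)` norm. -/
def supNorm (f : ℝ → ℝ) : ℝ :=
  (eLpNorm f ⊤ (volume : Measure ℝ)).toReal

/-- `f` is `r` times continuously differentiable in a neighbourhood of `y`, for real `r ≥ 0`:
near `y` it is `C^l` with `l = ⌊r⌋`, and `f^(l)` is Hölder with exponent `r - l`.
When `r` is an integer the exponent is `0`, so the last clause only asks `f^(l)` to be bounded
near `y`, which follows from its continuity. -/
def SmoothNear (r : ℝ) (f : ℝ → ℝ) (y : ℝ) : Prop :=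
  ∃ ε > 0, ContDiffOn ℝ (⌊r⌋₊ : ℕ) f (Metric.ball y ε) ∧
    ∃ L : ℝ, ∀ x ∈ Metric.ball y ε, ∀ z ∈ Metric.ball y ε,
      |iteratedDeriv ⌊r⌋₊ f x - iteratedDeriv ⌊r⌋₊ f z| ≤ L * |x - z| ^ (r - (⌊r⌋₊ : ℝ))

/-- A twice continuously differentiable orthonormal scaling function, supported in `[M₁, M₂]`,
whose projection kernel reproduces the polynomials of degree at most `s - 1`. -/
structure IsScaling (φ : ℝ → ℝ) (M₁ M₂ : ℝ) (s : ℕ) : Prop where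
  contDiff : ContDiff ℝ 2 φ
  support_subset : Function.support φ ⊆ Set.Icc M₁ M₂
  orthonormal : ∀ k l : ℤ, ∫ x, φ (x - k) * φ (x - l) = if k = l then 1 else 0
  reproduces : ∀ i : ℕ, i < s → ∀ z : ℝ,
    ∫ x, x ^ i * ∑' k : ℤ, φ (x - k) * φ (z - k) = z ^ i

/-- `φ_{m,k}(x) = 2^{m/2} φ(2^m x - k)`. -/
def phi (φ : ℝ → ℝ) (m : ℕ) (k : ℤ) (x : ℝ) : ℝ :=
  √((2 : ℝ) ^ m) * φ ((2 : ℝ) ^ m * x - k)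

/-- The finite set `K_{m,y}` of indices kept in the linear system. -/
def idx (M₁ M₂ : ℝ) (s : ℕ) (y : ℝ) (m : ℕ) : Finset ℤ :=
  Finset.Icc ⌈(2 : ℝ) ^ m * y - M₂ - s * (M₂ - M₁)⌉ ⌊(2 : ℝ) ^ m * y - M₁ + s * (M₂ - M₁)⌋

theorem mem_idx (M₁ M₂ : ℝ) (s : ℕ) (y : ℝ) (m : ℕ) (k : ℤ) :
    k ∈ idx M₁ M₂ s y m ↔
      (2 : ℝ) ^ m * y - M₂ - s * (M₂ - M₁) ≤ k ∧ (k : ℝ) ≤ (2 : ℝ) ^ m * y - M₁ + s * (M₂ - M₁) := by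
  rw [idx, Finset.mem_Icc, Int.ceil_le, Int.le_floor]

/-- The size `M` of the linear systems. The cardinality of `K_{m,y}` may vary by one with `m`;
`M` is its largest value. -/
def sysSize (M₁ M₂ : ℝ) (s : ℕ) (y : ℝ) : ℕ :=
  ⨆ m : ℕ, (idx M₁ M₂ s y m).card

/-- The component `γ_k^{(1)}(m) = (∫ u_{m,k}(x)² dx)^{1/2}`. -/
def gammaComp (u : ℕ → ℤ → ℝ → ℝ) (m : ℕ) (k : ℤ) : ℝ :=
  √(∫ x, u m k x ^ 2)

/-- `γ_m`, the Euclidean norm of the vector of the `γ_k^{(1)}(m)`, `k ∈ K_{m,y}`. -/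
def gam (M₁ M₂ : ℝ) (s : ℕ) (y : ℝ) (u : ℕ → ℤ → ℝ → ℝ) (m : ℕ) : ℝ :=
  √(∑ k ∈ idx M₁ M₂ s y m, gammaComp u m k ^ 2)

/-- The matrix of sample means `B̂_{j,k} = n⁻¹ ∑_l φ_{m,k}(X_l) φ_{m,j}(X_l)`. -/
def Bhat (φ : ℝ → ℝ) (M₁ M₂ : ℝ) (s : ℕ) (y : ℝ) (m : ℕ) {n : ℕ} (x : Fin n → ℝ) :
    Matrix (idx M₁ M₂ s y m) (idx M₁ M₂ s y m) ℝ :=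
  Matrix.of fun j k => (n : ℝ)⁻¹ * ∑ l, phi φ m k (x l) * phi φ m j (x l)

/-- The vector of sample means `ĉ_j = n⁻¹ ∑_l u_{m,j}(X_l)`. -/
def chat (M₁ M₂ : ℝ) (s : ℕ) (y : ℝ) (u : ℕ → ℤ → ℝ → ℝ) (m : ℕ) {n : ℕ} (x : Fin n → ℝ) :
    idx M₁ M₂ s y m → ℝ :=
  fun j => (n : ℝ)⁻¹ * ∑ l, u m j (x l)

/-- `B̂_{δ_m} = B̂ + δ_m I` with `δ_m = 2^{m/2} n^{-1/2}`. -/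
def Bdelta (φ : ℝ → ℝ) (M₁ M₂ : ℝ) (s : ℕ) (y : ℝ) (m : ℕ) {n : ℕ} (x : Fin n → ℝ) :
    Matrix (idx M₁ M₂ s y m) (idx M₁ M₂ s y m) ℝ :=
  Bhat φ M₁ M₂ s y m x + √((2 : ℝ) ^ m / n) • (1 : Matrix _ _ ℝ)

/-- The EB estimator at resolution level `m`: `t̂_m(y) = ∑_{k ∈ K_{m,y}} â_k φ_{m,k}(y)` with
`â = B̂_{δ_m}⁻¹ ĉ`. -/
def that (φ : ℝ → ℝ) (M₁ M₂ : ℝ) (s : ℕ) (y : ℝ) (u : ℕ → ℤ → ℝ → ℝ) (m : ℕ)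
    {n : ℕ} (x : Fin n → ℝ) : ℝ :=
  ∑ k, ((Bdelta φ M₁ M₂ s y m x)⁻¹.mulVec (chat M₁ M₂ s y u m x)) k * phi φ m k y

/-- The spectral norm `‖B̂_{δ_m}⁻¹‖`. -/
def invNorm (φ : ℝ → ℝ) (M₁ M₂ : ℝ) (s : ℕ) (y : ℝ) (m : ℕ) {n : ℕ} (x : Fin n → ℝ) : ℝ :=
  ‖Matrix.toEuclideanCLM (𝕜 := ℝ) (Bdelta φ M₁ M₂ s y m x)⁻¹‖

/-- `ρ²_{mn} = 2^m (1 + γ_m²) n⁻¹ log n`. -/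
def rhoSq (M₁ M₂ : ℝ) (s : ℕ) (y : ℝ) (u : ℕ → ℤ → ℝ → ℝ) (m n : ℕ) : ℝ :=
  (2 : ℝ) ^ m * (1 + gam M₁ M₂ s y u m ^ 2) * (n : ℝ)⁻¹ * Real.log n

/-- Lepski's choice of the level with constant `lam`: the least `m` in `{m₁, …, m₂}` such that
`|t̂_m(y) - t̂_j(y)|² ≤ lam² [‖B̂_{δ_m}⁻¹‖² + ‖B̂_{δ_j}⁻¹‖²]² ρ²_{jn}` for all `j ≥ m` in
`{m₁, …, m₂}`. If `m₁ ≤ m₂` such `m` exist, `m = m₂` being one. -/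
def mhat (φ : ℝ → ℝ) (M₁ M₂ : ℝ) (s : ℕ) (y : ℝ) (u : ℕ → ℤ → ℝ → ℝ) (lam : ℝ) (m₁ m₂ : ℕ)
    {n : ℕ} (x : Fin n → ℝ) : ℕ :=
  sInf {m : ℕ | m ∈ Set.Icc m₁ m₂ ∧ ∀ j ∈ Set.Icc m₁ m₂, m ≤ j →
    |that φ M₁ M₂ s y u m x - that φ M₁ M₂ s y u j x| ^ 2 ≤
      lam ^ 2 * (invNorm φ M₁ M₂ s y m x ^ 2 + invNorm φ M₁ M₂ s y j x ^ 2) ^ 2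
        * rhoSq M₁ M₂ s y u j n}

/-- `C_φ = sup_z ∑_k |φ(z - k)|`. -/
def Cphi (φ : ℝ → ℝ) : ℝ :=
  ⨆ z : ℝ, ∑' k : ℤ, |φ (z - k)|

/-- The constant `D`, from the functions `φ`, `p`, `Ψ`, the size `M` and `ν₁`, `ν₂`. -/
def Dconst (φ p Ψ : ℝ → ℝ) (M : ℕ) (ν₁ ν₂ : ℝ) : ℝ :=
  supNorm p
    + supNorm Ψ * supNorm φ * M * √M * (1 - ν₁) ^ (-(1 / 2) : ℝ)
    + 16 * supNorm Ψ * supNorm φ ^ 2 * supNorm p ^ (3 / 2 : ℝ) * (M : ℝ) ^ 3 * √M * (1 - ν₂)⁻¹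

/-- The constant `λ = 16 C_φ ‖p‖_∞^{1/2} √M D + 1`. -/
def lamConst (φ p Ψ : ℝ → ℝ) (M : ℕ) (ν₁ ν₂ : ℝ) : ℝ :=
  16 * Cphi φ * supNorm p ^ (1 / 2 : ℝ) * √M * Dconst φ p Ψ M ν₁ ν₂ + 1

/-- The adaptive estimator `t̂_{m̂}(y)` with Lepski's `m̂` and the constant `λ` above. -/
def thatAdaptive (q : ℝ → ℝ → ℝ) (g φ : ℝ → ℝ) (M₁ M₂ : ℝ) (s : ℕ) (y : ℝ)
    (u : ℕ → ℤ → ℝ → ℝ) (ν₁ ν₂ : ℝ) (m₁ m₂ : ℕ) {n : ℕ} (x : Fin n → ℝ) : ℝ :=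
  that φ M₁ M₂ s y u
    (mhat φ M₁ M₂ s y u
      (lamConst φ (marginal q g) (bayesNum q g) (sysSize M₁ M₂ s y) ν₁ ν₂) m₁ m₂ x) x

end WaveletEB

end

/-! The quotient t = Ψ/p solves t p = Ψ. Tested against the φ_{m,j} near y, this becomes a small
linear system B a = c with B_{jk} = ∫ φ_{m,j} φ_{m,k} p and c_j = ∫ φ_{m,j} Ψ. Fubini and the
equation for u_{m,j} turn c_j into the expectation of u_{m,j}(X), so both sides have unbiased sample
means. Orthonormality and continuity of p at y make B converge to p(y) I; the systems are therefore
uniformly well conditioned.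

Bias. Dividing the Taylor polynomials of Ψ and p gives Q of degree below s with Q(y) = t(y) and Ψ -
Q p = O(|x - y|^r) (`SmoothNear.exists_quotient_polynomial`). Wavelets reproduce Q, so its
coefficients solve the system up to a small residual, except in rows near the ends of the index set,
where the expansion is truncated. As B is banded with off-diagonal entries of order 2^{-m min(r,1)},
each bandwidth towards the centre gains that factor (`exists_abs_coeff_sub_le`). The s extra
bandwidths in the index set bring the truncation effect below 2^{-rm} (`exists_bias_le`).

Noise. A Bernstein-type inequality (`measure_abs_mean_sub_ge_le`) controls the sample means on two
events. On the coarse event all empirical matrices are near their limits, and ĉ at the last level is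
near c. It fails with probability smaller than any power of n, because 2^m (1 + γ_m²) log² n = O(n)
at the last level (`measure_not_coarse_le`). On the sharp event the deviations at all levels from
the balanced level on are at most √(log n) times their standard deviations, up to constants; it
fails with probability O(log n / n) (`measure_not_sharp_le`). On both events the error at level m is
at most ‖B̂_δ⁻¹‖² ((λ - 1/2) ρ_m + O(2^{-rm})) (`FineLevel.abs_that_sub_le_rho`), which is the form
that Lepski's threshold requires.

Risk. On both events Lepski's rule satisfies an oracle inequality relative to the balanced level 2^m
≈ n^{1/(2r+1+max(α,0))} (`abs_that_mhat_sub_le_oracle`). On the coarse event alone the error is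
bounded by a constant, since the selected level is always compared with the last one. Elsewhere the
ridge δ_m gives a polynomial bound in n, beaten by the probability of the event.
`integral_le_of_bounds` adds the three contributions, and `exists_risk_le` carries this out. -/

noncomputable section

namespace WaveletEB

/-! ### Euclidean norms of finite vectors and spectral norms of matrices -/

section Euclidean

variable {ι : Type*} [Fintype ι]

/-- The Euclidean norm of a finite real vector. -/
def l2 (v : ι → ℝ) : ℝ := ‖(WithLp.toLp 2 v : EuclideanSpace ℝ ι)‖

lemma l2_nonneg (v : ι → ℝ) : 0 ≤ l2 v := norm_nonneg _

lemma l2_sq (v : ι → ℝ) : l2 v ^ 2 = ∑ i, v i ^ 2 := by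
  simp [l2, EuclideanSpace.norm_sq_eq]

lemma l2_add_le (v w : ι → ℝ) : l2 (v + w) ≤ l2 v + l2 w := by
  simpa [l2] using norm_add_le (WithLp.toLp 2 v : EuclideanSpace ℝ ι) (WithLp.toLp 2 w)

lemma l2_sub_le (v w : ι → ℝ) : l2 (v - w) ≤ l2 v + l2 w := by
  simpa [l2] using norm_sub_le (WithLp.toLp 2 v : EuclideanSpace ℝ ι) (WithLp.toLp 2 w)

lemma l2_smul (c : ℝ) (v : ι → ℝ) : l2 (c • v) = |c| * l2 v := by
  simpa [l2] using norm_smul c (WithLp.toLp 2 v : EuclideanSpace ℝ ι)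

lemma abs_dot_le_l2 (v w : ι → ℝ) : |∑ i, v i * w i| ≤ l2 v * l2 w := by
  have h := abs_real_inner_le_norm (WithLp.toLp 2 w : EuclideanSpace ℝ ι) (WithLp.toLp 2 v)
  simp only [PiLp.inner_apply, RCLike.inner_apply, conj_trivial] at h
  rw [mul_comm (l2 v)]
  exact h

lemma abs_le_l2 (v : ι → ℝ) (i : ι) : |v i| ≤ l2 v := by
  refine abs_le_of_sq_le_sq ?_ (l2_nonneg v)
  rw [l2_sq]
  exact Finset.single_le_sum (f := fun i => v i ^ 2) (fun _ _ => sq_nonneg _) (Finset.mem_univ i)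

lemma l2_le_of_abs_le {v : ι → ℝ} {c : ℝ} (hc : 0 ≤ c) (h : ∀ i, |v i| ≤ c) :
    l2 v ≤ √(Fintype.card ι) * c := by
  refine (sq_le_sq₀ (l2_nonneg v) (by positivity)).1 ?_
  rw [l2_sq, mul_pow, Real.sq_sqrt (by positivity)]
  calc ∑ i, v i ^ 2 ≤ ∑ _i : ι, c ^ 2 :=
        Finset.sum_le_sum fun i _ => sq_le_sq' (abs_le.1 (h i)).1 (abs_le.1 (h i)).2
    _ = _ := by simp

lemma sum_abs_le_l2 (v : ι → ℝ) : ∑ i, |v i| ≤ √(Fintype.card ι) * l2 v := by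
  have h := abs_dot_le_l2 (fun i => |v i|) (fun _ => (1 : ℝ))
  have h1 : l2 (fun _ : ι => (1 : ℝ)) ≤ √(Fintype.card ι) := by
    simpa using l2_le_of_abs_le (v := fun _ : ι => (1 : ℝ)) zero_le_one (by simp)
  have h2 : l2 (fun i => |v i|) = l2 v := by
    have : l2 (fun i => |v i|) ^ 2 = l2 v ^ 2 := by simp [l2_sq]
    exact (sq_eq_sq₀ (l2_nonneg _) (l2_nonneg _)).1 this
  rw [h2] at h
  simp only [mul_one] at h
  calc _ ≤ abs (∑ i, |v i|) := le_abs_self _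
    _ ≤ _ := h
    _ ≤ l2 v * √(Fintype.card ι) := by gcongr; exact l2_nonneg v
    _ = _ := mul_comm _ _

variable [DecidableEq ι]

/-- The spectral norm of a matrix. -/
def specNorm (A : Matrix ι ι ℝ) : ℝ := ‖Matrix.toEuclideanCLM (𝕜 := ℝ) A‖

lemma l2_mulVec_le (A : Matrix ι ι ℝ) (v : ι → ℝ) : l2 (A.mulVec v) ≤ specNorm A * l2 v :=
  (Matrix.toEuclideanCLM (𝕜 := ℝ) A).le_opNorm (WithLp.toLp 2 v)

/-- A matrix bounded below is injective, hence invertible. -/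
lemma isUnit_det_of_l2_le {A : Matrix ι ι ℝ} {c : ℝ} (hc : 0 < c)
    (h : ∀ v, c * l2 v ≤ l2 (A.mulVec v)) : IsUnit A.det := by
  rw [← Matrix.isUnit_iff_isUnit_det, ← Matrix.mulVec_injective_iff_isUnit]
  intro v w hvw
  have h1 := h (v - w)
  rw [Matrix.mulVec_sub, hvw, sub_self] at h1
  have h0 : l2 (0 : ι → ℝ) = 0 := by simp [l2]
  rw [h0] at h1
  have h2 : l2 (v - w) = 0 := le_antisymm (by nlinarith [l2_nonneg (v - w)]) (l2_nonneg _)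
  ext i
  have h3 := abs_le_l2 (v - w) i
  rw [h2] at h3
  have := abs_eq_zero.1 (le_antisymm h3 (abs_nonneg _))
  simpa [sub_eq_zero] using this

lemma mulVec_inv_mulVec {A : Matrix ι ι ℝ} (h : IsUnit A.det) (v : ι → ℝ) :
    A.mulVec (A⁻¹.mulVec v) = v := by
  rw [Matrix.mulVec_mulVec, Matrix.mul_nonsing_inv _ h, Matrix.one_mulVec]

lemma inv_mulVec_mulVec {A : Matrix ι ι ℝ} (h : IsUnit A.det) (v : ι → ℝ) :
    A⁻¹.mulVec (A.mulVec v) = v := by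
  rw [Matrix.mulVec_mulVec, Matrix.nonsing_inv_mul _ h, Matrix.one_mulVec]

lemma specNorm_inv_le {A : Matrix ι ι ℝ} {c : ℝ} (hc : 0 < c)
    (h : ∀ v, c * l2 v ≤ l2 (A.mulVec v)) : specNorm A⁻¹ ≤ c⁻¹ := by
  refine ContinuousLinearMap.opNorm_le_bound _ (by positivity) fun x => ?_
  have h1 := h (A⁻¹.mulVec (WithLp.ofLp x))
  rw [mulVec_inv_mulVec (isUnit_det_of_l2_le hc h)] at h1
  change l2 (A⁻¹.mulVec (WithLp.ofLp x)) ≤ c⁻¹ * l2 (WithLp.ofLp x)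
  rwa [inv_mul_eq_div, le_div_iff₀ hc, mul_comm]

/-- Follows from v = A (A⁻¹ v) for a unit vector v. It serves to replace a factor ‖B̂_δ⁻¹‖, or a
constant, by a multiple of ‖B̂_δ⁻¹‖², the quantity in Lepski's threshold. -/
lemma one_le_mul_specNorm_inv [Nonempty ι] {A : Matrix ι ι ℝ} {C : ℝ} (hA : IsUnit A.det)
    (h : ∀ v, l2 (A.mulVec v) ≤ C * l2 v) : 1 ≤ C * specNorm A⁻¹ := by
  obtain ⟨i⟩ := ‹Nonempty ι›
  set v : ι → ℝ := Pi.single i 1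
  have hv : 0 < l2 v := lt_of_lt_of_le (by simp [v]) (abs_le_l2 v i)
  have hC : 0 ≤ C := by
    by_contra hC
    have := (l2_nonneg _).trans (h v)
    nlinarith
  have h1 := h (A⁻¹.mulVec v)
  rw [mulVec_inv_mulVec hA] at h1
  have h2 : l2 v ≤ C * (specNorm A⁻¹ * l2 v) :=
    h1.trans (mul_le_mul_of_nonneg_left (l2_mulVec_le _ _) hC)
  by_contra hlt
  push Not at hlt
  nlinarith

/-- One factor √card comes from the sum over columns (Cauchy–Schwarz), the other from passing from
the entries of a vector to its Euclidean norm. -/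
lemma abs_l2_mulVec_sub_le {A : Matrix ι ι ℝ} {c ε : ℝ} (hε : 0 ≤ ε)
    (h : ∀ i j, |A i j - (if i = j then c else 0)| ≤ ε) (v : ι → ℝ) :
    l2 (A.mulVec v - c • v) ≤ Fintype.card ι * ε * l2 v := by
  have key : ∀ i, |(A.mulVec v - c • v) i| ≤ ε * (√(Fintype.card ι) * l2 v) := by
    intro i
    have : (A.mulVec v - c • v) i = ∑ j, (A i j - (if i = j then c else 0)) * v j := by
      simp [Matrix.mulVec, dotProduct, sub_mul, Finset.sum_sub_distrib]
    rw [this]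
    calc _ ≤ ∑ j, |(A i j - (if i = j then c else 0)) * v j| := Finset.abs_sum_le_sum_abs _ _
      _ ≤ ∑ j, ε * |v j| := Finset.sum_le_sum fun j _ => by
          rw [abs_mul]; exact mul_le_mul_of_nonneg_right (h i j) (abs_nonneg _)
      _ = ε * ∑ j, |v j| := by rw [Finset.mul_sum]
      _ ≤ _ := mul_le_mul_of_nonneg_left (sum_abs_le_l2 v) hε
  have := l2_le_of_abs_le (by have := l2_nonneg v; positivity) key
  refine this.trans (le_of_eq ?_)
  have h2 : √(Fintype.card ι : ℝ) * √(Fintype.card ι) = Fintype.card ι :=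
    Real.mul_self_sqrt (by positivity)
  calc _ = (√(Fintype.card ι : ℝ) * √(Fintype.card ι)) * ε * l2 v := by ring
    _ = _ := by rw [h2]

lemma l2_mulVec_bounds {A : Matrix ι ι ℝ} {c ε : ℝ} (hc : 0 < c) (hε : 0 ≤ ε)
    (hcard : Fintype.card ι * ε ≤ c / 2)
    (h : ∀ i j, |A i j - (if i = j then c else 0)| ≤ ε) (v : ι → ℝ) :
    c / 2 * l2 v ≤ l2 (A.mulVec v) ∧ l2 (A.mulVec v) ≤ 3 * c / 2 * l2 v := by
  have h1 := (abs_l2_mulVec_sub_le hε h v).trans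
    (mul_le_mul_of_nonneg_right hcard (l2_nonneg v))
  have h2 : l2 (c • v) = c * l2 v := by rw [l2_smul, abs_of_pos hc]
  have h3 := l2_add_le (A.mulVec v - c • v) (c • v)
  have h4 := l2_sub_le (A.mulVec v) (A.mulVec v - c • v)
  rw [sub_add_cancel] at h3
  rw [sub_sub_cancel] at h4
  constructor <;> linarith

end Euclidean

/-! ### An exponential inequality for sample means of bounded variables -/

section Bernstein

variable {Ω : Type*} [MeasurableSpace Ω] {P : Measure Ω} [IsProbabilityMeasure P]

/-- Integrates exp z ≤ 1 + z + z², valid for |z| ≤ 1. The coefficient 1 of z², in place of 1/2, is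
the source of the constant 4 in the tail bounds below. -/
lemma mgf_le_of_abs_le {Z : Ω → ℝ} (hZ : Measurable Z) {b V t : ℝ}
    (hb : ∀ᵐ ω ∂P, |Z ω| ≤ b) (hmean : ∫ ω, Z ω ∂P = 0) (hV : ∫ ω, Z ω ^ 2 ∂P ≤ V)
    (ht : |t| * b ≤ 1) : mgf Z P t ≤ Real.exp (t ^ 2 * V) := by
  have hint : Integrable Z P := Integrable.of_bound hZ.aestronglyMeasurable b hb
  have hint2 : Integrable (fun ω => Z ω ^ 2) P := by
    refine Integrable.of_bound (hZ.pow_const 2).aestronglyMeasurable (b ^ 2) ?_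
    filter_upwards [hb] with ω hω
    rw [Real.norm_eq_abs, abs_pow]
    exact pow_le_pow_left₀ (abs_nonneg _) hω 2
  have hle : ∀ᵐ ω ∂P, Real.exp (t * Z ω) ≤ 1 + t * Z ω + t ^ 2 * Z ω ^ 2 := by
    filter_upwards [hb] with ω hω
    have h1 : |t * Z ω| ≤ 1 := by
      rw [abs_mul]
      exact (mul_le_mul_of_nonneg_left hω (abs_nonneg _)).trans ht
    have := (abs_le.1 (Real.abs_exp_sub_one_sub_id_le h1)).2
    nlinarith
  have hI : Integrable (fun ω => 1 + t * Z ω + t ^ 2 * Z ω ^ 2) P :=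
    ((integrable_const _).add (hint.const_mul t)).add (hint2.const_mul _)
  have hint3 : Integrable (fun ω => Real.exp (t * Z ω)) P := by
    refine Integrable.mono' hI (by fun_prop) ?_
    filter_upwards [hle] with ω hω
    rwa [Real.norm_eq_abs, Real.abs_exp]
  calc mgf Z P t ≤ ∫ ω, (1 + t * Z ω + t ^ 2 * Z ω ^ 2) ∂P := integral_mono_ae hint3 hI hle
    _ = 1 + t ^ 2 * ∫ ω, Z ω ^ 2 ∂P := by
        have h1 : Integrable (fun ω => 1 + t * Z ω) P := (integrable_const _).add (hint.const_mul t)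
        rw [integral_add h1 (hint2.const_mul _),
          integral_add (integrable_const _) (hint.const_mul t), integral_const_mul,
          integral_const_mul, hmean]
        simp
    _ ≤ 1 + t ^ 2 * V := by gcongr
    _ ≤ _ := by rw [add_comm]; exact Real.add_one_le_exp _

lemma measure_sum_ge_le {Z : ℕ → Ω → ℝ} (hZ : ∀ i, Measurable (Z i))
    (hind : iIndepFun Z P) {b V x : ℝ} (hb : ∀ i, ∀ᵐ ω ∂P, |Z i ω| ≤ b)
    (hmean : ∀ i, ∫ ω, Z i ω ∂P = 0) (hV : ∀ i, ∫ ω, Z i ω ^ 2 ∂P ≤ V)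
    (hV0 : 0 < V) (hx : 0 ≤ x) (hxb : x * b ≤ 2 * V) (n : ℕ) :
    P.real {ω | n * x ≤ ∑ l : Fin n, Z l ω} ≤ Real.exp (-(n * x ^ 2 / (4 * V))) := by
  have hb0 : 0 ≤ b := by
    obtain ⟨ω, hω⟩ := (hb 0).exists
    exact (abs_nonneg _).trans hω
  -- Chernoff's bound with the minimiser of t² V - t x; the hypothesis x b ≤ 2 V says exactly that t
  -- b ≤ 1.
  set t : ℝ := x / (2 * V) with htdef
  have ht : 0 ≤ t := by positivity
  have htb : |t| * b ≤ 1 := by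
    rw [abs_of_nonneg ht, htdef, div_mul_eq_mul_div, div_le_one (by positivity)]
    linarith
  have hind' : iIndepFun (fun (l : Fin n) => Z l) P := hind.precomp Fin.val_injective
  have hmgf : mgf (∑ l : Fin n, Z l) P t ≤ Real.exp (n * (t ^ 2 * V)) := by
    rw [hind'.mgf_sum (fun l => hZ l), Real.exp_nat_mul]
    calc _ ≤ ∏ _l : Fin n, Real.exp (t ^ 2 * V) :=
          Finset.prod_le_prod (fun _ _ => mgf_nonneg)
            fun l _ => mgf_le_of_abs_le (hZ l) (hb l) (hmean l) (hV l) htb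
      _ = _ := by simp
  have hint : Integrable (fun ω => Real.exp (t * (∑ l : Fin n, Z l) ω)) P := by
    refine Integrable.of_bound (C := Real.exp (t * (n * b))) ?_ ?_
    · have : Measurable (∑ l : Fin n, Z l) := by
        rw [Finset.sum_fn]; exact Finset.measurable_sum _ fun l _ => hZ l
      fun_prop
    · have : ∀ᵐ ω ∂P, ∀ l : Fin n, |Z l ω| ≤ b := ae_all_iff.2 fun l => hb l
      filter_upwards [this] with ω hω
      rw [Real.norm_eq_abs, Real.abs_exp, Finset.sum_apply]
      have : ∑ l : Fin n, Z l ω ≤ ∑ _l : Fin n, b :=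
        Finset.sum_le_sum fun l _ => (le_abs_self _).trans (hω l)
      simp only [Finset.sum_const, Finset.card_univ, Fintype.card_fin, nsmul_eq_mul] at this
      gcongr
  have h := measure_ge_le_exp_mul_mgf (n * x) ht hint
  have hset : {ω | n * x ≤ ∑ l : Fin n, Z l ω} = {ω | n * x ≤ (∑ l : Fin n, Z l) ω} := by
    ext; simp
  rw [hset]
  refine h.trans ((mul_le_mul_of_nonneg_left hmgf (Real.exp_nonneg _)).trans (le_of_eq ?_))
  rw [← Real.exp_add]
  congr 1
  rw [htdef]
  field_simp
  ring

/-- If `|Y| ≤ b`, `E Y² ≤ V` and `x b ≤ V`, then the mean of `n` independent copies of `Y`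
deviates from the expectation by `x` with probability at most `2 exp(-n x² / (4 V))`. -/
lemma measure_abs_mean_sub_ge_le {Y : ℕ → Ω → ℝ} (hY : ∀ i, Measurable (Y i))
    (hind : iIndepFun Y P) {b V x μ : ℝ} (hb : ∀ i, ∀ᵐ ω ∂P, |Y i ω| ≤ b)
    (hmean : ∀ i, ∫ ω, Y i ω ∂P = μ) (hV : ∀ i, ∫ ω, Y i ω ^ 2 ∂P ≤ V)
    (hV0 : 0 < V) (hx : 0 ≤ x) (hxb : x * b ≤ V) {n : ℕ} (hn : 0 < n) :
    P.real {ω | x ≤ |(n : ℝ)⁻¹ * ∑ l : Fin n, Y l ω - μ|} ≤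
      2 * Real.exp (-(n * x ^ 2 / (4 * V))) := by
  have hint : ∀ i, Integrable (Y i) P := fun i =>
    Integrable.of_bound (hY i).aestronglyMeasurable b (hb i)
  have hint2 : ∀ i, Integrable (fun ω => Y i ω ^ 2) P := fun i => by
    refine Integrable.of_bound ((hY i).pow_const 2).aestronglyMeasurable (b ^ 2) ?_
    filter_upwards [hb i] with ω hω
    rw [Real.norm_eq_abs, abs_pow]
    exact pow_le_pow_left₀ (abs_nonneg _) hω 2
  have hμ : |μ| ≤ b := by
    rw [← hmean 0]
    simpa using norm_integral_le_of_norm_le_const (μ := P) (f := Y 0) (hb 0)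
  have hvar : ∀ i, ∫ ω, (Y i ω - μ) ^ 2 ∂P ≤ V := fun i => by
    have : ∫ ω, (Y i ω - μ) ^ 2 ∂P = ∫ ω, Y i ω ^ 2 ∂P - μ ^ 2 := by
      have h1 : ∀ ω, (Y i ω - μ) ^ 2 = Y i ω ^ 2 - 2 * μ * Y i ω + μ ^ 2 := fun ω => by ring
      simp_rw [h1]
      have h2 : Integrable (fun ω => Y i ω ^ 2 - 2 * μ * Y i ω) P :=
        (hint2 i).sub ((hint i).const_mul _)
      rw [integral_add h2 (integrable_const _),
        integral_sub (hint2 i) ((hint i).const_mul _), integral_const_mul, hmean i]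
      simp
      ring
    rw [this]
    nlinarith [hV i, sq_nonneg μ]
  -- The sign σ treats both tails at once. Centring doubles the bound to 2 b, which is why the range
  -- condition is x b ≤ V here and x b ≤ 2 V above.
  have hcore : ∀ σ : ℝ, |σ| = 1 → P.real {ω | n * x ≤ ∑ l : Fin n, σ * (Y l ω - μ)} ≤
      Real.exp (-(n * x ^ 2 / (4 * V))) := by
    intro σ hσ
    have hσ2 : σ ^ 2 = 1 := by rw [← sq_abs, hσ, one_pow]
    refine measure_sum_ge_le (Z := fun i ω => σ * (Y i ω - μ)) (b := 2 * b)
      (fun i => ((hY i).sub_const μ).const_mul σ) ?_ ?_ ?_ ?_ hV0 hx (by linarith) n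
    · exact hind.comp (fun _ z => σ * (z - μ)) (fun _ => by fun_prop)
    · intro i
      filter_upwards [hb i] with ω hω
      rw [abs_mul, hσ, one_mul]
      exact (abs_sub _ _).trans (by linarith)
    · intro i
      rw [integral_const_mul, integral_sub (hint i) (integrable_const _), hmean i]
      simp
    · intro i
      simp_rw [mul_pow, hσ2, one_mul]
      exact hvar i
  have hn' : (0 : ℝ) < n := by exact_mod_cast hn
  have hsub : {ω | x ≤ |(n : ℝ)⁻¹ * ∑ l : Fin n, Y l ω - μ|} ⊆
      {ω | n * x ≤ ∑ l : Fin n, 1 * (Y l ω - μ)} ∪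
        {ω | n * x ≤ ∑ l : Fin n, (-1) * (Y l ω - μ)} := by
    intro ω hω
    have hs : ∑ l : Fin n, (Y l ω - μ) = n * ((n : ℝ)⁻¹ * ∑ l : Fin n, Y l ω - μ) := by
      rw [Finset.sum_sub_distrib]
      simp
      field_simp
    simp only [Set.mem_union, Set.mem_ofPred_eq, ← Finset.mul_sum, hs] at hω ⊢
    rcases le_abs.1 hω with h | h
    · left
      rw [one_mul]
      gcongr
    · right
      have := mul_le_mul_of_nonneg_left h hn'.le
      linarith
  calc _ ≤ _ := measureReal_mono hsub
    _ ≤ _ := measureReal_union_le _ _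
    _ ≤ _ := by
      have h1 := hcore 1 (by simp)
      have h2 := hcore (-1) (by simp)
      linarith

end Bernstein

/-! ### Local polynomial approximation of functions that are Hölder of order `r` -/

section Taylor

open Polynomial

lemma exists_antideriv (T : ℝ[X]) (c : ℝ) :
    ∃ S : ℝ[X], derivative S = T ∧ S.eval 0 = c ∧ S.natDegree ≤ T.natDegree + 1 := by
  refine ⟨C c + ∑ i ∈ Finset.range (T.natDegree + 1), C (T.coeff i / (i + 1)) * X ^ (i + 1),
    ?_, ?_, ?_⟩
  · conv_rhs => rw [T.as_sum_range_C_mul_X_pow]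
    rw [derivative_add, derivative_C, zero_add, derivative_sum]
    refine Finset.sum_congr rfl fun i _ => ?_
    rw [derivative_C_mul_X_pow]
    congr 2
    push_cast
    field_simp
  · simp [eval_finsetSum]
  · refine natDegree_add_le_of_degree_le (by simp) ?_
    refine natDegree_sum_le_of_forall_le _ _ fun i hi => ?_
    exact (natDegree_C_mul_X_pow_le _ _).trans (by simpa using Nat.lt_succ_iff.1 (by simpa using hi))

/-- Induction on the order: the polynomial for f is the primitive, with value f(y) at 0, of the one
for f'. The mean value inequality on the closed ball of radius |x - y| supplies one more power of |x
- y|. -/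
lemma exists_taylor_polynomial {y ε β K : ℝ} (hβ : 0 ≤ β) (hK : 0 ≤ K) (l : ℕ) :
    ∀ f : ℝ → ℝ, ContDiffOn ℝ l f (Metric.ball y ε) →
      (∀ x ∈ Metric.ball y ε, |iteratedDeriv l f x - iteratedDeriv l f y| ≤ K * |x - y| ^ β) →
      ∃ T : ℝ[X], T.natDegree ≤ l ∧ T.eval 0 = f y ∧
        ∀ x ∈ Metric.ball y ε, |f x - T.eval (x - y)| ≤ K * |x - y| ^ (l + β) := by
  induction l with
  | zero =>
    intro f _ hf
    refine ⟨C (f y), by simp, by simp, fun x hx => ?_⟩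
    simpa using hf x hx
  | succ l ih =>
    intro f hf hfl
    have hopen : IsOpen (Metric.ball y ε) := Metric.isOpen_ball
    rw [Nat.cast_add, Nat.cast_one, contDiffOn_succ_iff_deriv_of_isOpen hopen] at hf
    obtain ⟨hdiff, -, hder⟩ := hf
    rw [iteratedDeriv_succ'] at hfl
    obtain ⟨T', hT'deg, -, hT'⟩ := ih _ hder hfl
    obtain ⟨T, hT, hT0, hTdeg⟩ := exists_antideriv T' (f y)
    refine ⟨T, hTdeg.trans (by omega), hT0, fun x hx => ?_⟩
    set g : ℝ → ℝ := fun z => f z - T.eval (z - y) with hg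
    have hsub : Metric.closedBall y |x - y| ⊆ Metric.ball y ε :=
      Metric.closedBall_subset_ball (by simpa [Real.dist_eq] using hx)
    have hgd : ∀ z ∈ Metric.closedBall y |x - y|,
        HasDerivWithinAt g (deriv f z - T'.eval (z - y)) (Metric.closedBall y |x - y|) z := by
      intro z hz
      have h1 : HasDerivAt f (deriv f z) z :=
        ((hdiff z (hsub hz)).differentiableAt (hopen.mem_nhds (hsub hz))).hasDerivAt
      have h2 : HasDerivAt (fun z => T.eval (z - y)) (T'.eval (z - y)) z := by
        have := (T.hasDerivAt (z - y)).comp z ((hasDerivAt_id z).sub_const y)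
        rw [hT, mul_one] at this
        exact this
      exact (h1.sub h2).hasDerivWithinAt
    have hbound : ∀ z ∈ Metric.closedBall y |x - y|,
        ‖deriv f z - T'.eval (z - y)‖ ≤ K * |x - y| ^ (l + β) := by
      intro z hz
      have hz' : |z - y| ≤ |x - y| := by simpa [Real.dist_eq] using hz
      exact (hT' z (hsub hz)).trans
        (mul_le_mul_of_nonneg_left (Real.rpow_le_rpow (abs_nonneg _) hz' (by positivity)) hK)
    have := (convex_closedBall y |x - y|).norm_image_sub_le_of_norm_hasDerivWithin_le hgd hbound
      (Metric.mem_closedBall_self (abs_nonneg _)) (show x ∈ Metric.closedBall y |x - y| by simp [Real.dist_eq])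
    have hgy : g y = 0 := by simp [hg, hT0]
    rw [hgy, sub_zero, Real.norm_eq_abs, Real.norm_eq_abs] at this
    refine this.trans (le_of_eq ?_)
    -- Adding exponents of a real power needs a nonzero base.
    rcases eq_or_ne (x - y) 0 with h0 | h0
    · have : ((l + 1 : ℕ) : ℝ) + β ≠ 0 := by positivity
      rw [h0, abs_zero, mul_zero, Real.zero_rpow this, mul_zero]
    · rw [mul_assoc, ← Real.rpow_add_one (abs_ne_zero.2 h0)]
      push_cast
      ring_nf

/-- Division of power series truncated at order l: since B(0) ≠ 0, a multiple of X^(l+1) can be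
added to the quotient to cancel the lowest coefficient of the remainder. -/
lemma exists_dvd_sub_mul (A B : ℝ[X]) (hB : B.eval 0 ≠ 0) (l : ℕ) :
    ∃ Q : ℝ[X], Q.natDegree ≤ l ∧ X ^ (l + 1) ∣ A - Q * B := by
  have hB' : B.coeff 0 ≠ 0 := by rwa [coeff_zero_eq_eval_zero]
  induction l with
  | zero =>
    refine ⟨C (A.coeff 0 / B.coeff 0), by simp, ?_⟩
    rw [zero_add, pow_one, X_dvd_iff]
    simp [mul_coeff_zero, hB']
  | succ l ih =>
    obtain ⟨Q, hQ, R, hR⟩ := ih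
    refine ⟨Q + C (R.coeff 0 / B.coeff 0) * X ^ (l + 1), ?_, ?_⟩
    · exact natDegree_add_le_of_degree_le (hQ.trans (by omega)) (natDegree_C_mul_X_pow_le _ _)
    · have h1 : X ∣ R - C (R.coeff 0 / B.coeff 0) * B := by
        rw [X_dvd_iff]
        simp [mul_coeff_zero, hB']
      obtain ⟨W, hW⟩ := h1
      refine ⟨W, ?_⟩
      calc A - (Q + C (R.coeff 0 / B.coeff 0) * X ^ (l + 1)) * B
          = (A - Q * B) - X ^ (l + 1) * (C (R.coeff 0 / B.coeff 0) * B) := by ring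
        _ = X ^ (l + 1) * (R - C (R.coeff 0 / B.coeff 0) * B) := by rw [hR]; ring
        _ = _ := by rw [hW]; ring

lemma exists_abs_eval_le (T : ℝ[X]) : ∃ K, 0 ≤ K ∧ ∀ h : ℝ, |h| ≤ 1 → |T.eval h| ≤ K := by
  obtain ⟨K, hK⟩ := (isCompact_closedBall (0 : ℝ) 1).exists_bound_of_continuousOn
    T.continuous.continuousOn
  refine ⟨|K|, abs_nonneg K, fun h hh => ?_⟩
  have : h ∈ Metric.closedBall (0 : ℝ) 1 := by simpa using hh
  exact (hK h this).trans (le_abs_self K)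

lemma SmoothNear.exists_taylor {r : ℝ} {f : ℝ → ℝ} {y : ℝ} (hr : 0 ≤ r) (h : SmoothNear r f y) :
    ∃ ε > 0, ∃ K, 0 ≤ K ∧ ∃ T : ℝ[X], T.natDegree ≤ ⌊r⌋₊ ∧ T.eval 0 = f y ∧
      ∀ x, |x - y| < ε → |f x - T.eval (x - y)| ≤ K * |x - y| ^ r := by
  obtain ⟨ε, hε, hf, K, hK⟩ := h
  obtain ⟨T, h1, h2, h3⟩ := exists_taylor_polynomial (β := r - ⌊r⌋₊)
    (sub_nonneg.2 (Nat.floor_le hr)) (abs_nonneg K) ⌊r⌋₊ f hf (fun x hx =>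
      (hK x hx y (Metric.mem_ball_self hε)).trans
        (mul_le_mul_of_nonneg_right (le_abs_self K) (by positivity)))
  refine ⟨ε, hε, |K|, abs_nonneg K, T, h1, h2, fun x hx => ?_⟩
  have := h3 x (by simpa [Real.dist_eq] using hx)
  rwa [add_sub_cancel] at this

/-- For r < 1 the Taylor polynomial is constant; for r ≥ 1 its first-order term dominates. The
exponent min r 1 is thus the rate at which the population matrix approaches p(y) I. -/
lemma SmoothNear.exists_abs_sub_le {r : ℝ} {f : ℝ → ℝ} {y : ℝ} (hr : 0 < r)
    (h : SmoothNear r f y) : ∃ ε > 0, ∃ K, 0 ≤ K ∧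
      ∀ x, |x - y| < ε → |f x - f y| ≤ K * |x - y| ^ min r 1 := by
  obtain ⟨ε, hε, K, hK, T, hdeg, hT0, hT⟩ := h.exists_taylor hr.le
  rcases lt_or_ge r 1 with hr1 | hr1
  · refine ⟨ε, hε, K, hK, fun x hx => ?_⟩
    rw [min_eq_left hr1.le]
    have hfl : ⌊r⌋₊ = 0 := Nat.floor_eq_zero.2 hr1
    rw [hfl] at hdeg
    rw [eq_C_of_natDegree_le_zero hdeg] at hT0 hT
    simp only [eval_C] at hT0 hT
    simpa [hT0] using hT x hx
  · obtain ⟨R, hR⟩ : X ∣ T - C (f y) := by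
      rw [X_dvd_iff, coeff_sub, coeff_zero_eq_eval_zero, hT0]
      simp
    obtain ⟨K', hK', hRb⟩ := exists_abs_eval_le R
    refine ⟨min ε 1, by positivity, K + K', by positivity, fun x hx => ?_⟩
    have hx1 : |x - y| ≤ 1 := hx.le.trans (min_le_right _ _)
    rw [min_eq_right hr1, Real.rpow_one]
    have e1 := hT x (hx.trans_le (min_le_left _ _))
    have e2 : T.eval (x - y) - f y = (x - y) * R.eval (x - y) := by
      have := congrArg (eval (x - y)) hR
      simpa using this
    have e3 : |x - y| ^ r ≤ |x - y| := by
      simpa using Real.rpow_le_rpow_of_exponent_ge' (abs_nonneg (x - y)) hx1 zero_le_one hr1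
    calc |f x - f y| = |(f x - T.eval (x - y)) + (x - y) * R.eval (x - y)| := by
          rw [← e2]; ring_nf
      _ ≤ K * |x - y| ^ r + |x - y| * K' := by
          refine (abs_add_le _ _).trans (add_le_add e1 ?_)
          rw [abs_mul]
          exact mul_le_mul_of_nonneg_left (hRb _ hx1) (abs_nonneg _)
      _ ≤ K * |x - y| + |x - y| * K' := by gcongr
      _ = _ := by ring

/-- A quotient of two functions that are smooth of order `r` is approximated, after multiplication
by the denominator, by a polynomial of degree at most `⌊r⌋` with error `O(|x - y| ^ r)`. -/
lemma SmoothNear.exists_quotient_polynomial {r : ℝ} {p Ψ : ℝ → ℝ} {y : ℝ} (hr : 0 ≤ r)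
    (hp : SmoothNear r p y) (hΨ : SmoothNear r Ψ y) (hpy : p y ≠ 0) :
    ∃ ε > 0, ∃ K, 0 ≤ K ∧ ∃ Q : ℝ[X], Q.natDegree ≤ ⌊r⌋₊ ∧ Q.eval y = Ψ y / p y ∧
      ∀ x, |x - y| < ε → |Ψ x - Q.eval x * p x| ≤ K * |x - y| ^ r := by
  obtain ⟨ε₁, hε₁, K₁, hK₁, A, -, hA0, hA⟩ := hΨ.exists_taylor hr
  obtain ⟨ε₂, hε₂, K₂, hK₂, B, -, hB0, hB⟩ := hp.exists_taylor hr
  obtain ⟨Q, hQdeg, R, hR⟩ := exists_dvd_sub_mul A B (by rwa [hB0]) ⌊r⌋₊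
  obtain ⟨KQ, hKQ, hQb⟩ := exists_abs_eval_le Q
  obtain ⟨KR, hKR, hRb⟩ := exists_abs_eval_le R
  -- The quotient is formed in the variable x - y and translated back. The radius is capped at 1 so
  -- that powers of |x - y| decrease in the exponent; the remainder, of order ⌊r⌋ + 1 > r, is then
  -- O(|x - y|^r).
  refine ⟨min (min ε₁ ε₂) 1, by positivity, K₁ + KQ * K₂ + KR, by positivity,
    Q.comp (X - C y), ?_, ?_, fun x hx => ?_⟩
  · rwa [natDegree_comp, natDegree_X_sub_C, mul_one]
  · have := congrArg (eval 0) hR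
    simp only [eval_sub, eval_mul, hA0, hB0, eval_pow, eval_X, zero_pow (Nat.succ_ne_zero _),
      zero_mul] at this
    rw [eval_comp, eval_sub, eval_X, eval_C, sub_self, eq_div_iff hpy]
    linarith
  · have hx1 : |x - y| ≤ 1 := hx.le.trans (min_le_right _ _)
    have e1 := hA x (hx.trans_le ((min_le_left _ _).trans (min_le_left _ _)))
    have e2 := hB x (hx.trans_le ((min_le_left _ _).trans (min_le_right _ _)))
    have e3 : A.eval (x - y) - Q.eval (x - y) * B.eval (x - y) =
        (x - y) ^ (⌊r⌋₊ + 1) * R.eval (x - y) := by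
      have := congrArg (eval (x - y)) hR
      simpa using this
    have e4 : |x - y| ^ (⌊r⌋₊ + 1) ≤ |x - y| ^ r := by
      rw [← Real.rpow_natCast]
      refine Real.rpow_le_rpow_of_exponent_ge' (abs_nonneg _) hx1 hr ?_
      push_cast
      exact (Nat.lt_floor_add_one r).le
    have hev : (Q.comp (X - C y)).eval x = Q.eval (x - y) := by simp [eval_comp]
    rw [hev]
    calc |Ψ x - Q.eval (x - y) * p x|
        = |(Ψ x - A.eval (x - y)) - Q.eval (x - y) * (p x - B.eval (x - y)) +
            (x - y) ^ (⌊r⌋₊ + 1) * R.eval (x - y)| := by rw [← e3]; ring_nf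
      _ ≤ K₁ * |x - y| ^ r + KQ * (K₂ * |x - y| ^ r) + |x - y| ^ r * KR := by
          refine (abs_add_le _ _).trans (add_le_add ((abs_sub _ _).trans (add_le_add e1 ?_)) ?_)
          · rw [abs_mul]
            exact mul_le_mul (hQb _ hx1) e2 (abs_nonneg _) hKQ
          · rw [abs_mul, abs_pow]
            exact mul_le_mul e4 (hRb _ hx1) (abs_nonneg _) (by positivity)
      _ = _ := by ring

end Taylor

/-! ### Essential suprema -/

lemma supNorm_nonneg (f : ℝ → ℝ) : 0 ≤ supNorm f := ENNReal.toReal_nonneg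

lemma ae_abs_le_supNorm {f : ℝ → ℝ} (hf : MemLp f ⊤ volume) : ∀ᵐ x, |f x| ≤ supNorm f := by
  have h := ae_le_eLpNormEssSup (f := f) (μ := volume)
  filter_upwards [h] with x hx
  rw [← eLpNorm_exponent_top] at hx
  have := ENNReal.toReal_mono hf.2.ne hx
  simpa [supNorm] using this

/-- A violation at a continuity point persists on a neighbourhood, which has positive measure. -/
lemma abs_le_supNorm_of_continuousAt {f : ℝ → ℝ} (hf : MemLp f ⊤ volume) {x : ℝ}
    (hc : ContinuousAt f x) : |f x| ≤ supNorm f := by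
  by_contra h
  push Not at h
  have h1 : ∀ᶠ z in 𝓝 x, supNorm f < |f z| := hc.abs.eventually (lt_mem_nhds h)
  have h2 : volume {z | ¬ |f z| ≤ supNorm f} = 0 := ae_abs_le_supNorm hf
  have h3 : {z | ¬ |f z| ≤ supNorm f} ∈ 𝓝 x := by
    filter_upwards [h1] with z hz
    simpa using hz
  exact (Measure.measure_pos_of_mem_nhds volume h3).ne' h2

/-! ### Scaling functions -/

section Scaling

variable {φ : ℝ → ℝ} {M₁ M₂ : ℝ} {s : ℕ}

lemma IsScaling.continuous (hφ : IsScaling φ M₁ M₂ s) : Continuous φ := hφ.contDiff.continuous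

lemma IsScaling.mem_Icc (hφ : IsScaling φ M₁ M₂ s) {z : ℝ} (hz : φ z ≠ 0) : M₁ ≤ z ∧ z ≤ M₂ :=
  hφ.support_subset hz

lemma IsScaling.hasCompactSupport (hφ : IsScaling φ M₁ M₂ s) : HasCompactSupport φ :=
  HasCompactSupport.of_support_subset_isCompact isCompact_Icc hφ.support_subset

lemma IsScaling.memLp_top (hφ : IsScaling φ M₁ M₂ s) : MemLp φ ⊤ volume :=
  hφ.continuous.memLp_top_of_hasCompactSupport hφ.hasCompactSupport _

lemma IsScaling.abs_le (hφ : IsScaling φ M₁ M₂ s) (z : ℝ) : |φ z| ≤ supNorm φ :=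
  abs_le_supNorm_of_continuousAt hφ.memLp_top hφ.continuous.continuousAt

/-- If the support were shorter than 1, the integer translates would leave gaps: all of them vanish
at (M₁ + M₂ + 1)/2, against the reproduction of constants. -/
lemma IsScaling.one_le_length (hφ : IsScaling φ M₁ M₂ s) (hs : 0 < s) : 1 ≤ M₂ - M₁ := by
  by_contra hlt
  push Not at hlt
  have h0 : ∀ k : ℤ, φ ((M₁ + M₂ + 1) / 2 - k) = 0 := by
    intro k
    by_contra hk
    obtain ⟨h1, h2⟩ := hφ.mem_Icc hk
    rcases le_or_gt k 0 with hk | hk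
    · have : (k : ℝ) ≤ 0 := by exact_mod_cast hk
      linarith
    · have : (1 : ℝ) ≤ k := by exact_mod_cast hk
      linarith
  have := hφ.reproduces 0 hs ((M₁ + M₂ + 1) / 2)
  simp [h0] at this

lemma IsScaling.integral_sq (hφ : IsScaling φ M₁ M₂ s) : ∫ x, φ x ^ 2 = 1 := by
  have := hφ.orthonormal 0 0
  simpa [sq] using this

lemma IsScaling.integrable_sq (hφ : IsScaling φ M₁ M₂ s) : Integrable fun x => φ x ^ 2 := by
  by_contra h
  have := hφ.integral_sq
  rw [integral_undef h] at this
  norm_num at this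

/-- Cauchy–Schwarz with ∫ φ² = 1, in the pointwise form 2|φ| ≤ c φ² + 1/c on the support, with the
optimal c = √(M₂ - M₁). -/
lemma IsScaling.integral_abs_le (hφ : IsScaling φ M₁ M₂ s) (hs : 0 < s) :
    ∫ x, |φ x| ≤ √(M₂ - M₁) := by
  have hL : 0 < M₂ - M₁ := by have := hφ.one_le_length hs; linarith
  set c := √(M₂ - M₁) with hc
  have hc0 : 0 < c := Real.sqrt_pos.2 hL
  have hcc : c * c = M₂ - M₁ := Real.mul_self_sqrt hL.le
  have hind : Integrable ((Set.Icc M₁ M₂).indicator fun _ : ℝ => c⁻¹) := by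
    rw [integrable_indicator_iff measurableSet_Icc]
    exact integrableOn_const (by simp)
  have hle : ∀ x, |φ x| ≤ (c * φ x ^ 2 + (Set.Icc M₁ M₂).indicator (fun _ => c⁻¹) x) / 2 := by
    intro x
    by_cases hx : φ x = 0
    · rw [hx]
      have : 0 ≤ (Set.Icc M₁ M₂).indicator (fun _ : ℝ => c⁻¹) x :=
        Set.indicator_nonneg (fun _ _ => by positivity) x
      simp only [abs_zero]
      positivity
    · have hxm : x ∈ Set.Icc M₁ M₂ := hφ.mem_Icc hx
      rw [Set.indicator_of_mem hxm]
      have : c * φ x ^ 2 + c⁻¹ - 2 * |φ x| = (c * |φ x| - 1) ^ 2 / c := by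
        rw [← sq_abs (φ x)]
        field_simp
        ring
      have h2 : 0 ≤ (c * |φ x| - 1) ^ 2 / c := by positivity
      linarith
  have hint : Integrable fun x => (c * φ x ^ 2 + (Set.Icc M₁ M₂).indicator (fun _ => c⁻¹) x) / 2 :=
    ((hφ.integrable_sq.const_mul c).add hind).div_const 2
  calc ∫ x, |φ x| ≤ ∫ x, (c * φ x ^ 2 + (Set.Icc M₁ M₂).indicator (fun _ => c⁻¹) x) / 2 :=
        integral_mono (hφ.continuous.integrable_of_hasCompactSupport hφ.hasCompactSupport).abs
          hint hle
    _ = (c + (M₂ - M₁) * c⁻¹) / 2 := by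
        rw [integral_div, integral_add (hφ.integrable_sq.const_mul c) hind, integral_const_mul,
          hφ.integral_sq, integral_indicator measurableSet_Icc]
        simp [hL.le]
    _ = c := by rw [← hcc]; field_simp; ring

lemma IsScaling.continuous_phi (hφ : IsScaling φ M₁ M₂ s) (m : ℕ) (k : ℤ) :
    Continuous (phi φ m k) := by
  have := hφ.continuous
  unfold phi
  fun_prop

lemma IsScaling.mem_of_phi_ne_zero (hφ : IsScaling φ M₁ M₂ s) {m : ℕ} {k : ℤ} {x : ℝ}
    (h : phi φ m k x ≠ 0) : M₁ ≤ (2 : ℝ) ^ m * x - k ∧ (2 : ℝ) ^ m * x - k ≤ M₂ :=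
  hφ.mem_Icc fun h0 => h (by rw [phi, h0, mul_zero])

lemma IsScaling.hasCompactSupport_phi (hφ : IsScaling φ M₁ M₂ s) (m : ℕ) (k : ℤ) :
    HasCompactSupport (phi φ m k) := by
  refine HasCompactSupport.of_support_subset_isCompact
    (isCompact_Icc (a := (M₁ + k) / 2 ^ m) (b := (M₂ + k) / 2 ^ m)) fun x hx => ?_
  obtain ⟨h1, h2⟩ := hφ.mem_of_phi_ne_zero hx
  have : (0 : ℝ) < 2 ^ m := by positivity
  constructor
  · rw [div_le_iff₀ this]; linarith
  · rw [le_div_iff₀ this]; linarith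

lemma IsScaling.abs_phi_le (hφ : IsScaling φ M₁ M₂ s) (m : ℕ) (k : ℤ) (x : ℝ) :
    |phi φ m k x| ≤ √((2 : ℝ) ^ m) * supNorm φ := by
  rw [phi, abs_mul, abs_of_nonneg (Real.sqrt_nonneg _)]
  exact mul_le_mul_of_nonneg_left (hφ.abs_le _) (Real.sqrt_nonneg _)

lemma IsScaling.integrable_phi_mul (hφ : IsScaling φ M₁ M₂ s) (m : ℕ) (k : ℤ) {f : ℝ → ℝ}
    (hf : Continuous f) : Integrable fun x => phi φ m k x * f x :=
  ((hφ.continuous_phi m k).mul hf).integrable_of_hasCompactSupport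
    (hφ.hasCompactSupport_phi m k).mul_right

lemma IsScaling.integrable_phi (hφ : IsScaling φ M₁ M₂ s) (m : ℕ) (k : ℤ) :
    Integrable (phi φ m k) :=
  (hφ.continuous_phi m k).integrable_of_hasCompactSupport (hφ.hasCompactSupport_phi m k)

lemma integral_comp_two_pow_mul (f : ℝ → ℝ) (m : ℕ) :
    ∫ x, f ((2 : ℝ) ^ m * x) = ((2 : ℝ) ^ m)⁻¹ * ∫ x, f x := by
  rw [Measure.integral_comp_mul_left, abs_of_nonneg (by positivity), smul_eq_mul]

lemma IsScaling.integral_phi_mul_phi (hφ : IsScaling φ M₁ M₂ s) (m : ℕ) (j k : ℤ) :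
    ∫ x, phi φ m j x * phi φ m k x = if j = k then 1 else 0 := by
  have h : ∀ x, phi φ m j x * phi φ m k x =
      (2 : ℝ) ^ m * (fun z => φ (z - j) * φ (z - k)) ((2 : ℝ) ^ m * x) := by
    intro x
    have : √((2 : ℝ) ^ m) * √((2 : ℝ) ^ m) = 2 ^ m := Real.mul_self_sqrt (by positivity)
    simp only [phi]
    linear_combination (φ (2 ^ m * x - j) * φ (2 ^ m * x - k)) * this
  simp_rw [h]
  rw [integral_const_mul, integral_comp_two_pow_mul (fun z => φ (z - j) * φ (z - k)),
    hφ.orthonormal, ← mul_assoc,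
    mul_inv_cancel₀ (by positivity), one_mul]

lemma IsScaling.integral_phi_sq (hφ : IsScaling φ M₁ M₂ s) (m : ℕ) (k : ℤ) :
    ∫ x, phi φ m k x ^ 2 = 1 := by
  simpa [sq] using hφ.integral_phi_mul_phi m k k

lemma IsScaling.integral_abs_phi_le (hφ : IsScaling φ M₁ M₂ s) (hs : 0 < s) (m : ℕ) (k : ℤ) :
    ∫ x, |phi φ m k x| ≤ √(M₂ - M₁) * (√((2 : ℝ) ^ m))⁻¹ := by
  have h : ∀ x, |phi φ m k x| = √((2 : ℝ) ^ m) * (fun z => |φ (z - k)|) ((2 : ℝ) ^ m * x) := by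
    intro x
    rw [phi, abs_mul, abs_of_nonneg (Real.sqrt_nonneg _)]
  have h2 : √((2 : ℝ) ^ m) * ((2 : ℝ) ^ m)⁻¹ = (√((2 : ℝ) ^ m))⁻¹ := by
    have : √((2 : ℝ) ^ m) * √((2 : ℝ) ^ m) = 2 ^ m := Real.mul_self_sqrt (by positivity)
    have h0 : 0 < √((2 : ℝ) ^ m) := Real.sqrt_pos.2 (by positivity)
    rw [← mul_eq_one_iff_eq_inv₀ h0.ne', mul_right_comm, this, mul_inv_cancel₀ (by positivity)]
  simp_rw [h]
  rw [integral_const_mul, integral_comp_two_pow_mul (fun z => |φ (z - k)|),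
    integral_sub_right_eq_self (fun z => |φ z|), ← mul_assoc, h2, mul_comm]
  exact mul_le_mul_of_nonneg_right (hφ.integral_abs_le hs) (by positivity)

/-- At a fixed z only finitely many translates contribute, so sum and integral can be exchanged. The
sum runs over any finite set containing the active indices, so that truncated index sets can be used
as long as they miss none. -/
lemma IsScaling.sum_mul_moment (hφ : IsScaling φ M₁ M₂ s) {i : ℕ} (hi : i < s) (z : ℝ)
    {S : Finset ℤ} (hS : ∀ k : ℤ, φ (z - k) ≠ 0 → k ∈ S) :
    ∑ k ∈ S, φ (z - k) * ∫ x, x ^ i * φ (x - k) = z ^ i := by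
  rw [← hφ.reproduces i hi z]
  have h : ∀ x, x ^ i * ∑' k : ℤ, φ (x - k) * φ (z - k) =
      ∑ k ∈ S, φ (z - k) * (x ^ i * φ (x - k)) := by
    intro x
    rw [tsum_eq_sum (s := S), Finset.mul_sum]
    · exact Finset.sum_congr rfl fun _ _ => by ring
    · intro k hk
      by_contra h0
      exact hk (hS k fun h1 => h0 (by rw [h1, mul_zero]))
  simp_rw [h]
  rw [integral_finsetSum]
  · simp_rw [integral_const_mul]
  · intro k _
    refine Integrable.const_mul ?_ _
    have hc : HasCompactSupport fun x => φ (x - k) :=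
      hφ.hasCompactSupport.comp_homeomorph (Homeomorph.subRight (k : ℝ))
    have := hφ.continuous
    exact Continuous.integrable_of_hasCompactSupport (by fun_prop) hc.mul_left

lemma IsScaling.sum_phi_mul_moment (hφ : IsScaling φ M₁ M₂ s) {i : ℕ} (hi : i < s) (m : ℕ)
    (z : ℝ) {S : Finset ℤ} (hS : ∀ k : ℤ, phi φ m k z ≠ 0 → k ∈ S) :
    ∑ k ∈ S, (∫ x, phi φ m k x * x ^ i) * phi φ m k z = z ^ i := by
  have h2 : √((2 : ℝ) ^ m) * √((2 : ℝ) ^ m) = 2 ^ m := Real.mul_self_sqrt (by positivity)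
  have hpos : (0 : ℝ) < 2 ^ m := by positivity
  have h := hφ.sum_mul_moment hi ((2 : ℝ) ^ m * z) (S := S)
    fun k hk => hS k (by
      rw [phi]
      exact mul_ne_zero (Real.sqrt_ne_zero'.2 hpos) hk)
  have hmom : ∀ k : ℤ, ∫ x, phi φ m k x * x ^ i =
      √((2 : ℝ) ^ m) * (((2 : ℝ) ^ m)⁻¹ ^ i * (((2 : ℝ) ^ m)⁻¹ * ∫ x, x ^ i * φ (x - k))) := by
    intro k
    have : ∀ x, phi φ m k x * x ^ i = √((2 : ℝ) ^ m) * (((2 : ℝ) ^ m)⁻¹ ^ i *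
        (fun z => z ^ i * φ (z - k)) ((2 : ℝ) ^ m * x)) := by
      intro x
      simp only [phi, mul_pow, inv_pow]
      field_simp
    simp_rw [this]
    rw [integral_const_mul, integral_const_mul,
      integral_comp_two_pow_mul (fun z => z ^ i * φ (z - k))]
  have hz : z ^ i = ((2 : ℝ) ^ m)⁻¹ ^ i * ((2 : ℝ) ^ m * z) ^ i := by
    rw [← mul_pow, inv_mul_cancel_left₀ hpos.ne']
  rw [hz, ← h, Finset.mul_sum]
  refine Finset.sum_congr rfl fun k _ => ?_
  rw [hmom, phi]
  have h3 : √((2 : ℝ) ^ m) * √((2 : ℝ) ^ m) * ((2 : ℝ) ^ m)⁻¹ = 1 := by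
    rw [h2, mul_inv_cancel₀ hpos.ne']
  linear_combination (((2 : ℝ) ^ m)⁻¹ ^ i * φ (2 ^ m * z - k) * ∫ x, x ^ i * φ (x - k)) * h3

open Polynomial in
/-- Polynomials of degree less than `s` are reproduced by their wavelet coefficients. -/
lemma IsScaling.sum_coeff_mul_phi (hφ : IsScaling φ M₁ M₂ s) {Q : ℝ[X]} (hQ : Q.natDegree < s)
    (m : ℕ) (z : ℝ) {S : Finset ℤ} (hS : ∀ k : ℤ, phi φ m k z ≠ 0 → k ∈ S) :
    ∑ k ∈ S, (∫ x, phi φ m k x * Q.eval x) * phi φ m k z = Q.eval z := by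
  have hint : ∀ k : ℤ, ∫ x, phi φ m k x * Q.eval x =
      ∑ i ∈ Finset.range s, Q.coeff i * ∫ x, phi φ m k x * x ^ i := by
    intro k
    have : ∀ x, phi φ m k x * Q.eval x =
        ∑ i ∈ Finset.range s, Q.coeff i * (phi φ m k x * x ^ i) := by
      intro x
      rw [eval_eq_sum_range' hQ, Finset.mul_sum]
      exact Finset.sum_congr rfl fun _ _ => by ring
    simp_rw [this]
    rw [integral_finsetSum _ fun i _ =>
      (hφ.integrable_phi_mul m k (continuous_pow i)).const_mul _]
    simp_rw [integral_const_mul]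
  simp_rw [hint, Finset.sum_mul]
  rw [Finset.sum_comm, eval_eq_sum_range' hQ]
  refine Finset.sum_congr rfl fun i hi => ?_
  rw [← hφ.sum_phi_mul_moment (Finset.mem_range.1 hi) m z hS, Finset.mul_sum]
  exact Finset.sum_congr rfl fun _ _ => by ring

/-! ### The index sets -/

lemma idx_mono (hL : 0 ≤ M₂ - M₁) (y : ℝ) (m : ℕ) {i j : ℕ} (hij : i ≤ j) :
    idx M₁ M₂ i y m ⊆ idx M₁ M₂ j y m := by
  intro k hk
  rw [mem_idx] at hk ⊢
  have : (i : ℝ) * (M₂ - M₁) ≤ j * (M₂ - M₁) :=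
    mul_le_mul_of_nonneg_right (by exact_mod_cast hij) hL
  constructor <;> linarith [hk.1, hk.2]

lemma IsScaling.mem_idx_zero (hφ : IsScaling φ M₁ M₂ s) {y : ℝ} {m : ℕ} {k : ℤ}
    (h : phi φ m k y ≠ 0) : k ∈ idx M₁ M₂ 0 y m := by
  have := hφ.mem_of_phi_ne_zero h
  rw [mem_idx]
  simp only [CharP.cast_eq_zero, zero_mul]
  constructor <;> linarith [this.1, this.2]

/-- Indices with overlapping supports differ by at most M₂ - M₁, the width of one layer of `idx`.
This is how the bandedness of the matrices enters. -/
lemma IsScaling.mem_idx_succ (hφ : IsScaling φ M₁ M₂ s) {x y : ℝ} {m i : ℕ} {j k : ℤ}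
    (hj : j ∈ idx M₁ M₂ i y m) (hjx : phi φ m j x ≠ 0) (hkx : phi φ m k x ≠ 0) :
    k ∈ idx M₁ M₂ (i + 1) y m := by
  have h1 := hφ.mem_of_phi_ne_zero hjx
  have h2 := hφ.mem_of_phi_ne_zero hkx
  rw [mem_idx] at hj ⊢
  push_cast
  constructor <;> linarith [h1.1, h1.2, h2.1, h2.2, hj.1, hj.2]

lemma IsScaling.abs_sub_le_of_mem_idx (hφ : IsScaling φ M₁ M₂ s) {x y : ℝ} {m i : ℕ} {k : ℤ}
    (hk : k ∈ idx M₁ M₂ i y m) (hx : phi φ m k x ≠ 0) :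
    |x - y| ≤ (i + 1) * (M₂ - M₁) * ((2 : ℝ) ^ m)⁻¹ := by
  have h1 := hφ.mem_of_phi_ne_zero hx
  rw [mem_idx] at hk
  rw [← div_eq_mul_inv, le_div_iff₀ (by positivity), ← abs_of_pos (show (0 : ℝ) < 2 ^ m by positivity),
    ← abs_mul, _root_.abs_le]
  constructor <;> linarith [h1.1, h1.2, hk.1, hk.2]

/-- The bound is uniform in m. It makes the supremum defining `sysSize` one of a bounded set; for an
unbounded set the supremum in ℕ would default to 0. -/
lemma card_idx_le (y : ℝ) (m : ℕ) :
    (idx M₁ M₂ s y m).card ≤ ⌊(2 * s + 1) * (M₂ - M₁)⌋₊ + 1 := by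
  rcases (idx M₁ M₂ s y m).eq_empty_or_nonempty with h | ⟨k, hk⟩
  · simp [h]
  · have hne : ⌈(2 : ℝ) ^ m * y - M₂ - s * (M₂ - M₁)⌉ ≤ ⌊(2 : ℝ) ^ m * y - M₁ + s * (M₂ - M₁)⌋ := by
      rw [idx, Finset.mem_Icc] at hk
      exact hk.1.trans hk.2
    rw [idx, Int.card_Icc]
    have h1 := Int.le_ceil ((2 : ℝ) ^ m * y - M₂ - s * (M₂ - M₁))
    have h2 := Int.floor_le ((2 : ℝ) ^ m * y - M₁ + s * (M₂ - M₁))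
    set a := ⌈(2 : ℝ) ^ m * y - M₂ - s * (M₂ - M₁)⌉
    set b := ⌊(2 : ℝ) ^ m * y - M₁ + s * (M₂ - M₁)⌋
    have h3 : ((b - a).toNat : ℝ) ≤ (2 * s + 1) * (M₂ - M₁) := by
      have : ((b - a).toNat : ℤ) = b - a := Int.toNat_of_nonneg (by omega)
      have h4 : ((b - a).toNat : ℝ) = (b : ℝ) - a := by exact_mod_cast this
      rw [h4]
      linarith
    have := Nat.le_floor h3
    omega

lemma bddAbove_card_idx (M₁ M₂ : ℝ) (s : ℕ) (y : ℝ) :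
    BddAbove (Set.range fun m : ℕ => (idx M₁ M₂ s y m).card) :=
  ⟨_, by rintro _ ⟨m, rfl⟩; exact card_idx_le y m⟩

lemma card_idx_le_sysSize (M₁ M₂ : ℝ) (s : ℕ) (y : ℝ) (m : ℕ) :
    (idx M₁ M₂ s y m).card ≤ sysSize M₁ M₂ s y :=
  le_ciSup (bddAbove_card_idx M₁ M₂ s y) m

/-- Rounding loses less than two indices, which the s extra layers on either side more than make up.
The bound later replaces √(M₂ - M₁) by √M, the form found in the constant `Dconst`. -/
lemma IsScaling.length_le_card_idx (hφ : IsScaling φ M₁ M₂ s) (hs : 0 < s) (y : ℝ) (m : ℕ) :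
    M₂ - M₁ ≤ (idx M₁ M₂ s y m).card := by
  have hL := hφ.one_le_length hs
  have hs' : (1 : ℝ) ≤ s := by exact_mod_cast hs
  have hmul : M₂ - M₁ ≤ s * (M₂ - M₁) := le_mul_of_one_le_left (by linarith) hs'
  have h1 := Int.ceil_lt_add_one ((2 : ℝ) ^ m * y - M₂ - s * (M₂ - M₁))
  have h2 := Int.sub_one_lt_floor ((2 : ℝ) ^ m * y - M₁ + s * (M₂ - M₁))
  rw [idx, Int.card_Icc]
  set a := ⌈(2 : ℝ) ^ m * y - M₂ - s * (M₂ - M₁)⌉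
  set b := ⌊(2 : ℝ) ^ m * y - M₁ + s * (M₂ - M₁)⌋
  have h3 : ((b + 1 - a : ℤ) : ℝ) ≤ ((b + 1 - a).toNat : ℝ) := by exact_mod_cast Int.self_le_toNat _
  push_cast at h3
  linarith

lemma IsScaling.idx_nonempty (hφ : IsScaling φ M₁ M₂ s) (hs : 0 < s) (y : ℝ) (m : ℕ) :
    (idx M₁ M₂ s y m).Nonempty := by
  rw [← Finset.card_pos]
  have h1 := hφ.one_le_length hs
  have h2 := hφ.length_le_card_idx hs y m
  have : (0 : ℝ) < (idx M₁ M₂ s y m).card := by linarith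
  exact_mod_cast this

lemma IsScaling.length_le_sysSize (hφ : IsScaling φ M₁ M₂ s) (hs : 0 < s) (y : ℝ) :
    M₂ - M₁ ≤ sysSize M₁ M₂ s y :=
  (hφ.length_le_card_idx hs y 0).trans (by exact_mod_cast card_idx_le_sysSize M₁ M₂ s y 0)

lemma IsScaling.one_le_sysSize (hφ : IsScaling φ M₁ M₂ s) (hs : 0 < s) (y : ℝ) :
    (1 : ℝ) ≤ sysSize M₁ M₂ s y :=
  (hφ.one_le_length hs).trans (hφ.length_le_sysSize hs y)

/-! ### The constant `Cphi` -/

lemma tsum_abs_eq_sum (z : ℝ) {S : Finset ℤ}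
    (hS : ∀ k : ℤ, φ (z - k) ≠ 0 → k ∈ S) : ∑' k : ℤ, |φ (z - k)| = ∑ k ∈ S, |φ (z - k)| := by
  refine tsum_eq_sum fun k hk => ?_
  by_contra h0
  exact hk (hS k fun h1 => h0 (by rw [h1, abs_zero]))

/-- Compact support leaves a bounded number of nonzero terms, so the supremum in `Cphi` is over a
bounded set and dominates each partial sum. -/
lemma IsScaling.sum_abs_le_Cphi (hφ : IsScaling φ M₁ M₂ s) (z : ℝ) (S : Finset ℤ) :
    ∑ k ∈ S, |φ (z - k)| ≤ Cphi φ := by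
  have hmem : ∀ (z : ℝ) (k : ℤ), φ (z - k) ≠ 0 → k ∈ idx M₁ M₂ 0 z 0 := by
    intro z k hk
    obtain ⟨h1, h2⟩ := hφ.mem_Icc hk
    rw [mem_idx]
    simp only [pow_zero, one_mul, CharP.cast_eq_zero, zero_mul]
    constructor <;> linarith
  have hbdd : BddAbove (Set.range fun z : ℝ => ∑' k : ℤ, |φ (z - k)|) := by
    refine ⟨(⌊(2 * (0 : ℕ) + 1) * (M₂ - M₁)⌋₊ + 1 : ℕ) * supNorm φ, ?_⟩
    rintro _ ⟨z, rfl⟩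
    simp only
    rw [tsum_abs_eq_sum z (hmem z)]
    calc _ ≤ ∑ _k ∈ idx M₁ M₂ 0 z 0, supNorm φ := Finset.sum_le_sum fun _ _ => hφ.abs_le _
      _ = (idx M₁ M₂ 0 z 0).card * supNorm φ := by simp
      _ ≤ _ := by
        refine mul_le_mul_of_nonneg_right ?_ (supNorm_nonneg φ)
        exact_mod_cast card_idx_le (M₁ := M₁) (M₂ := M₂) (s := 0) z 0
  refine le_trans ?_ (le_ciSup hbdd z)
  rw [tsum_abs_eq_sum z (S := S ∪ idx M₁ M₂ 0 z 0)
    fun k hk => Finset.mem_union_right _ (hmem z k hk)]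
  exact Finset.sum_le_sum_of_subset_of_nonneg Finset.subset_union_left fun _ _ _ => abs_nonneg _

lemma IsScaling.Cphi_nonneg (hφ : IsScaling φ M₁ M₂ s) : 0 ≤ Cphi φ := by
  simpa using hφ.sum_abs_le_Cphi 0 ∅

/-- The Euclidean norm is at most the ℓ¹ norm, which `Cphi` controls after rescaling. -/
lemma IsScaling.l2_phi_le (hφ : IsScaling φ M₁ M₂ s) (m : ℕ) (y : ℝ) (S : Finset ℤ) :
    l2 (fun k : S => phi φ m k y) ≤ √((2 : ℝ) ^ m) * Cphi φ := by
  refine (sq_le_sq₀ (l2_nonneg _) (mul_nonneg (Real.sqrt_nonneg _) hφ.Cphi_nonneg)).1 ?_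
  rw [l2_sq, mul_pow]
  simp only [phi, mul_pow]
  rw [← Finset.mul_sum]
  refine mul_le_mul_of_nonneg_left ?_ (sq_nonneg _)
  rw [Finset.sum_coe_sort S (fun k : ℤ => φ (2 ^ m * y - k) ^ 2)]
  calc ∑ k ∈ S, φ (2 ^ m * y - k) ^ 2 = ∑ k ∈ S, |φ (2 ^ m * y - k)| ^ 2 := by simp
    _ ≤ (∑ k ∈ S, |φ (2 ^ m * y - k)|) ^ 2 :=
        Finset.sum_sq_le_sq_sum_of_nonneg fun _ _ => abs_nonneg _
    _ ≤ _ := pow_le_pow_left₀ (Finset.sum_nonneg fun _ _ => abs_nonneg _)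
        (hφ.sum_abs_le_Cphi _ S) 2

end Scaling

/-! ### The linear system of the population and its bias -/

/-- The densities and the scaling function of the estimation problem: `p` is a bounded density-like
function, `Ψ` is bounded, both are smooth of order `r` at `y`, where `p` is positive. -/
structure LocalModel (p Ψ φ : ℝ → ℝ) (M₁ M₂ : ℝ) (s : ℕ) (y r : ℝ) : Prop where
  scaling : IsScaling φ M₁ M₂ s
  p_meas : Measurable p
  p_nonneg : ∀ x, 0 ≤ p x
  p_mem : MemLp p ⊤ volume
  Ψ_mem : MemLp Ψ ⊤ volume
  p_pos : 0 < p y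
  half_le : 1 / 2 ≤ r
  le_sub_one : r ≤ (s : ℝ) - 1
  p_smooth : SmoothNear r p y
  Ψ_smooth : SmoothNear r Ψ y

/-- The entries `∫ φ_{m,k} φ_{m,j} p` of the population matrix. -/
def popB (φ p : ℝ → ℝ) (m : ℕ) (j k : ℤ) : ℝ := ∫ x, phi φ m k x * phi φ m j x * p x

/-- The entries `∫ φ_{m,k} Ψ` of the population vector. -/
def popC (φ Ψ : ℝ → ℝ) (m : ℕ) (k : ℤ) : ℝ := ∫ x, phi φ m k x * Ψ x

/-- The population matrix. -/
def popMat (φ p : ℝ → ℝ) (M₁ M₂ : ℝ) (s : ℕ) (y : ℝ) (m : ℕ) :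
    Matrix (idx M₁ M₂ s y m) (idx M₁ M₂ s y m) ℝ :=
  Matrix.of fun j k => popB φ p m j k

/-- The population vector. -/
def popVec (φ Ψ : ℝ → ℝ) (M₁ M₂ : ℝ) (s : ℕ) (y : ℝ) (m : ℕ) : idx M₁ M₂ s y m → ℝ :=
  fun k => popC φ Ψ m k

/-- The solution of the population system. -/
def popCoef (φ p Ψ : ℝ → ℝ) (M₁ M₂ : ℝ) (s : ℕ) (y : ℝ) (m : ℕ) : idx M₁ M₂ s y m → ℝ :=
  (popMat φ p M₁ M₂ s y m)⁻¹.mulVec (popVec φ Ψ M₁ M₂ s y m)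

lemma integrable_mul_of_memLp_top {g f : ℝ → ℝ} (hg : Integrable g) (hf : MemLp f ⊤ volume) :
    Integrable fun x => g x * f x := by
  refine hg.mul_bdd (c := supNorm f) hf.1 ?_
  filter_upwards [ae_abs_le_supNorm hf] with x hx using hx

/-! ### Integrals against one or two functions φ_{m,k} -/

section Bounds

variable {φ : ℝ → ℝ} {M₁ M₂ : ℝ} {s : ℕ}

lemma IsScaling.integrable_phi_mul_phi (hφ : IsScaling φ M₁ M₂ s) (m : ℕ) (j k : ℤ) :
    Integrable fun x => phi φ m k x * phi φ m j x :=
  hφ.integrable_phi_mul m k (hφ.continuous_phi m j)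

lemma IsScaling.abs_integral_phi_mul_le (hφ : IsScaling φ M₁ M₂ s) (hs : 0 < s) {m : ℕ} {k : ℤ}
    {f : ℝ → ℝ} {c : ℝ} (hc : 0 ≤ c) (h : ∀ᵐ x, phi φ m k x ≠ 0 → |f x| ≤ c) :
    |∫ x, phi φ m k x * f x| ≤ c * √(M₂ - M₁) * (√((2 : ℝ) ^ m))⁻¹ := by
  have h1 : ‖∫ x, phi φ m k x * f x‖ ≤ ∫ x, c * |phi φ m k x| := by
    refine norm_integral_le_of_norm_le ((hφ.integrable_phi m k).abs.const_mul c) ?_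
    filter_upwards [h] with x hx
    rw [Real.norm_eq_abs, abs_mul, mul_comm]
    by_cases h0 : phi φ m k x = 0
    · simp [h0]
    · exact mul_le_mul_of_nonneg_right (hx h0) (abs_nonneg _)
  rw [integral_const_mul] at h1
  refine h1.trans ?_
  rw [mul_assoc]
  exact mul_le_mul_of_nonneg_left (hφ.integral_abs_phi_le hs m k) hc

/-- 2|φ_{m,k} φ_{m,j}| ≤ φ_{m,k}² + φ_{m,j}², and both squares integrate to 1. No power of 2^m is
lost. -/
lemma IsScaling.abs_integral_phi_mul_phi_mul_le (hφ : IsScaling φ M₁ M₂ s) {m : ℕ} {j k : ℤ}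
    {f : ℝ → ℝ} {c : ℝ} (hc : 0 ≤ c) (h : ∀ᵐ x, phi φ m k x ≠ 0 → |f x| ≤ c) :
    |∫ x, phi φ m k x * phi φ m j x * f x| ≤ c := by
  have hsq : ∀ k, Integrable fun x => phi φ m k x ^ 2 := fun k => by
    simpa [sq] using hφ.integrable_phi_mul_phi m k k
  have h1 : ‖∫ x, phi φ m k x * phi φ m j x * f x‖ ≤
      ∫ x, c * ((phi φ m k x ^ 2 + phi φ m j x ^ 2) / 2) := by
    refine norm_integral_le_of_norm_le ((((hsq k).add (hsq j)).div_const 2).const_mul c) ?_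
    filter_upwards [h] with x hx
    rw [Real.norm_eq_abs, abs_mul, abs_mul, mul_comm]
    by_cases h0 : phi φ m k x = 0
    · rw [h0]
      simp only [abs_zero, zero_mul, mul_zero]
      positivity
    · refine mul_le_mul (hx h0) ?_ (by positivity) hc
      nlinarith [sq_nonneg (|phi φ m k x| - |phi φ m j x|), sq_abs (phi φ m k x),
        sq_abs (phi φ m j x)]
  refine h1.trans (le_of_eq ?_)
  rw [integral_const_mul, integral_div, integral_add (hsq k) (hsq j), hφ.integral_phi_sq,
    hφ.integral_phi_sq]
  ring

lemma popB_eq_zero {p : ℝ → ℝ} {m : ℕ} {j k : ℤ}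
    (h : ∀ x, phi φ m j x ≠ 0 → phi φ m k x = 0) : popB φ p m j k = 0 := by
  rw [popB, integral_eq_zero_of_ae]
  refine Eventually.of_forall fun x => ?_
  by_cases h0 : phi φ m j x = 0
  · simp [h0]
  · simp [h x h0]

end Bounds

/-! #### Estimates at fine levels -/

/-- The mesh width `2⁻ᵐ`. -/
def mesh (m : ℕ) : ℝ := ((2 : ℝ) ^ m)⁻¹

lemma mesh_pos (m : ℕ) : 0 < mesh m := by unfold mesh; positivity

lemma mesh_le_one (m : ℕ) : mesh m ≤ 1 :=
  inv_le_one_of_one_le₀ (one_le_pow₀ one_le_two)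

lemma tendsto_mesh : Tendsto mesh atTop (𝓝 0) :=
  tendsto_inv_atTop_zero.comp (tendsto_pow_atTop_atTop_of_one_lt one_lt_two)

lemma tendsto_const_mul_mesh (c : ℝ) : Tendsto (fun m => c * mesh m) atTop (𝓝 0) := by
  simpa using tendsto_mesh.const_mul c

lemma tendsto_const_mul_mesh_rpow (c : ℝ) {a : ℝ} (ha : 0 < a) :
    Tendsto (fun m => c * mesh m ^ a) atTop (𝓝 0) := by
  have := (tendsto_mesh.rpow_const (p := a) (Or.inr ha.le)).const_mul c
  simpa [Real.zero_rpow ha.ne'] using this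

namespace LocalModel

variable {p Ψ φ : ℝ → ℝ} {M₁ M₂ : ℝ} {s : ℕ} {y r : ℝ}

lemma r_pos (h : LocalModel p Ψ φ M₁ M₂ s y r) : 0 < r := by linarith [h.half_le]

lemma s_pos (h : LocalModel p Ψ φ M₁ M₂ s y r) : 0 < s := by
  have h1 := h.half_le
  have h2 := h.le_sub_one
  have : (0 : ℝ) < s := by linarith
  exact_mod_cast this

lemma min_pos (h : LocalModel p Ψ φ M₁ M₂ s y r) : 0 < min r 1 := lt_min h.r_pos one_pos

lemma integrable_phi_phi_p (h : LocalModel p Ψ φ M₁ M₂ s y r) (m : ℕ) (j k : ℤ) :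
    Integrable fun x => phi φ m k x * phi φ m j x * p x :=
  integrable_mul_of_memLp_top (h.scaling.integrable_phi_mul_phi m j k) h.p_mem

lemma length_pos (h : LocalModel p Ψ φ M₁ M₂ s y r) : 0 < M₂ - M₁ := by
  linarith [h.scaling.one_le_length h.s_pos]

lemma sysSize_pos (h : LocalModel p Ψ φ M₁ M₂ s y r) : (0 : ℝ) < sysSize M₁ M₂ s y := by
  linarith [h.scaling.one_le_sysSize h.s_pos y]

lemma card_le (_h : LocalModel p Ψ φ M₁ M₂ s y r) (m : ℕ) :
    (Fintype.card (idx M₁ M₂ s y m) : ℝ) ≤ sysSize M₁ M₂ s y := by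
  rw [Fintype.card_coe]
  exact_mod_cast card_idx_le_sysSize M₁ M₂ s y m

lemma abs_sub_le (h : LocalModel p Ψ φ M₁ M₂ s y r) {m : ℕ} {k : ℤ} {x : ℝ}
    (hk : k ∈ idx M₁ M₂ s y m) (hx : phi φ m k x ≠ 0) :
    |x - y| ≤ (s + 1) * (M₂ - M₁) * mesh m :=
  h.scaling.abs_sub_le_of_mem_idx hk hx

/-- By orthonormality the difference is ∫ φ_{m,k} φ_{m,j} (p - p(y)), and the support of φ_{m,k}
lies within O(2⁻ᵐ) of y. -/
lemma exists_abs_popB_sub_le (h : LocalModel p Ψ φ M₁ M₂ s y r) :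
    ∃ K, 0 ≤ K ∧ ∀ᶠ m in atTop, ∀ j ∈ idx M₁ M₂ s y m, ∀ k ∈ idx M₁ M₂ s y m,
      |popB φ p m j k - (if j = k then p y else 0)| ≤ K * mesh m ^ min r 1 := by
  obtain ⟨ε, hε, K, hK, hloc⟩ := h.p_smooth.exists_abs_sub_le h.r_pos
  have hR : 0 ≤ (s + 1) * (M₂ - M₁) := by have := h.length_pos; positivity
  refine ⟨K * ((s + 1) * (M₂ - M₁)) ^ min r 1, by positivity, ?_⟩
  filter_upwards [(tendsto_const_mul_mesh ((s + 1) * (M₂ - M₁))).eventually (gt_mem_nhds hε)]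
    with m hm j _ k hk
  have heq : popB φ p m j k - (if j = k then p y else 0) =
      ∫ x, phi φ m k x * phi φ m j x * (p x - p y) := by
    have : ∀ x, phi φ m k x * phi φ m j x * (p x - p y) =
        phi φ m k x * phi φ m j x * p x - phi φ m k x * phi φ m j x * p y := fun x => by ring
    simp_rw [this]
    rw [integral_sub (h.integrable_phi_phi_p m j k)
      ((h.scaling.integrable_phi_mul_phi m j k).mul_const _), integral_mul_const,
      h.scaling.integral_phi_mul_phi, popB]
    simp [eq_comm]
  rw [heq, mul_assoc, ← Real.mul_rpow hR (mesh_pos m).le]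
  have hmp := mesh_pos m
  refine h.scaling.abs_integral_phi_mul_phi_mul_le (by positivity) (Eventually.of_forall ?_)
  intro x hx
  have h1 := h.abs_sub_le hk hx
  exact (hloc x (h1.trans_lt hm)).trans (mul_le_mul_of_nonneg_left
    (Real.rpow_le_rpow (abs_nonneg _) h1 h.min_pos.le) hK)

lemma eventually_abs_popB_sub_le (h : LocalModel p Ψ φ M₁ M₂ s y r) {δ : ℝ} (hδ : 0 < δ) :
    ∀ᶠ m in atTop, ∀ j ∈ idx M₁ M₂ s y m, ∀ k ∈ idx M₁ M₂ s y m,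
      |popB φ p m j k - (if j = k then p y else 0)| ≤ δ := by
  obtain ⟨K, -, hev⟩ := h.exists_abs_popB_sub_le
  filter_upwards [hev, (tendsto_const_mul_mesh_rpow K h.min_pos).eventually (gt_mem_nhds hδ)]
    with m hm hlt j hj k hk
  exact (hm j hj k hk).trans hlt.le

lemma eventually_le_l2_popMat (h : LocalModel p Ψ φ M₁ M₂ s y r) :
    ∀ᶠ m in atTop, ∀ v, p y / 2 * l2 v ≤ l2 ((popMat φ p M₁ M₂ s y m).mulVec v) := by
  have hM := h.sysSize_pos
  have hp := h.p_pos
  filter_upwards [h.eventually_abs_popB_sub_le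
    (δ := p y / (2 * sysSize M₁ M₂ s y)) (by positivity)] with m hm v
  refine (l2_mulVec_bounds hp (ε := p y / (2 * sysSize M₁ M₂ s y)) (by positivity) ?_ ?_ v).1
  · calc _ ≤ (sysSize M₁ M₂ s y : ℝ) * (p y / (2 * sysSize M₁ M₂ s y)) :=
          mul_le_mul_of_nonneg_right (h.card_le m) (by positivity)
      _ = _ := by field_simp
  · intro i j
    have := hm i i.2 j j.2
    simp only [popMat, Matrix.of_apply, Subtype.ext_iff]
    exact this

lemma abs_popC_le (h : LocalModel p Ψ φ M₁ M₂ s y r) (m : ℕ) (k : ℤ) :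
    |popC φ Ψ m k| ≤ supNorm Ψ * √(M₂ - M₁) * (√((2 : ℝ) ^ m))⁻¹ := by
  refine h.scaling.abs_integral_phi_mul_le h.s_pos (supNorm_nonneg _) ?_
  filter_upwards [ae_abs_le_supNorm h.Ψ_mem] with x hx _ using hx

lemma eventually_popMat_popCoef (h : LocalModel p Ψ φ M₁ M₂ s y r) :
    ∀ᶠ m in atTop, (popMat φ p M₁ M₂ s y m).mulVec (popCoef φ p Ψ M₁ M₂ s y m) =
      popVec φ Ψ M₁ M₂ s y m := by
  filter_upwards [h.eventually_le_l2_popMat] with m hm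
  exact mulVec_inv_mulVec (isUnit_det_of_l2_le (by have := h.p_pos; positivity) hm) _

lemma eventually_l2_popCoef_le (h : LocalModel p Ψ φ M₁ M₂ s y r) :
    ∀ᶠ m in atTop, l2 (popCoef φ p Ψ M₁ M₂ s y m) ≤
      2 / p y * (√(sysSize M₁ M₂ s y) * (supNorm Ψ * √(M₂ - M₁))) * (√((2 : ℝ) ^ m))⁻¹ := by
  have hp := h.p_pos
  filter_upwards [h.eventually_le_l2_popMat, h.eventually_popMat_popCoef] with m hm heq
  have h1 := hm (popCoef φ p Ψ M₁ M₂ s y m)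
  rw [heq] at h1
  have h0 : 0 ≤ supNorm Ψ * √(M₂ - M₁) * (√((2 : ℝ) ^ m))⁻¹ := by
    have := supNorm_nonneg Ψ
    positivity
  have h2 : l2 (popVec φ Ψ M₁ M₂ s y m) ≤
      √(sysSize M₁ M₂ s y) * (supNorm Ψ * √(M₂ - M₁) * (√((2 : ℝ) ^ m))⁻¹) :=
    (l2_le_of_abs_le (v := popVec φ Ψ M₁ M₂ s y m) h0 fun k => h.abs_popC_le m k).trans
      (mul_le_mul_of_nonneg_right (Real.sqrt_le_sqrt (h.card_le m)) h0)
  have h3 := h1.trans h2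
  calc l2 (popCoef φ p Ψ M₁ M₂ s y m)
      = 2 / p y * (p y / 2 * l2 (popCoef φ p Ψ M₁ M₂ s y m)) := by field_simp
    _ ≤ 2 / p y * (√(sysSize M₁ M₂ s y) * (supNorm Ψ * √(M₂ - M₁) * (√((2 : ℝ) ^ m))⁻¹)) :=
        mul_le_mul_of_nonneg_left h3 (by positivity)
    _ = _ := by ring

end LocalModel

/-! ### Bias of the truncated population system -/

namespace LocalModel

open Polynomial

variable {p Ψ φ : ℝ → ℝ} {M₁ M₂ : ℝ} {s : ℕ} {y r : ℝ}

lemma exists_abs_coeff_le (h : LocalModel p Ψ φ M₁ M₂ s y r) (Q : ℝ[X]) :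
    ∃ K, 0 ≤ K ∧ ∀ m, ∀ k ∈ idx M₁ M₂ s y m,
      |∫ x, phi φ m k x * Q.eval x| ≤ K * (√((2 : ℝ) ^ m))⁻¹ := by
  obtain ⟨K, hK⟩ := (isCompact_closedBall y ((s + 1) * (M₂ - M₁))).exists_bound_of_continuousOn
    Q.continuous.continuousOn
  refine ⟨|K| * √(M₂ - M₁), by positivity, fun m k hk => ?_⟩
  refine h.scaling.abs_integral_phi_mul_le h.s_pos (abs_nonneg K) (Eventually.of_forall ?_)
  intro x hx
  have hL := h.length_pos
  have hmem : x ∈ Metric.closedBall y ((s + 1) * (M₂ - M₁)) := by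
    rw [Metric.mem_closedBall, Real.dist_eq]
    exact (h.abs_sub_le hk hx).trans (mul_le_of_le_one_right (by positivity) (mesh_le_one m))
  exact (hK x hmem).trans (le_abs_self K)

/-- The error of the wavelet coefficients of a polynomial in the population system is an integral
against `φ_{m,j}`. -/
lemma mulVec_coeff_sub (h : LocalModel p Ψ φ M₁ M₂ s y r) (b : ℤ → ℝ) (m : ℕ)
    (j : idx M₁ M₂ s y m) :
    (popMat φ p M₁ M₂ s y m).mulVec (fun k => b k) j - popVec φ Ψ M₁ M₂ s y m j =
      ∫ x, phi φ m j x * ((∑ k ∈ idx M₁ M₂ s y m, b k * phi φ m k x) * p x - Ψ x) := by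
  have h1 : (popMat φ p M₁ M₂ s y m).mulVec (fun k => b k) j =
      ∑ k ∈ idx M₁ M₂ s y m, popB φ p m j k * b k := by
    simp only [Matrix.mulVec, dotProduct, popMat, Matrix.of_apply]
    exact Finset.sum_coe_sort (idx M₁ M₂ s y m) fun k => popB φ p m j k * b k
  have h2 : ∀ x, phi φ m j x * ((∑ k ∈ idx M₁ M₂ s y m, b k * phi φ m k x) * p x - Ψ x) =
      ∑ k ∈ idx M₁ M₂ s y m, (phi φ m k x * phi φ m j x * p x) * b k - phi φ m j x * Ψ x := by
    intro x
    rw [mul_sub, ← mul_assoc, Finset.mul_sum, Finset.sum_mul]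
    congr 1
    exact Finset.sum_congr rfl fun _ _ => by ring
  simp_rw [h2]
  rw [integral_sub
    (integrable_finsetSum _ fun k _ => (h.integrable_phi_phi_p m j k).mul_const _)
    (integrable_mul_of_memLp_top (h.scaling.integrable_phi m j) h.Ψ_mem),
    integral_finsetSum _ fun k _ => (h.integrable_phi_phi_p m j k).mul_const _, h1]
  simp_rw [integral_mul_const]
  rfl

/-- In every row the truncated expansion of Q is bounded, which gives the order 2^{-m/2}. For j one
layer inside, every φ_{m,k} that meets the support of φ_{m,j} is present, so the expansion equals Q
there and the local approximation adds the factor 2^{-rm}. The residual enters as a number f with an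
equation, so that it can be rewritten as a row of B applied to the coefficient error. -/
lemma exists_residual_bounds (h : LocalModel p Ψ φ M₁ M₂ s y r) {Q : ℝ[X]}
    (hQ : Q.natDegree < s) {ε K : ℝ} (hε : 0 < ε) (hK : 0 ≤ K)
    (hloc : ∀ x, |x - y| < ε → |Ψ x - Q.eval x * p x| ≤ K * |x - y| ^ r) :
    ∃ R, 0 ≤ R ∧ ∀ᶠ m in atTop, ∀ j : idx M₁ M₂ s y m, ∀ f : ℝ,
      f = (popMat φ p M₁ M₂ s y m).mulVec (fun k => ∫ x, phi φ m k x * Q.eval x) j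
        - popVec φ Ψ M₁ M₂ s y m j →
      |f| ≤ R * (√((2 : ℝ) ^ m))⁻¹ ∧
      ((j : ℤ) ∈ idx M₁ M₂ (s - 1) y m → |f| ≤ R * (√((2 : ℝ) ^ m))⁻¹ * mesh m ^ r) := by
  obtain ⟨Kb, hKb, hb⟩ := h.exists_abs_coeff_le Q
  have hL := h.length_pos
  have hR : 0 ≤ (s + 1) * (M₂ - M₁) := by positivity
  have hF := supNorm_nonneg φ
  have hP := supNorm_nonneg p
  have hS := supNorm_nonneg Ψ
  have hM := h.sysSize_pos
  set R₁ := (sysSize M₁ M₂ s y * (Kb * supNorm φ) * supNorm p + supNorm Ψ) * √(M₂ - M₁) with hR₁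
  set R₂ := K * ((s + 1) * (M₂ - M₁)) ^ r * √(M₂ - M₁) with hR₂
  have hR₁0 : 0 ≤ R₁ := by positivity
  have hR₂0 : 0 ≤ R₂ := by positivity
  refine ⟨R₁ + R₂, by positivity, ?_⟩
  filter_upwards [(tendsto_const_mul_mesh ((s + 1) * (M₂ - M₁))).eventually (gt_mem_nhds hε)]
    with m hm j f hf
  rw [h.mulVec_coeff_sub (fun k => ∫ x, phi φ m k x * Q.eval x)] at hf
  have hs0 : 0 < √((2 : ℝ) ^ m) := Real.sqrt_pos.2 (by positivity)
  have hmp := mesh_pos m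
  constructor
  · have h1 : |f| ≤ R₁ * (√((2 : ℝ) ^ m))⁻¹ := by
      rw [hf]
      refine h.scaling.abs_integral_phi_mul_le h.s_pos (by positivity) ?_
      filter_upwards [ae_abs_le_supNorm h.p_mem, ae_abs_le_supNorm h.Ψ_mem] with x hpx hΨx _
      refine (abs_sub _ _).trans (add_le_add ?_ hΨx)
      rw [abs_mul]
      refine mul_le_mul ?_ hpx (abs_nonneg _) (by positivity)
      calc _ ≤ ∑ k ∈ idx M₁ M₂ s y m, |(∫ x, phi φ m k x * Q.eval x) * phi φ m k x| :=
            Finset.abs_sum_le_sum_abs _ _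
        _ ≤ ∑ _k ∈ idx M₁ M₂ s y m, Kb * supNorm φ := by
            refine Finset.sum_le_sum fun k hk => ?_
            rw [abs_mul]
            calc _ ≤ (Kb * (√((2 : ℝ) ^ m))⁻¹) * (√((2 : ℝ) ^ m) * supNorm φ) :=
                  mul_le_mul (hb m k hk) (h.scaling.abs_phi_le m k x) (abs_nonneg _)
                    (by positivity)
              _ = _ := by field_simp
        _ ≤ _ := by
            rw [Finset.sum_const, nsmul_eq_mul]
            refine mul_le_mul_of_nonneg_right ?_ (by positivity)
            exact_mod_cast card_idx_le_sysSize M₁ M₂ s y m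
    refine h1.trans (mul_le_mul_of_nonneg_right ?_ (by positivity))
    linarith
  · intro hj
    have h2 : |f| ≤ K * ((s + 1) * (M₂ - M₁) * mesh m) ^ r * √(M₂ - M₁) * (√((2 : ℝ) ^ m))⁻¹ := by
      rw [hf]
      refine h.scaling.abs_integral_phi_mul_le h.s_pos (by positivity) (Eventually.of_forall ?_)
      intro x hx
      have hsum : ∑ k ∈ idx M₁ M₂ s y m, (∫ x, phi φ m k x * Q.eval x) * phi φ m k x =
          Q.eval x := by
        refine h.scaling.sum_coeff_mul_phi hQ m x fun k hk => ?_
        have := h.scaling.mem_idx_succ hj hx hk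
        rwa [Nat.sub_add_cancel h.s_pos] at this
      rw [hsum, abs_sub_comm]
      have h3 := h.abs_sub_le j.2 hx
      exact (hloc x (h3.trans_lt hm)).trans (mul_le_mul_of_nonneg_left
        (Real.rpow_le_rpow (abs_nonneg _) h3 h.r_pos.le) hK)
    refine h2.trans ?_
    rw [Real.mul_rpow hR hmp.le]
    have e : K * (((s + 1) * (M₂ - M₁)) ^ r * mesh m ^ r) * √(M₂ - M₁) * (√((2 : ℝ) ^ m))⁻¹ =
        R₂ * ((√((2 : ℝ) ^ m))⁻¹ * mesh m ^ r) := by rw [hR₂]; ring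
    rw [e, mul_assoc (R₁ + R₂)]
    exact mul_le_mul_of_nonneg_right (by linarith) (by positivity)

/-- The boundary effect of the truncation of the linear system decays geometrically towards the
centre of the index set. -/
lemma exists_abs_coeff_sub_le (h : LocalModel p Ψ φ M₁ M₂ s y r) {Q : ℝ[X]}
    (hQ : Q.natDegree < s) {ε K : ℝ} (hε : 0 < ε) (hK : 0 ≤ K)
    (hloc : ∀ x, |x - y| < ε → |Ψ x - Q.eval x * p x| ≤ K * |x - y| ^ r) (d : ℕ) :
    d ≤ s → ∃ C, 0 ≤ C ∧ ∀ᶠ m in atTop, ∀ j : idx M₁ M₂ s y m,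
      (j : ℤ) ∈ idx M₁ M₂ (s - d) y m →
      |(∫ x, phi φ m j x * Q.eval x) - popCoef φ p Ψ M₁ M₂ s y m j| ≤
        C * (√((2 : ℝ) ^ m))⁻¹ * (mesh m ^ r + (mesh m ^ min r 1) ^ d) := by
  obtain ⟨R, hR, hres⟩ := h.exists_residual_bounds hQ hε hK hloc
  obtain ⟨KB, hKB, hB⟩ := h.exists_abs_popB_sub_le
  have hM := h.sysSize_pos
  have hp := h.p_pos
  induction d with
  | zero =>
    intro _
    refine ⟨2 / p y * (√(sysSize M₁ M₂ s y) * R), by positivity, ?_⟩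
    filter_upwards [hres, h.eventually_le_l2_popMat, h.eventually_popMat_popCoef]
      with m hresm hlow heq j _
    have hs0 : 0 < √((2 : ℝ) ^ m) := Real.sqrt_pos.2 (by positivity)
    set b : idx M₁ M₂ s y m → ℝ := fun k => ∫ x, phi φ m k x * Q.eval x with hb
    set e := b - popCoef φ p Ψ M₁ M₂ s y m with he
    -- Base case: stability of the system and the crude residual bound, valid up to the boundary.
    -- The second summand of the claim is here a zeroth power, that is, 1.
    have h1 := hlow e
    have h2 : l2 ((popMat φ p M₁ M₂ s y m).mulVec e) ≤
        √(sysSize M₁ M₂ s y) * (R * (√((2 : ℝ) ^ m))⁻¹) := by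
      refine (l2_le_of_abs_le (c := R * (√((2 : ℝ) ^ m))⁻¹) (by positivity) fun i => ?_).trans
        (mul_le_mul_of_nonneg_right (Real.sqrt_le_sqrt (h.card_le m)) (by positivity))
      refine (hresm i _ ?_).1
      rw [he, Matrix.mulVec_sub, heq]
      rfl
    have h3 : |e j| ≤ 2 / p y * (√(sysSize M₁ M₂ s y) * (R * (√((2 : ℝ) ^ m))⁻¹)) :=
      calc |e j| ≤ l2 e := abs_le_l2 e j
        _ = 2 / p y * (p y / 2 * l2 e) := by field_simp
        _ ≤ _ := mul_le_mul_of_nonneg_left (h1.trans h2) (by positivity)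
    refine h3.trans ?_
    have hmr : 0 ≤ mesh m ^ r := (Real.rpow_pos_of_pos (mesh_pos m) r).le
    calc _ = 2 / p y * (√(sysSize M₁ M₂ s y) * R) * (√((2 : ℝ) ^ m))⁻¹ * 1 := by ring
      _ ≤ _ := by
        refine mul_le_mul_of_nonneg_left ?_ (by positivity)
        rw [pow_zero]
        linarith
  | succ d ih =>
    intro hd
    obtain ⟨C, hC, hCm⟩ := ih (by omega)
    refine ⟨(p y)⁻¹ * (R + sysSize M₁ M₂ s y * (KB * C)), by positivity, ?_⟩
    filter_upwards [hres, hB, hCm, h.eventually_popMat_popCoef] with m hresm hBm hCm heq j hj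
    have hs0 : 0 < √((2 : ℝ) ^ m) := Real.sqrt_pos.2 (by positivity)
    have hjd : (j : ℤ) ∈ idx M₁ M₂ (s - 1) y m :=
      idx_mono h.length_pos.le y m (by omega) hj
    have hmp := mesh_pos m
    have hmr : 0 < mesh m ^ r := Real.rpow_pos_of_pos (mesh_pos m) r
    set η := mesh m ^ min r 1 with hη
    have hη0 : 0 < η := Real.rpow_pos_of_pos (mesh_pos m) _
    have hη1 : η ≤ 1 := Real.rpow_le_one hmp.le (mesh_le_one m) h.min_pos.le
    set b : idx M₁ M₂ s y m → ℝ := fun k => ∫ x, phi φ m k x * Q.eval x with hb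
    set e := b - popCoef φ p Ψ M₁ M₂ s y m with he
    have hf := (hresm j ((popMat φ p M₁ M₂ s y m).mulVec e j) (by
      rw [he, Matrix.mulVec_sub, heq]; rfl)).2 hjd
    -- One step of a Jacobi iteration: the diagonal part p(y) is isolated, and the rest of the
    -- matrix has entries of order `η`.
    have hsplit : p y * e j = (popMat φ p M₁ M₂ s y m).mulVec e j -
        ∑ k : idx M₁ M₂ s y m, (popB φ p m j k - (if j = k then p y else 0)) * e k := by
      simp [Matrix.mulVec, dotProduct, popMat, sub_mul, Finset.sum_sub_distrib]
    have hterm : ∀ k : idx M₁ M₂ s y m,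
        |(popB φ p m j k - (if j = k then p y else 0)) * e k| ≤
          KB * C * (√((2 : ℝ) ^ m))⁻¹ * (mesh m ^ r + η ^ (d + 1)) := by
      intro k
      by_cases hk : (k : ℤ) ∈ idx M₁ M₂ (s - d) y m
      · rw [abs_mul]
        have e1 : |popB φ p m j k - (if j = k then p y else 0)| ≤ KB * η := by
          have := hBm j j.2 k k.2
          simp only [Subtype.ext_iff]
          exact this
        refine (mul_le_mul e1 (hCm k hk) (abs_nonneg _) (by positivity)).trans ?_
        calc _ = KB * C * (√((2 : ℝ) ^ m))⁻¹ * (η * mesh m ^ r + η ^ (d + 1)) := by ring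
          _ ≤ _ := by
            refine mul_le_mul_of_nonneg_left ?_ (by positivity)
            have := mul_le_mul_of_nonneg_right hη1 hmr.le
            linarith
      -- Here k is outside layer s - d while j is in layer s - (d + 1), so the supports are disjoint
      -- and the matrix entry is exactly zero. Errors from farther out never reach j in one step.
      · have hne : j ≠ k := by
          rintro rfl
          exact hk (idx_mono h.length_pos.le y m (by omega) hj)
        have hz : popB φ p m j k = 0 := by
          refine popB_eq_zero fun x hx => ?_
          by_contra hkx
          have := h.scaling.mem_idx_succ hj hx hkx
          rw [show s - (d + 1) + 1 = s - d by omega] at this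
          exact hk this
        rw [hz, if_neg hne]
        simp only [sub_zero, zero_mul, abs_zero]
        positivity
    have hsum : |∑ k : idx M₁ M₂ s y m, (popB φ p m j k - (if j = k then p y else 0)) * e k| ≤
        sysSize M₁ M₂ s y * (KB * C * (√((2 : ℝ) ^ m))⁻¹ * (mesh m ^ r + η ^ (d + 1))) := by
      refine (Finset.abs_sum_le_sum_abs _ _).trans ((Finset.sum_le_sum fun k _ => hterm k).trans ?_)
      rw [Finset.sum_const, nsmul_eq_mul, Finset.card_univ]
      exact mul_le_mul_of_nonneg_right (h.card_le m) (by positivity)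
    change |e j| ≤ _
    have hpe : p y * |e j| ≤ R * (√((2 : ℝ) ^ m))⁻¹ * mesh m ^ r +
        sysSize M₁ M₂ s y * (KB * C * (√((2 : ℝ) ^ m))⁻¹ * (mesh m ^ r + η ^ (d + 1))) := by
      have e2 : p y * |e j| = |p y * e j| := by rw [abs_mul, abs_of_pos hp]
      rw [e2, hsplit]
      exact (abs_sub _ _).trans (add_le_add hf hsum)
    have hRle : R * (√((2 : ℝ) ^ m))⁻¹ * mesh m ^ r ≤
        R * (√((2 : ℝ) ^ m))⁻¹ * (mesh m ^ r + η ^ (d + 1)) :=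
      mul_le_mul_of_nonneg_left (by have : 0 < η ^ (d + 1) := by positivity
                                    linarith) (by positivity)
    calc |e j| = (p y)⁻¹ * (p y * |e j|) := by field_simp
      _ ≤ (p y)⁻¹ * (R * (√((2 : ℝ) ^ m))⁻¹ * (mesh m ^ r + η ^ (d + 1)) +
        sysSize M₁ M₂ s y * (KB * C * (√((2 : ℝ) ^ m))⁻¹ * (mesh m ^ r + η ^ (d + 1)))) :=
          mul_le_mul_of_nonneg_left (hpe.trans (by linarith)) (by positivity)
      _ = _ := by ring

/-- The bias of the solution of the population system is `O(2^{-rm})`. -/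
lemma exists_bias_le (h : LocalModel p Ψ φ M₁ M₂ s y r) :
    ∃ C, 0 ≤ C ∧ ∀ᶠ m in atTop,
      |∑ k, popCoef φ p Ψ M₁ M₂ s y m k * phi φ m k y - Ψ y / p y| ≤ C * mesh m ^ r := by
  obtain ⟨ε, hε, K, hK, Q, hdeg, hQy, hloc⟩ :=
    h.p_smooth.exists_quotient_polynomial h.r_pos.le h.Ψ_smooth h.p_pos.ne'
  have hQ : Q.natDegree < s := by
    refine lt_of_le_of_lt hdeg ((Nat.floor_lt h.r_pos.le).2 ?_)
    linarith [h.le_sub_one]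
  obtain ⟨C, hC, hCm⟩ := h.exists_abs_coeff_sub_le hQ hε hK hloc s le_rfl
  have hF := supNorm_nonneg φ
  have hM := h.sysSize_pos
  refine ⟨sysSize M₁ M₂ s y * (2 * C * supNorm φ), by positivity, ?_⟩
  filter_upwards [hCm] with m hm
  have hs0 : 0 < √((2 : ℝ) ^ m) := Real.sqrt_pos.2 (by positivity)
  have hmp := mesh_pos m
  have hmr : 0 < mesh m ^ r := Real.rpow_pos_of_pos (mesh_pos m) r
  -- Here s layers suffice: s · min(r, 1) ≥ r because s ≥ r + 1.
  have hpow : (mesh m ^ min r 1) ^ s ≤ mesh m ^ r := by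
    rw [← Real.rpow_natCast, ← Real.rpow_mul hmp.le]
    refine Real.rpow_le_rpow_of_exponent_ge hmp (mesh_le_one m) ?_
    have h1 := h.le_sub_one
    have h2 := h.r_pos
    rcases le_total r 1 with hr | hr
    · rw [min_eq_left hr]; nlinarith
    · rw [min_eq_right hr]; linarith
  have hrep : ∑ k : idx M₁ M₂ s y m, (∫ x, phi φ m k x * Q.eval x) * phi φ m k y = Ψ y / p y := by
    rw [← hQy, Finset.sum_coe_sort (idx M₁ M₂ s y m)
      fun k => (∫ x, phi φ m k x * Q.eval x) * phi φ m k y]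
    exact h.scaling.sum_coeff_mul_phi hQ m y fun k hk =>
      idx_mono h.length_pos.le y m (Nat.zero_le _) (h.scaling.mem_idx_zero hk)
  rw [← hrep, abs_sub_comm, ← Finset.sum_sub_distrib]
  calc _ ≤ ∑ k : idx M₁ M₂ s y m, |(∫ x, phi φ m k x * Q.eval x) * phi φ m k y -
        popCoef φ p Ψ M₁ M₂ s y m k * phi φ m k y| := Finset.abs_sum_le_sum_abs _ _
    _ ≤ ∑ _k : idx M₁ M₂ s y m, 2 * C * supNorm φ * mesh m ^ r := by
        refine Finset.sum_le_sum fun k _ => ?_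
        rw [← sub_mul, abs_mul]
        -- Only the coefficients with φ_{m,k}(y) ≠ 0 matter; their indices lie in the innermost
        -- layer, where the bound after s steps applies.
        by_cases hk : phi φ m k y = 0
        · rw [hk, abs_zero, mul_zero]
          positivity
        · have h1 := hm k (by rw [Nat.sub_self]; exact h.scaling.mem_idx_zero hk)
          calc _ ≤ (C * (√((2 : ℝ) ^ m))⁻¹ * (mesh m ^ r + mesh m ^ r)) *
                (√((2 : ℝ) ^ m) * supNorm φ) := by
                refine mul_le_mul (h1.trans ?_) (h.scaling.abs_phi_le m k y) (abs_nonneg _)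
                  (by positivity)
                exact mul_le_mul_of_nonneg_left (by linarith) (by positivity)
            _ = _ := by field_simp; ring
    _ = Fintype.card (idx M₁ M₂ s y m) * (2 * C * supNorm φ * mesh m ^ r) := by
        rw [Finset.sum_const, nsmul_eq_mul, Finset.card_univ]
    _ ≤ sysSize M₁ M₂ s y * (2 * C * supNorm φ * mesh m ^ r) :=
        mul_le_mul_of_nonneg_right (h.card_le m) (by positivity)
    _ = _ := by ring

end LocalModel

/-! ### Stability of the empirical linear system -/

section Sample

variable {φ : ℝ → ℝ} {M₁ M₂ : ℝ} {s : ℕ} {y : ℝ} {u : ℕ → ℤ → ℝ → ℝ} {m n : ℕ} {x : Fin n → ℝ}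

lemma invNorm_nonneg : 0 ≤ invNorm φ M₁ M₂ s y m x := norm_nonneg _

lemma Bhat_mulVec (a : idx M₁ M₂ s y m → ℝ) (j : idx M₁ M₂ s y m) :
    (Bhat φ M₁ M₂ s y m x).mulVec a j =
      (n : ℝ)⁻¹ * ∑ l, phi φ m j (x l) * ∑ k, a k * phi φ m k (x l) := by
  simp only [Matrix.mulVec, dotProduct, Bhat, Matrix.of_apply, Finset.mul_sum, Finset.sum_mul]
  rw [Finset.sum_comm]
  exact Finset.sum_congr rfl fun _ _ => Finset.sum_congr rfl fun _ _ => by ring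

lemma Bdelta_mulVec (a : idx M₁ M₂ s y m → ℝ) :
    (Bdelta φ M₁ M₂ s y m x).mulVec a =
      (Bhat φ M₁ M₂ s y m x).mulVec a + √((2 : ℝ) ^ m / n) • a := by
  rw [Bdelta, Matrix.add_mulVec, Matrix.smul_mulVec, Matrix.one_mulVec]

/-- `Bhat` is a Gram matrix, hence positive semidefinite, so the quadratic form of `Bdelta` is at
least that of its ridge. This holds for every sample. -/
lemma le_l2_Bdelta_mulVec (v : idx M₁ M₂ s y m → ℝ) :
    √((2 : ℝ) ^ m / n) * l2 v ≤ l2 ((Bdelta φ M₁ M₂ s y m x).mulVec v) := by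
  have hquad : √((2 : ℝ) ^ m / n) * l2 v ^ 2 ≤
      ∑ j, v j * (Bdelta φ M₁ M₂ s y m x).mulVec v j := by
    have h1 : ∑ j, v j * (Bdelta φ M₁ M₂ s y m x).mulVec v j =
        (n : ℝ)⁻¹ * ∑ l, (∑ k, v k * phi φ m k (x l)) ^ 2 + √((2 : ℝ) ^ m / n) * l2 v ^ 2 := by
      rw [Bdelta_mulVec, l2_sq]
      simp only [Pi.add_apply, Bhat_mulVec, Pi.smul_apply, smul_eq_mul, mul_add,
        Finset.sum_add_distrib]
      congr 1
      · simp only [sq, Finset.mul_sum, Finset.sum_mul]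
        rw [Finset.sum_comm]
        exact Finset.sum_congr rfl fun _ _ => Finset.sum_congr rfl fun _ _ =>
          Finset.sum_congr rfl fun _ _ => by ring
      · rw [Finset.mul_sum]
        exact Finset.sum_congr rfl fun _ _ => by ring
    rw [h1]
    have : 0 ≤ (n : ℝ)⁻¹ * ∑ l, (∑ k, v k * phi φ m k (x l)) ^ 2 :=
      mul_nonneg (by positivity) (Finset.sum_nonneg fun _ _ => sq_nonneg _)
    linarith
  have h2 := hquad.trans ((le_abs_self _).trans (abs_dot_le_l2 v _))
  rcases (l2_nonneg v).eq_or_lt with h0 | h0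
  · rw [← h0, mul_zero]
    exact l2_nonneg _
  · refine le_of_mul_le_mul_left ?_ h0
    calc _ = √((2 : ℝ) ^ m / n) * l2 v ^ 2 := by ring
      _ ≤ _ := h2

lemma IsScaling.abs_that_le_mul (hφ : IsScaling φ M₁ M₂ s) :
    |that φ M₁ M₂ s y u m x| ≤
      √((2 : ℝ) ^ m) * Cphi φ * (invNorm φ M₁ M₂ s y m x * l2 (chat M₁ M₂ s y u m x)) := by
  refine (abs_dot_le_l2 _ _).trans ?_
  rw [mul_comm]
  exact mul_le_mul (hφ.l2_phi_le m y _) (l2_mulVec_le _ _) (l2_nonneg _)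
    (mul_nonneg (Real.sqrt_nonneg _) hφ.Cphi_nonneg)

lemma l2_chat_le {U : ℝ} (hU : 0 ≤ U) (h : ∀ k ∈ idx M₁ M₂ s y m, ∀ l, |u m k (x l)| ≤ U) :
    l2 (chat M₁ M₂ s y u m x) ≤ √(sysSize M₁ M₂ s y) * U := by
  refine (l2_le_of_abs_le (c := U) hU fun k => ?_).trans
    (mul_le_mul_of_nonneg_right (Real.sqrt_le_sqrt ?_) hU)
  · rw [chat, abs_mul, abs_of_nonneg (show (0 : ℝ) ≤ (n : ℝ)⁻¹ by positivity)]
    have : |∑ l, u m k (x l)| ≤ n * U :=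
      (Finset.abs_sum_le_sum_abs _ _).trans
        ((Finset.sum_le_sum fun l _ => h k k.2 l).trans (by simp))
    rcases Nat.eq_zero_or_pos n with h0 | h0
    · subst h0; simpa using hU
    · rw [inv_mul_le_iff₀ (by exact_mod_cast h0)]
      exact this
  · rw [Fintype.card_coe]
    exact_mod_cast card_idx_le_sysSize M₁ M₂ s y m

/-- A crude bound for the estimator that holds for every sample. -/
lemma IsScaling.abs_that_le (hφ : IsScaling φ M₁ M₂ s) (hn : 0 < n) {U : ℝ} (hU : 0 ≤ U)
    (h : ∀ k ∈ idx M₁ M₂ s y m, ∀ l, |u m k (x l)| ≤ U) :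
    |that φ M₁ M₂ s y u m x| ≤ Cphi φ * √(sysSize M₁ M₂ s y) * √n * U := by
  have hn' : (0 : ℝ) < n := by exact_mod_cast hn
  have hδ : 0 < √((2 : ℝ) ^ m / n) := Real.sqrt_pos.2 (by positivity)
  -- The ridge bounds the inverse without any event; in the product with φ_{m,k}(y) the powers of
  -- 2^m cancel, since 2^{m/2}/δ_m = √n.
  have h1 : invNorm φ M₁ M₂ s y m x ≤ (√((2 : ℝ) ^ m / n))⁻¹ :=
    specNorm_inv_le hδ le_l2_Bdelta_mulVec
  have hC := hφ.Cphi_nonneg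
  calc _ ≤ _ := hφ.abs_that_le_mul
    _ ≤ √((2 : ℝ) ^ m) * Cphi φ * ((√((2 : ℝ) ^ m / n))⁻¹ * (√(sysSize M₁ M₂ s y) * U)) :=
        mul_le_mul_of_nonneg_left (mul_le_mul h1 (l2_chat_le hU h) (l2_nonneg _) (by positivity))
          (by positivity)
    _ = _ := by
        rw [Real.sqrt_div (by positivity)]
        have : 0 < √((2 : ℝ) ^ m) := Real.sqrt_pos.2 (by positivity)
        field_simp

/-- The stochastic error of the estimator in terms of the residual of the population solution. -/
lemma IsScaling.abs_that_sub_le (hφ : IsScaling φ M₁ M₂ s)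
    (hA : IsUnit (Bdelta φ M₁ M₂ s y m x).det) (a c : idx M₁ M₂ s y m → ℝ) {d₁ d₂ : ℝ}
    (hd₁ : l2 (chat M₁ M₂ s y u m x - c) ≤ d₁)
    (hd₂ : l2 ((Bhat φ M₁ M₂ s y m x).mulVec a - c) ≤ d₂) :
    |that φ M₁ M₂ s y u m x - ∑ k, a k * phi φ m k y| ≤
      √((2 : ℝ) ^ m) * Cphi φ *
        (invNorm φ M₁ M₂ s y m x * (d₁ + d₂ + √((2 : ℝ) ^ m / n) * l2 a)) := by
  set A := Bdelta φ M₁ M₂ s y m x with hAdef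
  set ĉ := chat M₁ M₂ s y u m x with hc
  have h1 : that φ M₁ M₂ s y u m x - ∑ k, a k * phi φ m k y =
      ∑ k, (A⁻¹.mulVec (ĉ - A.mulVec a)) k * phi φ m k y := by
    rw [Matrix.mulVec_sub, inv_mulVec_mulVec hA, that, ← Finset.sum_sub_distrib]
    exact Finset.sum_congr rfl fun _ _ => by simp only [Pi.sub_apply, sub_mul]; rfl
  -- Three sources of error: noise in the vector, noise in the matrix along the fixed vector `a`,
  -- and the bias of the ridge.
  have h2 : ĉ - A.mulVec a = (ĉ - c) - ((Bhat φ M₁ M₂ s y m x).mulVec a - c) -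
      √((2 : ℝ) ^ m / n) • a := by
    rw [hAdef, Bdelta_mulVec]
    abel
  have h3 : l2 (ĉ - A.mulVec a) ≤ d₁ + d₂ + √((2 : ℝ) ^ m / n) * l2 a := by
    rw [h2]
    refine (l2_sub_le _ _).trans (add_le_add ((l2_sub_le _ _).trans (add_le_add hd₁ hd₂)) ?_)
    rw [l2_smul, abs_of_nonneg (Real.sqrt_nonneg _)]
  rw [h1]
  refine (abs_dot_le_l2 _ _).trans ?_
  rw [mul_comm]
  refine mul_le_mul (hφ.l2_phi_le m y _) ((l2_mulVec_le _ _).trans ?_) (l2_nonneg _)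
    (mul_nonneg (Real.sqrt_nonneg _) hφ.Cphi_nonneg)
  exact mul_le_mul_of_nonneg_left h3 invNorm_nonneg

end Sample

/-! ### Conditioning of the empirical matrix near p(y) I -/

namespace LocalModel

variable {p Ψ φ : ℝ → ℝ} {M₁ M₂ : ℝ} {s : ℕ} {y r : ℝ} {m n : ℕ} {x : Fin n → ℝ}

/-- The tolerance for the entries of the empirical matrix. -/
def tol (p : ℝ → ℝ) (M₁ M₂ : ℝ) (s : ℕ) (y : ℝ) : ℝ := p y / (8 * sysSize M₁ M₂ s y)

lemma tol_pos (h : LocalModel p Ψ φ M₁ M₂ s y r) : 0 < tol p M₁ M₂ s y := by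
  have := h.sysSize_pos
  have := h.p_pos
  unfold tol
  positivity

/-- Each entry differs from that of p(y) I by at most three tolerances: empirical to population,
population to limit, and ridge. Since M · 4 `tol` = p(y)/2, the perturbation is at most half of p(y)
I. -/
lemma Bdelta_bounds (h : LocalModel p Ψ φ M₁ M₂ s y r)
    (hpop : ∀ j ∈ idx M₁ M₂ s y m, ∀ k ∈ idx M₁ M₂ s y m,
      |popB φ p m j k - (if j = k then p y else 0)| ≤ tol p M₁ M₂ s y)
    (hδ : √((2 : ℝ) ^ m / n) ≤ tol p M₁ M₂ s y)
    (hB : ∀ j k, |Bhat φ M₁ M₂ s y m x j k - popB φ p m j k| ≤ tol p M₁ M₂ s y)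
    (v : idx M₁ M₂ s y m → ℝ) :
    p y / 2 * l2 v ≤ l2 ((Bdelta φ M₁ M₂ s y m x).mulVec v) ∧
      l2 ((Bdelta φ M₁ M₂ s y m x).mulVec v) ≤ 3 * p y / 2 * l2 v := by
  have hp := h.p_pos
  have hM := h.sysSize_pos
  have ht := h.tol_pos
  refine l2_mulVec_bounds hp (ε := 4 * tol p M₁ M₂ s y) (by positivity) ?_ ?_ v
  · calc _ ≤ (sysSize M₁ M₂ s y : ℝ) * (4 * tol p M₁ M₂ s y) :=
          mul_le_mul_of_nonneg_right (h.card_le m) (by positivity)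
      _ = _ := by rw [tol]; field_simp; ring
  · intro i j
    have e1 := hpop i i.2 j j.2
    have e2 := hB i j
    have e3 : Bdelta φ M₁ M₂ s y m x i j = Bhat φ M₁ M₂ s y m x i j +
        (if i = j then √((2 : ℝ) ^ m / n) else 0) := by
      simp [Bdelta, Matrix.one_apply]
    have e4 : |(if i = j then √((2 : ℝ) ^ m / n) else 0)| ≤ tol p M₁ M₂ s y := by
      split_ifs
      · rwa [abs_of_nonneg (Real.sqrt_nonneg _)]
      · simpa using ht.le
    have e5 : (if i = j then p y else 0) = (if (i : ℤ) = j then p y else 0) := by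
      simp only [Subtype.ext_iff]
    rw [e3, e5]
    have e6 := abs_add_three (Bhat φ M₁ M₂ s y m x i j - popB φ p m i j)
      (popB φ p m i j - (if (i : ℤ) = j then p y else 0))
      (if i = j then √((2 : ℝ) ^ m / n) else 0)
    calc _ = |(Bhat φ M₁ M₂ s y m x i j - popB φ p m i j) +
        (popB φ p m i j - (if (i : ℤ) = j then p y else 0)) +
        (if i = j then √((2 : ℝ) ^ m / n) else 0)| := by ring_nf
      _ ≤ _ := by linarith

/-- Consequences of the closeness of the empirical matrix to `p(y) I`. -/
lemma invNorm_bounds (h : LocalModel p Ψ φ M₁ M₂ s y r)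
    (hpop : ∀ j ∈ idx M₁ M₂ s y m, ∀ k ∈ idx M₁ M₂ s y m,
      |popB φ p m j k - (if j = k then p y else 0)| ≤ tol p M₁ M₂ s y)
    (hδ : √((2 : ℝ) ^ m / n) ≤ tol p M₁ M₂ s y)
    (hB : ∀ j k, |Bhat φ M₁ M₂ s y m x j k - popB φ p m j k| ≤ tol p M₁ M₂ s y) :
    IsUnit (Bdelta φ M₁ M₂ s y m x).det ∧ invNorm φ M₁ M₂ s y m x ≤ 2 / p y ∧
      1 ≤ 3 * p y / 2 * invNorm φ M₁ M₂ s y m x := by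
  have hp := h.p_pos
  have hb := h.Bdelta_bounds hpop hδ hB
  have hu := isUnit_det_of_l2_le (by positivity) fun v => (hb v).1
  refine ⟨hu, ?_, ?_⟩
  · have := specNorm_inv_le (by positivity) fun v => (hb v).1
    rwa [inv_div] at this
  · have : Nonempty (idx M₁ M₂ s y m) := (h.scaling.idx_nonempty h.s_pos y m).to_subtype
    exact one_le_mul_specNorm_inv hu fun v => (hb v).2

lemma l2_Bhat_mulVec_sub_le (h : LocalModel p Ψ φ M₁ M₂ s y r)
    (hB : ∀ j k, |Bhat φ M₁ M₂ s y m x j k - popB φ p m j k| ≤ tol p M₁ M₂ s y)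
    (a : idx M₁ M₂ s y m → ℝ) :
    l2 ((Bhat φ M₁ M₂ s y m x).mulVec a - (popMat φ p M₁ M₂ s y m).mulVec a) ≤
      p y / 8 * l2 a := by
  have h1 := abs_l2_mulVec_sub_le (A := Bhat φ M₁ M₂ s y m x - popMat φ p M₁ M₂ s y m) (c := 0)
    h.tol_pos.le (fun i j => by simpa [popMat] using hB i j) a
  rw [zero_smul, sub_zero, Matrix.sub_mulVec] at h1
  refine h1.trans (mul_le_mul_of_nonneg_right ?_ (l2_nonneg a))
  have hM := h.sysSize_pos
  calc _ ≤ (sysSize M₁ M₂ s y : ℝ) * tol p M₁ M₂ s y :=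
        mul_le_mul_of_nonneg_right (h.card_le m) h.tol_pos.le
    _ = _ := by rw [tol]; field_simp

end LocalModel

/-! ### Errors at a fixed level -/

namespace LocalModel

variable {p Ψ φ : ℝ → ℝ} {M₁ M₂ : ℝ} {s : ℕ} {y r : ℝ} {m n : ℕ} {x : Fin n → ℝ}

/-- The constant in the bound for the norm of the population solution. -/
def coefConst (p Ψ : ℝ → ℝ) (M₁ M₂ : ℝ) (s : ℕ) (y : ℝ) : ℝ :=
  2 / p y * (√(sysSize M₁ M₂ s y) * (supNorm Ψ * √(M₂ - M₁)))

lemma coefConst_nonneg (h : LocalModel p Ψ φ M₁ M₂ s y r) : 0 ≤ coefConst p Ψ M₁ M₂ s y := by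
  have := h.p_pos
  have := supNorm_nonneg Ψ
  unfold coefConst
  positivity

/-- The norm is an essential supremum, so the value at the single point y is controlled only through
continuity there, which the smoothness provides. -/
lemma p_le_supNorm (h : LocalModel p Ψ φ M₁ M₂ s y r) : p y ≤ supNorm p := by
  refine (le_abs_self _).trans (abs_le_supNorm_of_continuousAt h.p_mem ?_)
  obtain ⟨ε, hε, K, hK, hloc⟩ := h.p_smooth.exists_abs_sub_le h.r_pos
  rw [ContinuousAt, tendsto_iff_norm_sub_tendsto_zero]
  have hlim : Tendsto (fun z => K * |z - y| ^ min r 1) (𝓝 y) (𝓝 0) := by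
    have hc : Continuous fun z : ℝ => |z - y| := by fun_prop
    have h1 : Tendsto (fun z : ℝ => |z - y|) (𝓝 y) (𝓝 0) := by
      simpa using hc.tendsto y
    have := (h1.rpow_const (p := min r 1) (Or.inr h.min_pos.le)).const_mul K
    simpa [Real.zero_rpow h.min_pos.ne'] using this
  refine squeeze_zero' (Eventually.of_forall fun _ => norm_nonneg _) ?_ hlim
  filter_upwards [Metric.ball_mem_nhds y hε] with z hz
  exact hloc z (by simpa [Real.dist_eq] using hz)

/-- H will bound the function Σ a_k φ_{m,k} of the population solution uniformly in m and x. The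
second inequality is the only place where the size of λ is used: the slack 3/4 leaves room for 1/4
from the ridge and 1/2 to absorb the bias in Lepski's comparison. -/
lemma exists_height (h : LocalModel p Ψ φ M₁ M₂ s y r) {ν₁ ν₂ : ℝ} (hν₁ : 0 < ν₁) (hν₂ : 0 < ν₂)
    (hν : ν₁ + ν₂ < 1) :
    ∃ H, 0 < H ∧ supNorm φ * √(sysSize M₁ M₂ s y) * coefConst p Ψ M₁ M₂ s y ≤ H ∧
      3 * p y * (Cphi φ * √(sysSize M₁ M₂ s y) * √(supNorm p)) * (1 + H) ≤
        lamConst φ p Ψ (sysSize M₁ M₂ s y) ν₁ ν₂ - 3 / 4 := by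
  have hp := h.p_pos
  have hF := supNorm_nonneg φ
  have hS := supNorm_nonneg Ψ
  have hP := supNorm_nonneg p
  have hC := h.scaling.Cphi_nonneg
  have hM := h.sysSize_pos
  set M : ℝ := (sysSize M₁ M₂ s y : ℝ) with hMdef
  set W := Cphi φ * √M * √(supNorm p) with hW
  have hW0 : 0 ≤ W := by positivity
  have hMM : √M * √M = M := Real.mul_self_sqrt hM.le
  -- The second summand only makes H positive, in case the first vanishes; it costs W/(4(W + 1)) ≤
  -- 1/4 below.
  refine ⟨2 / p y * (supNorm φ * M * √M * supNorm Ψ) + 1 / (12 * p y * (W + 1)), by positivity,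
    ?_, ?_⟩
  · have e1 : supNorm φ * √M * coefConst p Ψ M₁ M₂ s y =
        2 / p y * (supNorm φ * M * √(M₂ - M₁) * supNorm Ψ) := by
      rw [coefConst, ← hMdef]
      linear_combination (2 / p y * supNorm φ * √(M₂ - M₁) * supNorm Ψ) * hMM
    rw [e1]
    have e2 : √(M₂ - M₁) ≤ √M := Real.sqrt_le_sqrt (h.scaling.length_le_sysSize h.s_pos y)
    have e3 : 2 / p y * (supNorm φ * M * √(M₂ - M₁) * supNorm Ψ) ≤
        2 / p y * (supNorm φ * M * √M * supNorm Ψ) := by gcongr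
    have e4 : 0 < 1 / (12 * p y * (W + 1)) := by positivity
    linarith
  · have hν1 : 1 ≤ (1 - ν₁) ^ (-(1 / 2) : ℝ) :=
      Real.one_le_rpow_of_pos_of_le_one_of_nonpos (by linarith) (by linarith) (by norm_num)
    have hν2 : 0 < (1 - ν₂)⁻¹ := inv_pos.2 (by linarith)
    set A := supNorm Ψ * supNorm φ * M * √M with hA
    have hA0 : 0 ≤ A := by positivity
    have hD : p y + A ≤ Dconst φ p Ψ (sysSize M₁ M₂ s y) ν₁ ν₂ := by
      rw [Dconst, ← hMdef, ← hA]
      have h1 : A ≤ A * (1 - ν₁) ^ (-(1 / 2) : ℝ) := le_mul_of_one_le_right hA0 hν1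
      have h2 : 0 ≤ 16 * supNorm Ψ * supNorm φ ^ 2 * supNorm p ^ (3 / 2 : ℝ) * M ^ 3 * √M *
        (1 - ν₂)⁻¹ := by positivity
      linarith [h.p_le_supNorm]
    have hlam : lamConst φ p Ψ (sysSize M₁ M₂ s y) ν₁ ν₂ =
        16 * W * Dconst φ p Ψ (sysSize M₁ M₂ s y) ν₁ ν₂ + 1 := by
      rw [lamConst, ← hMdef, hW, Real.sqrt_eq_rpow (supNorm p)]
      ring
    have e5 : 3 * p y * W * (1 + (2 / p y * (supNorm φ * M * √M * supNorm Ψ) +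
        1 / (12 * p y * (W + 1)))) = 3 * W * (p y + 2 * A) + W / (W + 1) / 4 := by
      rw [hA]
      field_simp
      ring
    have e6 : W / (W + 1) ≤ 1 := by rw [div_le_one (by positivity)]; linarith
    have e7 : 3 * W * (p y + 2 * A) ≤ 16 * W * Dconst φ p Ψ (sysSize M₁ M₂ s y) ν₁ ν₂ := by
      calc 3 * W * (p y + 2 * A) ≤ 16 * W * (p y + A) := by
            have := mul_nonneg hW0 hp.le
            have := mul_nonneg hW0 hA0
            linarith
        _ ≤ _ := mul_le_mul_of_nonneg_left hD (by positivity)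
    rw [e5, hlam]
    linarith

/-- A level at which the population system is close to its limit and its solution has bias at most
`Cb 2^{-rm}`. -/
structure FineLevel (p Ψ φ : ℝ → ℝ) (M₁ M₂ : ℝ) (s : ℕ) (y r Cb : ℝ) (m : ℕ) : Prop where
  pop_close : ∀ j ∈ idx M₁ M₂ s y m, ∀ k ∈ idx M₁ M₂ s y m,
    |popB φ p m j k - (if j = k then p y else 0)| ≤ tol p M₁ M₂ s y
  solves : (popMat φ p M₁ M₂ s y m).mulVec (popCoef φ p Ψ M₁ M₂ s y m) = popVec φ Ψ M₁ M₂ s y m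
  coef_le : l2 (popCoef φ p Ψ M₁ M₂ s y m) ≤ coefConst p Ψ M₁ M₂ s y * (√((2 : ℝ) ^ m))⁻¹
  bias_le : |∑ k, popCoef φ p Ψ M₁ M₂ s y m k * phi φ m k y - Ψ y / p y| ≤ Cb * mesh m ^ r

lemma exists_fineLevel (h : LocalModel p Ψ φ M₁ M₂ s y r) :
    ∃ Cb, 0 ≤ Cb ∧ ∀ᶠ m in atTop, FineLevel p Ψ φ M₁ M₂ s y r Cb m := by
  obtain ⟨Cb, hCb, hbias⟩ := h.exists_bias_le
  refine ⟨Cb, hCb, ?_⟩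
  filter_upwards [hbias, h.eventually_abs_popB_sub_le h.tol_pos, h.eventually_popMat_popCoef,
    h.eventually_l2_popCoef_le] with m h1 h2 h3 h4
  exact ⟨h2, h3, h4, h1⟩

/-- Coefficients of order 2^{-m/2} meet functions of order 2^{m/2}. -/
lemma FineLevel.abs_sum_le (h : LocalModel p Ψ φ M₁ M₂ s y r) {Cb H : ℝ}
    (hm : FineLevel p Ψ φ M₁ M₂ s y r Cb m)
    (hH : supNorm φ * √(sysSize M₁ M₂ s y) * coefConst p Ψ M₁ M₂ s y ≤ H) (z : ℝ) :
    |∑ k, popCoef φ p Ψ M₁ M₂ s y m k * phi φ m k z| ≤ H := by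
  have hs0 : 0 < √((2 : ℝ) ^ m) := Real.sqrt_pos.2 (by positivity)
  have hF := supNorm_nonneg φ
  calc _ ≤ ∑ k, |popCoef φ p Ψ M₁ M₂ s y m k * phi φ m k z| := Finset.abs_sum_le_sum_abs _ _
    _ ≤ ∑ k, |popCoef φ p Ψ M₁ M₂ s y m k| * (√((2 : ℝ) ^ m) * supNorm φ) :=
        Finset.sum_le_sum fun k _ => by
          rw [abs_mul]
          exact mul_le_mul_of_nonneg_left (h.scaling.abs_phi_le m k z) (abs_nonneg _)
    _ = (∑ k, |popCoef φ p Ψ M₁ M₂ s y m k|) * (√((2 : ℝ) ^ m) * supNorm φ) := by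
        rw [Finset.sum_mul]
    _ ≤ (√(sysSize M₁ M₂ s y) * (coefConst p Ψ M₁ M₂ s y * (√((2 : ℝ) ^ m))⁻¹)) *
        (√((2 : ℝ) ^ m) * supNorm φ) := by
        refine mul_le_mul_of_nonneg_right ((sum_abs_le_l2 _).trans ?_) (by positivity)
        exact mul_le_mul (Real.sqrt_le_sqrt (h.card_le m)) hm.coef_le (l2_nonneg _) (by positivity)
    _ = supNorm φ * √(sysSize M₁ M₂ s y) * coefConst p Ψ M₁ M₂ s y := by field_simp
    _ ≤ H := hH

variable {u : ℕ → ℤ → ℝ → ℝ}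

/-- On the event that the empirical system is close to the population system, the estimator at one
level is bounded. -/
lemma FineLevel.abs_that_sub_le_const (h : LocalModel p Ψ φ M₁ M₂ s y r) {Cb : ℝ} (hCb : 0 ≤ Cb)
    (hm : FineLevel p Ψ φ M₁ M₂ s y r Cb m) (hδ : √((2 : ℝ) ^ m / n) ≤ tol p M₁ M₂ s y)
    (hB : ∀ j k, |Bhat φ M₁ M₂ s y m x j k - popB φ p m j k| ≤ tol p M₁ M₂ s y)
    (hc : ∀ k, |chat M₁ M₂ s y u m x k - popC φ Ψ m k| ≤ (√((2 : ℝ) ^ m))⁻¹) :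
    |that φ M₁ M₂ s y u m x - Ψ y / p y| ≤
      Cphi φ * (2 / p y * (√(sysSize M₁ M₂ s y) + p y / 8 * coefConst p Ψ M₁ M₂ s y +
        tol p M₁ M₂ s y * coefConst p Ψ M₁ M₂ s y)) + Cb := by
  have hs0 : 0 < √((2 : ℝ) ^ m) := Real.sqrt_pos.2 (by positivity)
  have hp := h.p_pos
  have hC := h.scaling.Cphi_nonneg
  have ht := h.tol_pos
  have hK := h.coefConst_nonneg
  obtain ⟨hu, hκ, -⟩ := h.invNorm_bounds hm.pop_close hδ hB
  have h1 := h.scaling.abs_that_sub_le (u := u) hu (popCoef φ p Ψ M₁ M₂ s y m)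
    (popVec φ Ψ M₁ M₂ s y m) (d₁ := √(sysSize M₁ M₂ s y) * (√((2 : ℝ) ^ m))⁻¹)
    (d₂ := p y / 8 * (coefConst p Ψ M₁ M₂ s y * (√((2 : ℝ) ^ m))⁻¹))
    ((l2_le_of_abs_le (c := (√((2 : ℝ) ^ m))⁻¹) (by positivity) hc).trans
      (mul_le_mul_of_nonneg_right (Real.sqrt_le_sqrt (h.card_le m)) (by positivity)))
    (by
      rw [← hm.solves]
      exact (h.l2_Bhat_mulVec_sub_le hB _).trans
        (mul_le_mul_of_nonneg_left hm.coef_le (by positivity)))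
  have h2 : √((2 : ℝ) ^ m / n) * l2 (popCoef φ p Ψ M₁ M₂ s y m) ≤
      tol p M₁ M₂ s y * (coefConst p Ψ M₁ M₂ s y * (√((2 : ℝ) ^ m))⁻¹) :=
    mul_le_mul hδ hm.coef_le (l2_nonneg _) ht.le
  have h3 : mesh m ^ r ≤ 1 := Real.rpow_le_one (mesh_pos m).le (mesh_le_one m) h.r_pos.le
  calc _ ≤ |that φ M₁ M₂ s y u m x - ∑ k, popCoef φ p Ψ M₁ M₂ s y m k * phi φ m k y| +
        |∑ k, popCoef φ p Ψ M₁ M₂ s y m k * phi φ m k y - Ψ y / p y| := _root_.abs_sub_le _ _ _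
    _ ≤ √((2 : ℝ) ^ m) * Cphi φ * (2 / p y * (√(sysSize M₁ M₂ s y) * (√((2 : ℝ) ^ m))⁻¹ +
          p y / 8 * (coefConst p Ψ M₁ M₂ s y * (√((2 : ℝ) ^ m))⁻¹) +
          tol p M₁ M₂ s y * (coefConst p Ψ M₁ M₂ s y * (√((2 : ℝ) ^ m))⁻¹))) + Cb := by
        refine add_le_add (h1.trans (mul_le_mul_of_nonneg_left ?_ (by positivity)))
          (hm.bias_le.trans (mul_le_of_le_one_right hCb h3))
        refine mul_le_mul hκ (by linarith) ?_ (by positivity)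
        have := l2_nonneg (popCoef φ p Ψ M₁ M₂ s y m)
        positivity
    _ = _ := by field_simp

/-- The error at one level in terms of `‖B̂_δ⁻¹‖²`, on the event that the deviations of the sample
means are of the order of their standard deviations up to a logarithmic factor. -/
lemma FineLevel.abs_that_sub_le_rho (h : LocalModel p Ψ φ M₁ M₂ s y r) {Cb H lam : ℝ}
    (hCb : 0 ≤ Cb) (hm : FineLevel p Ψ φ M₁ M₂ s y r Cb m) (hH : 0 < H)
    (hlam : 3 * p y * (Cphi φ * √(sysSize M₁ M₂ s y) * √(supNorm p)) * (1 + H) ≤ lam - 3 / 4)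
    (hn : 1 < n)
    (hlog : 3 * p y / 2 * Cphi φ * coefConst p Ψ M₁ M₂ s y ≤ 1 / 4 * √(Real.log n))
    (hδ : √((2 : ℝ) ^ m / n) ≤ tol p M₁ M₂ s y)
    (hB : ∀ j k, |Bhat φ M₁ M₂ s y m x j k - popB φ p m j k| ≤ tol p M₁ M₂ s y)
    (hc : ∀ k, |chat M₁ M₂ s y u m x k - popC φ Ψ m k| ≤
      2 * √(supNorm p * (1 + gam M₁ M₂ s y u m ^ 2) * (Real.log n / n)))
    (hBc : ∀ j, |(Bhat φ M₁ M₂ s y m x).mulVec (popCoef φ p Ψ M₁ M₂ s y m) j - popC φ Ψ m j| ≤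
      2 * √(supNorm p * H ^ 2 * (Real.log n / n))) :
    |that φ M₁ M₂ s y u m x - Ψ y / p y| ≤ invNorm φ M₁ M₂ s y m x ^ 2 *
      ((lam - 1 / 2) * √(rhoSq M₁ M₂ s y u m n) + Cb * (3 * p y / 2) ^ 2 * mesh m ^ r) := by
  have hs0 : 0 < √((2 : ℝ) ^ m) := Real.sqrt_pos.2 (by positivity)
  have hp := h.p_pos
  have hC := h.scaling.Cphi_nonneg
  have hK := h.coefConst_nonneg
  have hP := supNorm_nonneg p
  have hn' : (0 : ℝ) < n := by exact_mod_cast (by omega : 0 < n)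
  have hl : 0 < Real.log n := Real.log_pos (by exact_mod_cast hn)
  have hmr : 0 < mesh m ^ r := Real.rpow_pos_of_pos (mesh_pos m) r
  set κ := invNorm φ M₁ M₂ s y m x with hκdef
  have hκ0 : 0 ≤ κ := invNorm_nonneg
  set γ := gam M₁ M₂ s y u m with hγ
  set ρ := √(rhoSq M₁ M₂ s y u m n) with hρ
  set M : ℝ := (sysSize M₁ M₂ s y : ℝ) with hM
  have hM0 : 0 < M := h.sysSize_pos
  set G := √(1 + γ ^ 2) with hG
  have hG1 : 1 ≤ G := by
    rw [hG, Real.one_le_sqrt]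
    linarith [sq_nonneg γ]
  set ℓ := √(Real.log n / n) with hℓ
  have hρeq : ρ = √((2 : ℝ) ^ m) * G * ℓ := by
    rw [hρ, rhoSq, hG, hℓ, ← Real.sqrt_mul (by positivity), ← Real.sqrt_mul (by positivity)]
    congr 1
    rw [← hγ]
    field_simp
  have hρ0 : 0 ≤ ρ := Real.sqrt_nonneg _
  obtain ⟨hu, -, hκ1⟩ := h.invNorm_bounds hm.pop_close hδ hB
  rw [← hκdef] at hκ1
  have e1 : √(supNorm p * (1 + γ ^ 2) * (Real.log n / n)) = √(supNorm p) * G * ℓ := by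
    rw [hG, hℓ, Real.sqrt_mul (by positivity), Real.sqrt_mul hP]
  have e2 : √(supNorm p * H ^ 2 * (Real.log n / n)) = √(supNorm p) * H * ℓ := by
    rw [hℓ, Real.sqrt_mul (by positivity), Real.sqrt_mul hP, Real.sqrt_sq hH.le]
  rw [e1] at hc
  rw [e2] at hBc
  have h1 := h.scaling.abs_that_sub_le (u := u) hu (popCoef φ p Ψ M₁ M₂ s y m)
    (popVec φ Ψ M₁ M₂ s y m) (d₁ := √M * (2 * (√(supNorm p) * G * ℓ)))
    (d₂ := √M * (2 * (√(supNorm p) * H * ℓ)))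
    ((l2_le_of_abs_le (c := 2 * (√(supNorm p) * G * ℓ)) (by positivity) hc).trans
      (mul_le_mul_of_nonneg_right (Real.sqrt_le_sqrt (h.card_le m)) (by positivity)))
    ((l2_le_of_abs_le (c := 2 * (√(supNorm p) * H * ℓ)) (by positivity) hBc).trans
      (mul_le_mul_of_nonneg_right (Real.sqrt_le_sqrt (h.card_le m)) (by positivity)))
  have h2 : √((2 : ℝ) ^ m / n) * l2 (popCoef φ p Ψ M₁ M₂ s y m) ≤
      √((2 : ℝ) ^ m / n) * (coefConst p Ψ M₁ M₂ s y * (√((2 : ℝ) ^ m))⁻¹) :=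
    mul_le_mul_of_nonneg_left hm.coef_le (by positivity)
  have h3 : √((2 : ℝ) ^ m) * (√((2 : ℝ) ^ m / n) *
      (coefConst p Ψ M₁ M₂ s y * (√((2 : ℝ) ^ m))⁻¹)) * √(Real.log n) ≤
      coefConst p Ψ M₁ M₂ s y * ρ := by
    have : √((2 : ℝ) ^ m) * (√((2 : ℝ) ^ m / n) *
        (coefConst p Ψ M₁ M₂ s y * (√((2 : ℝ) ^ m))⁻¹)) * √(Real.log n) =
        coefConst p Ψ M₁ M₂ s y * (√((2 : ℝ) ^ m) * 1 * ℓ) := by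
      rw [hℓ, Real.sqrt_div (by positivity), Real.sqrt_div hl.le]
      field_simp
    rw [this, hρeq]
    gcongr
  have hL0 : 0 < √(Real.log n) := Real.sqrt_pos.2 hl
  set E := √((2 : ℝ) ^ m) * (√((2 : ℝ) ^ m / n) *
      (coefConst p Ψ M₁ M₂ s y * (√((2 : ℝ) ^ m))⁻¹)) with hE
  have hE0 : 0 ≤ E := by positivity
  -- The ridge bias is smaller than ρ by a factor √(log n), so for large n it costs at most a
  -- quarter.
  have h4 : 3 * p y / 2 * Cphi φ * E ≤ 1 / 4 * ρ := by
    refine le_of_mul_le_mul_right ?_ hL0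
    calc 3 * p y / 2 * Cphi φ * E * √(Real.log n) = 3 * p y / 2 * Cphi φ * (E * √(Real.log n)) := by
          ring
      _ ≤ 3 * p y / 2 * Cphi φ * (coefConst p Ψ M₁ M₂ s y * ρ) :=
          mul_le_mul_of_nonneg_left h3 (by positivity)
      _ = 3 * p y / 2 * Cphi φ * coefConst p Ψ M₁ M₂ s y * ρ := by ring
      _ ≤ 1 / 4 * √(Real.log n) * ρ := mul_le_mul_of_nonneg_right hlog hρ0
      _ = _ := by ring
  have h5 : √((2 : ℝ) ^ m) * (G * ℓ + H * ℓ) ≤ (1 + H) * ρ := by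
    rw [hρeq]
    calc √((2 : ℝ) ^ m) * (G * ℓ + H * ℓ) = √((2 : ℝ) ^ m) * ((G + H * 1) * ℓ) := by ring
      _ ≤ √((2 : ℝ) ^ m) * ((G + H * G) * ℓ) := by gcongr
      _ = _ := by ring
  have h6 : |that φ M₁ M₂ s y u m x - ∑ k, popCoef φ p Ψ M₁ M₂ s y m k * phi φ m k y| ≤
      κ * (2 * (Cphi φ * √M * √(supNorm p)) * ((1 + H) * ρ) + Cphi φ * E) := by
    refine h1.trans ?_
    calc _ ≤ √((2 : ℝ) ^ m) * Cphi φ * (κ * (√M * (2 * (√(supNorm p) * G * ℓ)) +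
          √M * (2 * (√(supNorm p) * H * ℓ)) +
          √((2 : ℝ) ^ m / n) * (coefConst p Ψ M₁ M₂ s y * (√((2 : ℝ) ^ m))⁻¹))) := by
          gcongr
      _ = κ * (2 * (Cphi φ * √M * √(supNorm p)) * (√((2 : ℝ) ^ m) * (G * ℓ + H * ℓ)) +
          Cphi φ * E) := by rw [hE]; ring
      _ ≤ _ := by gcongr
  -- λ - 3/4 for the noise and 1/4 for the ridge add up to λ - 1/2.
  have h7 : 3 * p y / 2 * (2 * (Cphi φ * √M * √(supNorm p)) * ((1 + H) * ρ) + Cphi φ * E) ≤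
      (lam - 1 / 2) * ρ := by
    have := mul_le_mul_of_nonneg_right hlam hρ0
    linarith
  -- As 1 ≤ (3 p(y)/2) κ, one factor κ becomes κ²; the bias is treated in the same way with two
  -- factors.
  have h8 : κ * (2 * (Cphi φ * √M * √(supNorm p)) * ((1 + H) * ρ) + Cphi φ * E) ≤
      κ ^ 2 * ((lam - 1 / 2) * ρ) := by
    have h0 : 0 ≤ 2 * (Cphi φ * √M * √(supNorm p)) * ((1 + H) * ρ) + Cphi φ * E := by positivity
    calc _ = 1 * (κ * (2 * (Cphi φ * √M * √(supNorm p)) * ((1 + H) * ρ) + Cphi φ * E)) := by ring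
      _ ≤ (3 * p y / 2 * κ) *
          (κ * (2 * (Cphi φ * √M * √(supNorm p)) * ((1 + H) * ρ) + Cphi φ * E)) :=
          mul_le_mul_of_nonneg_right hκ1 (by positivity)
      _ = κ ^ 2 * (3 * p y / 2 *
          (2 * (Cphi φ * √M * √(supNorm p)) * ((1 + H) * ρ) + Cphi φ * E)) := by ring
      _ ≤ _ := mul_le_mul_of_nonneg_left h7 (by positivity)
  have h9 : Cb * mesh m ^ r ≤ κ ^ 2 * (Cb * (3 * p y / 2) ^ 2 * mesh m ^ r) := by
    have : 1 ≤ (3 * p y / 2 * κ) ^ 2 := one_le_pow₀ hκ1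
    calc Cb * mesh m ^ r ≤ Cb * mesh m ^ r * (3 * p y / 2 * κ) ^ 2 :=
          le_mul_of_one_le_right (by positivity) this
      _ = _ := by ring
  calc _ ≤ |that φ M₁ M₂ s y u m x - ∑ k, popCoef φ p Ψ M₁ M₂ s y m k * phi φ m k y| +
        |∑ k, popCoef φ p Ψ M₁ M₂ s y m k * phi φ m k y - Ψ y / p y| := _root_.abs_sub_le _ _ _
    _ ≤ κ ^ 2 * ((lam - 1 / 2) * ρ) + κ ^ 2 * (Cb * (3 * p y / 2) ^ 2 * mesh m ^ r) :=
        add_le_add (h6.trans h8) (hm.bias_le.trans h9)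
    _ = _ := by ring

end LocalModel

/-! ### Lepski's choice of the level -/

section Lepski

variable {φ : ℝ → ℝ} {M₁ M₂ : ℝ} {s : ℕ} {y : ℝ} {u : ℕ → ℤ → ℝ → ℝ} {m₁ m₂ n : ℕ}
  {x : Fin n → ℝ} {lam : ℝ}

lemma rhoSq_nonneg (M₁ M₂ : ℝ) (s : ℕ) (y : ℝ) (u : ℕ → ℤ → ℝ → ℝ) (m n : ℕ) :
    0 ≤ rhoSq M₁ M₂ s y u m n := by
  have := Real.log_natCast_nonneg n
  unfold rhoSq
  positivity

lemma mhat_spec (hle : m₁ ≤ m₂) :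
    mhat φ M₁ M₂ s y u lam m₁ m₂ x ∈ Set.Icc m₁ m₂ ∧
      ∀ j ∈ Set.Icc m₁ m₂, mhat φ M₁ M₂ s y u lam m₁ m₂ x ≤ j →
        |that φ M₁ M₂ s y u (mhat φ M₁ M₂ s y u lam m₁ m₂ x) x - that φ M₁ M₂ s y u j x| ^ 2 ≤
          lam ^ 2 * (invNorm φ M₁ M₂ s y (mhat φ M₁ M₂ s y u lam m₁ m₂ x) x ^ 2 +
            invNorm φ M₁ M₂ s y j x ^ 2) ^ 2 * rhoSq M₁ M₂ s y u j n := by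
  refine Nat.sInf_mem (s := {m : ℕ | m ∈ Set.Icc m₁ m₂ ∧ ∀ j ∈ Set.Icc m₁ m₂, m ≤ j →
    |that φ M₁ M₂ s y u m x - that φ M₁ M₂ s y u j x| ^ 2 ≤
      lam ^ 2 * (invNorm φ M₁ M₂ s y m x ^ 2 + invNorm φ M₁ M₂ s y j x ^ 2) ^ 2
        * rhoSq M₁ M₂ s y u j n}) ⟨m₂, ⟨hle, le_rfl⟩, fun j hj hmj => ?_⟩
  have : j = m₂ := le_antisymm hj.2 hmj
  subst this
  simp only [sub_self, abs_zero, zero_pow two_ne_zero]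
  have := rhoSq_nonneg M₁ M₂ s y u j n
  positivity

lemma mhat_le {m : ℕ} (hm : m ∈ Set.Icc m₁ m₂)
    (h : ∀ j ∈ Set.Icc m₁ m₂, m ≤ j →
      |that φ M₁ M₂ s y u m x - that φ M₁ M₂ s y u j x| ^ 2 ≤
        lam ^ 2 * (invNorm φ M₁ M₂ s y m x ^ 2 + invNorm φ M₁ M₂ s y j x ^ 2) ^ 2
          * rhoSq M₁ M₂ s y u j n) :
    mhat φ M₁ M₂ s y u lam m₁ m₂ x ≤ m :=
  Nat.sInf_le ⟨hm, h⟩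

/-- The comparison of Lepski's level with a later one, when the inverse matrices are bounded. -/
lemma abs_that_mhat_sub_le (hlam : 0 ≤ lam) (hle : m₁ ≤ m₂) {κ : ℝ}
    (hκ : ∀ m ∈ Set.Icc m₁ m₂, invNorm φ M₁ M₂ s y m x ≤ κ) {j : ℕ} (hj : j ∈ Set.Icc m₁ m₂)
    (hmj : mhat φ M₁ M₂ s y u lam m₁ m₂ x ≤ j) :
    |that φ M₁ M₂ s y u (mhat φ M₁ M₂ s y u lam m₁ m₂ x) x - that φ M₁ M₂ s y u j x| ≤
      2 * lam * κ ^ 2 * √(rhoSq M₁ M₂ s y u j n) := by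
  obtain ⟨hmem, hspec⟩ := mhat_spec (φ := φ) (M₁ := M₁) (M₂ := M₂) (s := s) (y := y) (u := u)
    (lam := lam) (x := x) hle
  have h1 := hspec j hj hmj
  have hρ := rhoSq_nonneg M₁ M₂ s y u j n
  have e : ∀ m ∈ Set.Icc m₁ m₂, invNorm φ M₁ M₂ s y m x ^ 2 ≤ κ ^ 2 := fun m hm =>
    pow_le_pow_left₀ invNorm_nonneg (hκ m hm) 2
  have h2 := add_le_add (e _ hmem) (e j hj)
  refine (sq_le_sq₀ (abs_nonneg _) (by positivity)).1 ?_
  refine h1.trans ?_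
  calc _ ≤ lam ^ 2 * (κ ^ 2 + κ ^ 2) ^ 2 * rhoSq M₁ M₂ s y u j n := by gcongr
    _ = _ := by rw [mul_pow _ (√_), Real.sq_sqrt hρ]; ring

lemma mesh_rpow_le_of_lt {r : ℝ} (hr : 0 < r) {m j : ℕ} (hmj : m < j) :
    mesh j ^ r ≤ (1 / 2 : ℝ) ^ r * mesh m ^ r := by
  rw [← Real.mul_rpow (by norm_num) (mesh_pos m).le]
  refine Real.rpow_le_rpow (mesh_pos j).le ?_ hr.le
  rw [mesh, mesh, one_div, ← mul_inv, ← pow_succ']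
  exact inv_anti₀ (by positivity) (pow_le_pow_right₀ one_le_two hmj)

/-- ρ is not assumed monotone, since the γ_m are arbitrary. A minimiser of ρ + c 2^{-rm} is taken
instead: minimality forces ρ at every later level to exceed ρ at the oracle by a fixed fraction of
the bias term there. -/
lemma exists_oracle (ρ : ℕ → ℝ) {c r : ℝ} (hc : 0 ≤ c) (hr : 0 < r) {a b : ℕ} (hab : a ≤ b) :
    ∃ m ∈ Set.Icc a b, ρ m + c * mesh m ^ r ≤ ρ a + c * mesh a ^ r ∧
      ∀ j, m < j → j ≤ b → ρ m + c * (1 - (1 / 2 : ℝ) ^ r) * mesh m ^ r ≤ ρ j := by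
  obtain ⟨m, hm, hmin⟩ := Finset.exists_min_image (Finset.Icc a b)
    (fun m => ρ m + c * mesh m ^ r) ⟨a, Finset.mem_Icc.2 ⟨le_rfl, hab⟩⟩
  rw [Finset.mem_Icc] at hm
  refine ⟨m, hm, hmin a (Finset.mem_Icc.2 ⟨le_rfl, hab⟩), fun j hmj hjb => ?_⟩
  have h1 := hmin j (Finset.mem_Icc.2 ⟨hm.1.trans hmj.le, hjb⟩)
  have h2 := mul_le_mul_of_nonneg_left (mesh_rpow_le_of_lt hr hmj) hc
  linarith

/-- The oracle inequality for Lepski's choice. -/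
lemma abs_that_mhat_sub_le_oracle {T κ B r : ℝ} {m₀ : ℕ} (hlam : 1 / 2 ≤ lam) (hB : 0 ≤ B) (hr : 0 < r)
    (h10 : m₁ ≤ m₀) (h02 : m₀ ≤ m₂)
    (hκ : ∀ m ∈ Set.Icc m₁ m₂, invNorm φ M₁ M₂ s y m x ≤ κ)
    (herr : ∀ m ∈ Set.Icc m₀ m₂, |that φ M₁ M₂ s y u m x - T| ≤ invNorm φ M₁ M₂ s y m x ^ 2 *
      ((lam - 1 / 2) * √(rhoSq M₁ M₂ s y u m n) + B * mesh m ^ r)) :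
    |that φ M₁ M₂ s y u (mhat φ M₁ M₂ s y u lam m₁ m₂ x) x - T| ≤
      (3 * lam + 1) * κ ^ 2 * (√(rhoSq M₁ M₂ s y u m₀ n) +
        2 * B / (1 - (1 / 2 : ℝ) ^ r) * mesh m₀ ^ r) := by
  have hlam0 : 0 ≤ lam := by linarith
  have hq0 : 0 < (1 / 2 : ℝ) ^ r := by positivity
  have hq : 0 < 1 - (1 / 2 : ℝ) ^ r :=
    sub_pos.2 (Real.rpow_lt_one (by norm_num) (by norm_num) hr)
  -- Chosen so that ρ at later levels exceeds ρ at the oracle by at least 2 B 2^{-rm}; the bias is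
  -- then at most half of any later ρ.
  set c := 2 * B / (1 - (1 / 2 : ℝ) ^ r) with hc
  have hc0 : 0 ≤ c := by positivity
  have hcq : c * (1 - (1 / 2 : ℝ) ^ r) = 2 * B := by rw [hc]; field_simp
  have hBc : B ≤ c := by nlinarith
  obtain ⟨m, hm, hV, hor⟩ := exists_oracle (fun m => √(rhoSq M₁ M₂ s y u m n)) hc0 hr h02
  rw [hcq] at hor
  have hm' : m ∈ Set.Icc m₁ m₂ := ⟨h10.trans hm.1, hm.2⟩
  have hmesh : ∀ j, 0 < mesh j ^ r := fun j => Real.rpow_pos_of_pos (mesh_pos j) r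
  have hsq : ∀ j, 0 ≤ √(rhoSq M₁ M₂ s y u j n) := fun j => Real.sqrt_nonneg _
  have hle : mhat φ M₁ M₂ s y u lam m₁ m₂ x ≤ m := by
    refine mhat_le hm' fun j hj hmj => ?_
    rcases hmj.eq_or_lt with rfl | hlt
    · simp only [sub_self, abs_zero, zero_pow two_ne_zero]
      have := rhoSq_nonneg M₁ M₂ s y u m n
      positivity
    · have h1 := hor j hlt hj.2
      have h2 : mesh j ^ r ≤ mesh m ^ r :=
        (mesh_rpow_le_of_lt hr hlt).trans (mul_le_of_le_one_left (hmesh m).le (by linarith))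
      -- The 1/2 withheld from λ pays for the bias, so the errors at m and at j both fit under λ ρ_j
      -- and the oracle level passes Lepski's test.
      have e1 : (lam - 1 / 2) * √(rhoSq M₁ M₂ s y u m n) + B * mesh m ^ r ≤
          lam * √(rhoSq M₁ M₂ s y u j n) := by
        have a1 := mul_nonneg hB (hmesh m).le
        have a2 := mul_le_mul_of_nonneg_left (show √(rhoSq M₁ M₂ s y u m n) ≤
          √(rhoSq M₁ M₂ s y u j n) by linarith) (sub_nonneg.2 hlam)
        have := hsq m
        linarith
      have e2 : (lam - 1 / 2) * √(rhoSq M₁ M₂ s y u j n) + B * mesh j ^ r ≤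
          lam * √(rhoSq M₁ M₂ s y u j n) := by
        have := mul_le_mul_of_nonneg_left h2 hB
        have := hsq m
        linarith
      have h3 : |that φ M₁ M₂ s y u m x - that φ M₁ M₂ s y u j x| ≤
          lam * (invNorm φ M₁ M₂ s y m x ^ 2 + invNorm φ M₁ M₂ s y j x ^ 2) *
            √(rhoSq M₁ M₂ s y u j n) := by
        have a1 := abs_sub_le (that φ M₁ M₂ s y u m x) T (that φ M₁ M₂ s y u j x)
        have a2 := (herr m hm).trans (mul_le_mul_of_nonneg_left e1 (sq_nonneg _))
        have a3 := (herr j ⟨hm.1.trans hmj, hj.2⟩).trans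
          (mul_le_mul_of_nonneg_left e2 (sq_nonneg _))
        rw [abs_sub_comm T] at a1
        linarith
      refine (pow_le_pow_left₀ (abs_nonneg _) h3 2).trans (le_of_eq ?_)
      rw [mul_pow, mul_pow, Real.sq_sqrt (rhoSq_nonneg _ _ _ _ _ _ _)]
  have b1 := abs_that_mhat_sub_le hlam0 (h10.trans h02) hκ hm' hle
  have b2 := herr m hm
  have b3 : invNorm φ M₁ M₂ s y m x ^ 2 ≤ κ ^ 2 := pow_le_pow_left₀ invNorm_nonneg (hκ m hm') 2
  have b4 : (lam - 1 / 2) * √(rhoSq M₁ M₂ s y u m n) + B * mesh m ^ r ≤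
      lam * √(rhoSq M₁ M₂ s y u m n) + c * mesh m ^ r := by
    have := mul_le_mul_of_nonneg_right hBc (hmesh m).le
    have := hsq m
    linarith
  have b5 : |that φ M₁ M₂ s y u m x - T| ≤
      κ ^ 2 * (lam * √(rhoSq M₁ M₂ s y u m n) + c * mesh m ^ r) := by
    refine b2.trans ((mul_le_mul_of_nonneg_left b4 (sq_nonneg _)).trans ?_)
    refine mul_le_mul_of_nonneg_right b3 ?_
    have := hsq m
    have := hmesh m
    positivity
  have hm0 := hsq m
  have hm1 := mul_nonneg hc0 (hmesh m).le
  have hκ2 := sq_nonneg κ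
  calc _ ≤ _ := abs_sub_le _ (that φ M₁ M₂ s y u m x) _
    _ ≤ 2 * lam * κ ^ 2 * √(rhoSq M₁ M₂ s y u m n) +
        κ ^ 2 * (lam * √(rhoSq M₁ M₂ s y u m n) + c * mesh m ^ r) := add_le_add b1 b5
    _ ≤ (3 * lam + 1) * κ ^ 2 * (√(rhoSq M₁ M₂ s y u m n) + c * mesh m ^ r) := by
        have q1 := mul_nonneg hκ2 hm0
        have q2 := mul_nonneg (mul_nonneg hlam0 hκ2) hm1
        linarith
    _ ≤ _ := mul_le_mul_of_nonneg_left hV (by positivity)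

end Lepski

/-! ### Deviations of the sample means -/

section Probability

variable {Ω : Type*} [MeasurableSpace Ω] {P : Measure Ω}

lemma measureReal_not_forall_le {ι : Type*} [Fintype ι] {A : ι → Ω → Prop} {b : ℝ}
    (h : ∀ i, P.real {ω | ¬ A i ω} ≤ b) :
    P.real {ω | ¬ ∀ i, A i ω} ≤ Fintype.card ι * b := by
  have hset : {ω | ¬ ∀ i, A i ω} = ⋃ i, {ω | ¬ A i ω} := by
    ext ω
    simp
  rw [hset]
  calc _ ≤ ∑ i, P.real {ω | ¬ A i ω} := measureReal_iUnion_fintype_le _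
    _ ≤ ∑ _i : ι, b := Finset.sum_le_sum fun i _ => h i
    _ = _ := by simp

/-- The sample: independent observations with density `p`. -/
structure IsSample (P : Measure Ω) (p : ℝ → ℝ) (X : ℕ → Ω → ℝ) : Prop where
  meas : ∀ i, Measurable (X i)
  indep : iIndepFun X P
  law : ∀ i, P.map (X i) = volume.withDensity fun x => ENNReal.ofReal (p x)

variable {p : ℝ → ℝ} {X : ℕ → Ω → ℝ}

lemma IsSample.ae_comp (hX : IsSample P p X) {Q : ℝ → Prop} (h : ∀ᵐ x, Q x) (i : ℕ) :
    ∀ᵐ ω ∂P, Q (X i ω) := by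
  have h1 : ∀ᵐ x ∂(P.map (X i)), Q x := by
    rw [hX.law i]
    exact (withDensity_absolutelyContinuous _ _).ae_le h
  exact ae_of_ae_map (hX.meas i).aemeasurable h1

lemma IsSample.integral_comp (hX : IsSample P p X) (hp : Measurable p) (hp0 : ∀ x, 0 ≤ p x)
    {f : ℝ → ℝ} (hf : Measurable f) (i : ℕ) : ∫ ω, f (X i ω) ∂P = ∫ x, f x * p x := by
  rw [← integral_map (hX.meas i).aemeasurable hf.aestronglyMeasurable, hX.law i,
    integral_withDensity_eq_integral_toReal_smul hp.ennreal_ofReal (by simp)]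
  refine integral_congr_ae (Eventually.of_forall fun x => ?_)
  simp [ENNReal.toReal_ofReal (hp0 x), mul_comm]

lemma IsSample.measure_dev_le [IsProbabilityMeasure P] (hX : IsSample P p X)
    (hp : Measurable p) (hp0 : ∀ x, 0 ≤ p x)
    {f : ℝ → ℝ} (hf : Measurable f) {b V t : ℝ} (hb : ∀ᵐ x, |f x| ≤ b)
    (hV : ∫ x, f x ^ 2 * p x ≤ V) (hV0 : 0 < V) (ht : 0 ≤ t) (htb : t * b ≤ V) {n : ℕ}
    (hn : 0 < n) :
    P.real {ω | ¬ |(n : ℝ)⁻¹ * ∑ l : Fin n, f (X l ω) - ∫ x, f x * p x| ≤ t} ≤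
      2 * Real.exp (-(n * t ^ 2 / (4 * V))) := by
  refine le_trans (measureReal_mono ?_) (measure_abs_mean_sub_ge_le (Y := fun i ω => f (X i ω))
    (fun i => hf.comp (hX.meas i)) (hX.indep.comp (fun _ => f) fun _ => hf)
    (fun i => hX.ae_comp hb i) (fun i => hX.integral_comp hp hp0 hf i)
    (fun i => ?_) hV0 ht htb hn)
  · intro ω hω
    simp only [Set.mem_ofPred_eq, not_le] at hω ⊢
    exact hω.le
  · rw [hX.integral_comp hp hp0 (hf.pow_const 2) i]
    exact hV

lemma integral_sq_mul_le {f g : ℝ → ℝ} (hp0 : ∀ x, 0 ≤ p x) (hpm : MemLp p ⊤ volume) {c : ℝ}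
    (hg : Integrable fun x => g x ^ 2) (h : ∀ x, f x ^ 2 ≤ c * g x ^ 2) :
    ∫ x, f x ^ 2 * p x ≤ c * (∫ x, g x ^ 2) * supNorm p := by
  rw [← integral_const_mul, ← integral_mul_const]
  refine integral_mono_of_nonneg (Eventually.of_forall fun x => mul_nonneg (sq_nonneg _) (hp0 x))
    ((hg.const_mul c).mul_const _) ?_
  filter_upwards [ae_abs_le_supNorm hpm] with x hx
  exact mul_le_mul (h x) ((le_abs_self _).trans hx) (hp0 x) ((sq_nonneg _).trans (h x))

/-- The functions `u_{m,k}` from level `L` on. -/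
structure Companion (p Ψ φ : ℝ → ℝ) (M₁ M₂ : ℝ) (s : ℕ) (y : ℝ) (u : ℕ → ℤ → ℝ → ℝ) (L : ℕ)
    (α Cγ Cu : ℝ) : Prop where
  meas : ∀ m, L ≤ m → ∀ k ∈ idx M₁ M₂ s y m, Measurable (u m k)
  sq_int : ∀ m, L ≤ m → ∀ k ∈ idx M₁ M₂ s y m, Integrable fun x => u m k x ^ 2
  mean : ∀ m, L ≤ m → ∀ k ∈ idx M₁ M₂ s y m, ∫ x, u m k x * p x = popC φ Ψ m k
  gam_le : ∀ m, L ≤ m → gam M₁ M₂ s y u m ^ 2 ≤ Cγ * (2 : ℝ) ^ (α * (m : ℝ))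
  bdd : ∀ m, L ≤ m → ∀ k ∈ idx M₁ M₂ s y m,
    ∀ᵐ x, |u m k x| ≤ Cu * √((2 : ℝ) ^ m) * gam M₁ M₂ s y u m
  Cu_nonneg : 0 ≤ Cu

lemma integral_sq_le_gam_sq {M₁ M₂ : ℝ} {s : ℕ} {y : ℝ} {u : ℕ → ℤ → ℝ → ℝ} {m : ℕ} {k : ℤ}
    (hk : k ∈ idx M₁ M₂ s y m) : ∫ x, u m k x ^ 2 ≤ gam M₁ M₂ s y u m ^ 2 := by
  rw [gam, Real.sq_sqrt (Finset.sum_nonneg fun _ _ => sq_nonneg _)]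
  have h1 : gammaComp u m k ^ 2 = ∫ x, u m k x ^ 2 :=
    Real.sq_sqrt (integral_nonneg fun _ => sq_nonneg _)
  rw [← h1]
  exact Finset.single_le_sum (f := fun k => gammaComp u m k ^ 2) (fun _ _ => sq_nonneg _) hk

/-! ### Deviation probabilities for the empirical system -/

namespace LocalModel

variable {Ψ φ : ℝ → ℝ} {M₁ M₂ : ℝ} {s : ℕ} {y r : ℝ} {u : ℕ → ℤ → ℝ → ℝ} {L : ℕ} {α Cγ Cu : ℝ}
  {m n : ℕ}

lemma supNorm_p_pos (h : LocalModel p Ψ φ M₁ M₂ s y r) : 0 < supNorm p :=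
  h.p_pos.trans_le h.p_le_supNorm

/-- The variance constant for the entries of the empirical matrix. -/
def varConst (p φ : ℝ → ℝ) (M₁ M₂ : ℝ) (s : ℕ) (y : ℝ) : ℝ :=
  supNorm φ ^ 2 * supNorm p + tol p M₁ M₂ s y * supNorm φ ^ 2 + 1

lemma varConst_pos (h : LocalModel p Ψ φ M₁ M₂ s y r) : 0 < varConst p φ M₁ M₂ s y := by
  have := h.supNorm_p_pos
  have := h.tol_pos
  unfold varConst
  positivity

/-- The second moment of φ_{m,k} φ_{m,j} is of order 2^m, so a fixed tolerance is exceeded with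
probability exponentially small in n/2^m. The summand `tol` ‖φ‖² of `varConst` makes the range
condition of the exponential inequality hold. -/
lemma measure_Bhat_dev_le [IsProbabilityMeasure P] (h : LocalModel p Ψ φ M₁ M₂ s y r)
    (hX : IsSample P p X) (hn : 0 < n) :
    P.real {ω | ¬ ∀ j k, |Bhat φ M₁ M₂ s y m (fun i : Fin n => X i ω) j k - popB φ p m j k| ≤
      tol p M₁ M₂ s y} ≤ sysSize M₁ M₂ s y * (sysSize M₁ M₂ s y *
        (2 * Real.exp (-(tol p M₁ M₂ s y ^ 2 / (4 * varConst p φ M₁ M₂ s y) * (n / 2 ^ m))))) := by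
  have hV := h.varConst_pos
  have ht := h.tol_pos
  have hP := h.supNorm_p_pos
  have hF := supNorm_nonneg φ
  have hss : √((2 : ℝ) ^ m) * √((2 : ℝ) ^ m) = 2 ^ m := Real.mul_self_sqrt (by positivity)
  have key : ∀ j k : idx M₁ M₂ s y m,
      P.real {ω | ¬ |Bhat φ M₁ M₂ s y m (fun i : Fin n => X i ω) j k - popB φ p m j k| ≤
        tol p M₁ M₂ s y} ≤
      2 * Real.exp (-(tol p M₁ M₂ s y ^ 2 / (4 * varConst p φ M₁ M₂ s y) * (n / 2 ^ m))) := by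
    intro j k
    have := hX.measure_dev_le h.p_meas h.p_nonneg (f := fun x => phi φ m k x * phi φ m j x)
      ((h.scaling.continuous_phi m k).mul (h.scaling.continuous_phi m j)).measurable
      (b := 2 ^ m * supNorm φ ^ 2) (V := varConst p φ M₁ M₂ s y * 2 ^ m) (t := tol p M₁ M₂ s y)
      (Eventually.of_forall fun x => ?_) ?_ (by positivity) ht.le ?_ hn
    · refine this.trans (le_of_eq ?_)
      congr 3
      field_simp
    · rw [abs_mul, ← hss]
      calc _ ≤ (√((2 : ℝ) ^ m) * supNorm φ) * (√((2 : ℝ) ^ m) * supNorm φ) :=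
            mul_le_mul (h.scaling.abs_phi_le _ _ _) (h.scaling.abs_phi_le _ _ _) (abs_nonneg _)
              (by positivity)
        _ = _ := by ring
    · refine (integral_sq_mul_le h.p_nonneg h.p_mem (g := phi φ m k)
        (c := 2 ^ m * supNorm φ ^ 2) ?_ fun x => ?_).trans ?_
      · simpa [sq] using h.scaling.integrable_phi_mul_phi m k k
      · rw [mul_pow, mul_comm]
        refine mul_le_mul_of_nonneg_right ?_ (sq_nonneg _)
        have := pow_le_pow_left₀ (abs_nonneg _) (h.scaling.abs_phi_le m j x) 2
        rwa [sq_abs, mul_pow, sq (√_), hss] at this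
      · rw [h.scaling.integral_phi_sq, varConst]
        have : 0 ≤ (tol p M₁ M₂ s y * supNorm φ ^ 2 + 1) * 2 ^ m := by positivity
        linarith
    · rw [varConst]
      have : 0 ≤ (supNorm φ ^ 2 * supNorm p + 1) * 2 ^ m := by positivity
      linarith
  refine (measureReal_not_forall_le fun j => measureReal_not_forall_le fun k => key j k).trans ?_
  have := h.card_le m
  gcongr

/-- The variance proxy V is left free: it is ‖p‖ (1 + γ²) for deviations of the natural size, and is
enlarged by Cu (1 + γ²) for the tolerance 2^{-m/2} in the coarse event, to satisfy the range
condition. -/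
lemma measure_chat_dev_le [IsProbabilityMeasure P] (h : LocalModel p Ψ φ M₁ M₂ s y r)
    (hX : IsSample P p X)
    (hu : Companion p Ψ φ M₁ M₂ s y u L α Cγ Cu) (hm : L ≤ m) (hn : 0 < n) {V t : ℝ}
    (hV : supNorm p * (1 + gam M₁ M₂ s y u m ^ 2) ≤ V) (ht : 0 ≤ t)
    (htb : t * (Cu * √((2 : ℝ) ^ m) * √(1 + gam M₁ M₂ s y u m ^ 2)) ≤ V) :
    P.real {ω | ¬ ∀ k, |chat M₁ M₂ s y u m (fun i : Fin n => X i ω) k - popC φ Ψ m k| ≤ t} ≤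
      sysSize M₁ M₂ s y * (2 * Real.exp (-(n * t ^ 2 / (4 * V)))) := by
  have hP := h.supNorm_p_pos
  have hV0 : 0 < V := lt_of_lt_of_le (by positivity) hV
  have hCu := hu.Cu_nonneg
  refine (measureReal_not_forall_le (b := 2 * Real.exp (-(n * t ^ 2 / (4 * V)))) fun k => ?_).trans ?_
  · have := hX.measure_dev_le h.p_meas h.p_nonneg (hu.meas m hm k k.2)
      (b := Cu * √((2 : ℝ) ^ m) * √(1 + gam M₁ M₂ s y u m ^ 2)) (V := V) (t := t) ?_ ?_ hV0 ht
      htb hn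
    · rwa [hu.mean m hm k k.2] at this
    · filter_upwards [hu.bdd m hm k k.2] with x hx
      refine hx.trans (mul_le_mul_of_nonneg_left ?_ (by positivity))
      exact Real.le_sqrt_of_sq_le (by linarith)
    · have h1 := integral_sq_mul_le h.p_nonneg h.p_mem (f := u m k) (g := u m k) (c := 1)
        (hu.sq_int m hm k k.2) (fun x => by rw [one_mul])
      have h2 := integral_sq_le_gam_sq (u := u) k.2
      refine h1.trans (le_trans ?_ hV)
      rw [one_mul, mul_comm]
      exact mul_le_mul_of_nonneg_left (by linarith) hP.le
  · exact mul_le_mul_of_nonneg_right (h.card_le m) (by positivity)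

/-- Each component is the sample mean of φ_{m,j} w, where w is the function of the population
solution; its expectation is c_j because that solution solves the system. As |w| ≤ H, the second
moment is at most ‖p‖ H² with no factor 2^m, unlike for individual matrix entries. -/
lemma measure_Bhat_mulVec_dev_le [IsProbabilityMeasure P] (h : LocalModel p Ψ φ M₁ M₂ s y r)
    (hX : IsSample P p X)
    {Cb H : ℝ} (hm : FineLevel p Ψ φ M₁ M₂ s y r Cb m) (hH0 : 0 < H)
    (hH : supNorm φ * √(sysSize M₁ M₂ s y) * coefConst p Ψ M₁ M₂ s y ≤ H) (hn : 0 < n) {t : ℝ}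
    (ht : 0 ≤ t) (htb : t * (√((2 : ℝ) ^ m) * supNorm φ * H) ≤ supNorm p * H ^ 2) :
    P.real {ω | ¬ ∀ j, |(Bhat φ M₁ M₂ s y m (fun i : Fin n => X i ω)).mulVec
        (popCoef φ p Ψ M₁ M₂ s y m) j - popC φ Ψ m j| ≤ t} ≤
      sysSize M₁ M₂ s y * (2 * Real.exp (-(n * t ^ 2 / (4 * (supNorm p * H ^ 2))))) := by
  have hP := h.supNorm_p_pos
  have hF := supNorm_nonneg φ
  set w : ℝ → ℝ := fun z => ∑ k, popCoef φ p Ψ M₁ M₂ s y m k * phi φ m k z with hw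
  have hwc : Continuous w :=
    continuous_finsetSum _ fun k _ => continuous_const.mul (h.scaling.continuous_phi m k)
  have hwb : ∀ z, |w z| ≤ H := hm.abs_sum_le h hH
  refine (measureReal_not_forall_le
    (b := 2 * Real.exp (-(n * t ^ 2 / (4 * (supNorm p * H ^ 2))))) fun j => ?_).trans ?_
  · have := hX.measure_dev_le h.p_meas h.p_nonneg (f := fun x => phi φ m j x * w x)
      ((h.scaling.continuous_phi m j).mul hwc).measurable
      (b := √((2 : ℝ) ^ m) * supNorm φ * H) (V := supNorm p * H ^ 2) (t := t)
      (Eventually.of_forall fun x => ?_) ?_ (by positivity) ht htb hn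
    · have hmean : ∫ x, phi φ m j x * w x * p x = popC φ Ψ m j := by
        have h1 := congrFun hm.solves j
        have h2 : popVec φ Ψ M₁ M₂ s y m j = popC φ Ψ m j := rfl
        rw [h2] at h1
        rw [← h1]
        simp only [Matrix.mulVec, dotProduct, popMat, Matrix.of_apply, popB]
        simp_rw [← integral_mul_const]
        rw [← integral_finsetSum Finset.univ (f := fun (k : idx M₁ M₂ s y m) x =>
          phi φ m k x * phi φ m j x * p x * popCoef φ p Ψ M₁ M₂ s y m k)
          fun k _ => (h.integrable_phi_phi_p m j k).mul_const _]
        refine integral_congr_ae (Eventually.of_forall fun x => ?_)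
        simp only [hw, Finset.mul_sum, Finset.sum_mul]
        exact Finset.sum_congr rfl fun _ _ => by ring
      simp only [hmean] at this
      simp only [Bhat_mulVec]
      exact this
    · rw [abs_mul]
      exact mul_le_mul (h.scaling.abs_phi_le m j x) (hwb x) (abs_nonneg _) (by positivity)
    · refine (integral_sq_mul_le h.p_nonneg h.p_mem (g := phi φ m j) (c := H ^ 2) ?_
        fun x => ?_).trans (le_of_eq ?_)
      · simpa [sq] using h.scaling.integrable_phi_mul_phi m j j
      · rw [mul_pow, mul_comm]
        refine mul_le_mul_of_nonneg_right ?_ (sq_nonneg _)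
        rw [← sq_abs]
        exact pow_le_pow_left₀ (abs_nonneg _) (hwb x) 2
      · rw [h.scaling.integral_phi_sq]
        ring
  · exact mul_le_mul_of_nonneg_right (h.card_le m) (by positivity)

end LocalModel

end Probability

/-! ### Measurability of the estimator -/

section Measurability

variable {Ω : Type*} [MeasurableSpace Ω]

lemma measurable_of_continuous_entries {ι : Type*} [Fintype ι] {A : Ω → Matrix ι ι ℝ}
    (hA : ∀ i j, Measurable fun ω => A ω i j) {F : Matrix ι ι ℝ → ℝ} (hF : Continuous F) :
    Measurable fun ω => F (A ω) := by
  have h1 : Measurable fun ω => (fun i j => A ω i j : ι → ι → ℝ) :=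
    measurable_pi_iff.2 fun i => measurable_pi_iff.2 fun j => hA i j
  have h2 : Continuous fun B : ι → ι → ℝ => F (Matrix.of B) := hF.comp continuous_id
  exact h2.measurable.comp h1

/-- Cramer's formula: the entries are built from the determinant and the adjugate, which are
continuous. Real inversion is measurable at 0 as well, so singular matrices need no separate
treatment. -/
lemma measurable_matrix_inv {ι : Type*} [Fintype ι] [DecidableEq ι] {A : Ω → Matrix ι ι ℝ}
    (hA : ∀ i j, Measurable fun ω => A ω i j) (i j : ι) : Measurable fun ω => (A ω)⁻¹ i j := by
  simp only [Matrix.inv_def, Ring.inverse_eq_inv', Matrix.smul_apply, smul_eq_mul]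
  refine Measurable.mul (Measurable.inv ?_) ?_
  · exact measurable_of_continuous_entries hA (F := fun B => B.det)
      (Continuous.matrix_det continuous_id)
  · exact measurable_of_continuous_entries hA (F := fun B => B.adjugate i j)
      ((Continuous.matrix_adjugate continuous_id).matrix_elem i j)

lemma measurable_specNorm {ι : Type*} [Fintype ι] [DecidableEq ι] {A : Ω → Matrix ι ι ℝ}
    (hA : ∀ i j, Measurable fun ω => A ω i j) : Measurable fun ω => specNorm (A ω) := by
  refine measurable_of_continuous_entries hA (F := specNorm) ?_
  let T : Matrix ι ι ℝ →ₗ[ℝ] (EuclideanSpace ℝ ι →L[ℝ] EuclideanSpace ℝ ι) :=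
    { toFun := fun B => Matrix.toEuclideanCLM (n := ι) (𝕜 := ℝ) B
      map_add' := map_add _
      map_smul' := map_smul _ }
  exact T.continuous_of_finiteDimensional.norm

variable {φ : ℝ → ℝ} {M₁ M₂ : ℝ} {s : ℕ} {y : ℝ} {u : ℕ → ℤ → ℝ → ℝ} {m n : ℕ}
  {X : ℕ → Ω → ℝ}

lemma IsScaling.measurable_Bdelta (hφ : IsScaling φ M₁ M₂ s) (hX : ∀ i, Measurable (X i))
    (i j : idx M₁ M₂ s y m) :
    Measurable fun ω => Bdelta φ M₁ M₂ s y m (fun l : Fin n => X l ω) i j := by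
  have h : ∀ k, Measurable (phi φ m k) := fun k => (hφ.continuous_phi m k).measurable
  simp only [Bdelta, Matrix.add_apply, Bhat, Matrix.of_apply]
  refine Measurable.add_const (Measurable.const_mul (Finset.measurable_sum _ fun l _ => ?_) _) _
  exact ((h _).comp (hX l)).mul ((h _).comp (hX l))

lemma IsScaling.measurable_invNorm (hφ : IsScaling φ M₁ M₂ s) (hX : ∀ i, Measurable (X i)) :
    Measurable fun ω => invNorm φ M₁ M₂ s y m (fun l : Fin n => X l ω) :=
  measurable_specNorm (measurable_matrix_inv (hφ.measurable_Bdelta hX))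

lemma IsScaling.measurable_that (hφ : IsScaling φ M₁ M₂ s) (hX : ∀ i, Measurable (X i))
    (hu : ∀ k ∈ idx M₁ M₂ s y m, Measurable (u m k)) :
    Measurable fun ω => that φ M₁ M₂ s y u m (fun l : Fin n => X l ω) := by
  simp only [that, Matrix.mulVec, dotProduct, chat]
  refine Finset.measurable_sum _ fun k _ => Measurable.mul_const ?_ _
  refine Finset.measurable_sum _ fun j _ => ?_
  refine (measurable_matrix_inv (hφ.measurable_Bdelta hX) k j).mul (Measurable.const_mul ?_ _)
  exact Finset.measurable_sum _ fun l _ => (hu j j.2).comp (hX l)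

/-- The selected level takes finitely many values, and it equals m exactly when m passes the test
and no smaller level does. The estimator is thus a finite sum of fixed-level estimators on
measurable pieces. -/
lemma IsScaling.measurable_that_mhat (hφ : IsScaling φ M₁ M₂ s) (hX : ∀ i, Measurable (X i))
    {lam : ℝ} {m₁ m₂ : ℕ} (hle : m₁ ≤ m₂)
    (hu : ∀ m, m₁ ≤ m → ∀ k ∈ idx M₁ M₂ s y m, Measurable (u m k)) :
    Measurable fun ω => that φ M₁ M₂ s y u
      (mhat φ M₁ M₂ s y u lam m₁ m₂ (fun l : Fin n => X l ω)) (fun l : Fin n => X l ω) := by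
  set x : Ω → Fin n → ℝ := fun ω l => X l ω with hx
  set Q : ℕ → Ω → Prop := fun m ω => m ∈ Set.Icc m₁ m₂ ∧ ∀ j ∈ Set.Icc m₁ m₂, m ≤ j →
    |that φ M₁ M₂ s y u m (x ω) - that φ M₁ M₂ s y u j (x ω)| ^ 2 ≤
      lam ^ 2 * (invNorm φ M₁ M₂ s y m (x ω) ^ 2 + invNorm φ M₁ M₂ s y j (x ω) ^ 2) ^ 2
        * rhoSq M₁ M₂ s y u j n with hQ
  have hthat : ∀ m, m₁ ≤ m → Measurable fun ω => that φ M₁ M₂ s y u m (x ω) := fun m hm =>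
    hφ.measurable_that hX (hu m hm)
  have hinv : ∀ m, Measurable fun ω => invNorm φ M₁ M₂ s y m (x ω) := fun m =>
    hφ.measurable_invNorm hX
  have hQm : ∀ m, MeasurableSet {ω | Q m ω} := by
    intro m
    by_cases hm : m ∈ Set.Icc m₁ m₂
    · have : {ω | Q m ω} = ⋂ j ∈ Set.Icc m₁ m₂, ⋂ _ : m ≤ j,
          {ω | |that φ M₁ M₂ s y u m (x ω) - that φ M₁ M₂ s y u j (x ω)| ^ 2 ≤
            lam ^ 2 * (invNorm φ M₁ M₂ s y m (x ω) ^ 2 + invNorm φ M₁ M₂ s y j (x ω) ^ 2) ^ 2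
              * rhoSq M₁ M₂ s y u j n} := by
        ext ω
        simp only [hQ, Set.mem_ofPred_eq, Set.mem_iInter]
        exact ⟨fun h => h.2, fun h => ⟨hm, h⟩⟩
      rw [this]
      refine MeasurableSet.iInter fun j => MeasurableSet.iInter fun hj => MeasurableSet.iInter
        fun _ => measurableSet_le ?_ ?_
      · have := (hthat m hm.1).sub (hthat j hj.1)
        exact (continuous_abs.measurable.comp this).pow_const 2
      · have h1 := hinv m
        have h2 := hinv j
        exact ((((h1.pow_const 2).add (h2.pow_const 2)).pow_const 2).const_mul _).mul_const _
    · have : {ω | Q m ω} = ∅ := by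
        ext ω
        simp only [hQ, Set.mem_ofPred_eq, Set.mem_empty_iff_false, iff_false]
        exact fun h => hm h.1
      rw [this]
      exact MeasurableSet.empty
  have hmhat : ∀ m, {ω | mhat φ M₁ M₂ s y u lam m₁ m₂ (x ω) = m} =
      {ω | Q m ω} ∩ ⋂ j, ⋂ _ : j < m, {ω | Q j ω}ᶜ := by
    intro m
    ext ω
    simp only [Set.mem_ofPred_eq, Set.mem_inter_iff, Set.mem_iInter, Set.mem_compl_iff]
    constructor
    · rintro rfl
      exact ⟨mhat_spec hle, fun j hj hQj => Nat.notMem_of_lt_sInf hj hQj⟩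
    · rintro ⟨h1, h2⟩
      refine le_antisymm (Nat.sInf_le h1) ?_
      by_contra hlt
      push Not at hlt
      exact h2 _ hlt (mhat_spec hle)
  have heq : (fun ω => that φ M₁ M₂ s y u (mhat φ M₁ M₂ s y u lam m₁ m₂ (x ω)) (x ω)) =
      fun ω => ∑ m ∈ Finset.Icc m₁ m₂,
        if mhat φ M₁ M₂ s y u lam m₁ m₂ (x ω) = m then that φ M₁ M₂ s y u m (x ω) else 0 := by
    ext ω
    have hmem := (mhat_spec (φ := φ) (M₁ := M₁) (M₂ := M₂) (s := s) (y := y) (u := u)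
      (lam := lam) (x := x ω) hle).1
    rw [Finset.sum_ite_eq, if_pos (Finset.mem_Icc.2 hmem)]
  rw [heq]
  refine Finset.measurable_sum _ fun m hm => Measurable.ite ?_ (hthat m (Finset.mem_Icc.1 hm).1)
    measurable_const
  rw [hmhat]
  exact (hQm m).inter (MeasurableSet.iInter fun j => MeasurableSet.iInter fun _ => (hQm j).compl)

/-- A bound for an expectation from three bounds that hold off smaller and smaller events. -/
lemma integral_le_of_bounds {P : Measure Ω} [IsProbabilityMeasure P] {Z : Ω → ℝ}
    (hZ : Measurable Z) (hZ0 : ∀ ω, 0 ≤ Z ω) {a b c : ℝ} (ha : 0 ≤ a) (hb : 0 ≤ b) (hc : 0 ≤ c)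
    {S T : Set Ω} (h1 : ∀ᵐ ω ∂P, Z ω ≤ c) (h2 : ∀ ω, ω ∉ S → Z ω ≤ b)
    (h3 : ∀ ω, ω ∉ S → ω ∉ T → Z ω ≤ a) :
    Integrable Z P ∧ ∫ ω, Z ω ∂P ≤ a + b * P.real T + c * P.real S := by
  refine ⟨Integrable.of_bound hZ.aestronglyMeasurable c ?_, ?_⟩
  · filter_upwards [h1] with ω hω
    rwa [Real.norm_eq_abs, abs_of_nonneg (hZ0 ω)]
  -- The events are not assumed measurable; measurable hulls have the same probability.
  set S' := toMeasurable P S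
  set T' := toMeasurable P T
  have hS' : MeasurableSet S' := measurableSet_toMeasurable P S
  have hT' : MeasurableSet T' := measurableSet_toMeasurable P T
  have iT : Integrable (T'.indicator fun _ => b) P := (integrable_const b).indicator hT'
  have iS : Integrable (S'.indicator fun _ => c) P := (integrable_const c).indicator hS'
  have iaT : Integrable (fun ω => a + T'.indicator (fun _ => b) ω) P := (integrable_const a).add iT
  have hle : ∫ ω, Z ω ∂P ≤
      ∫ ω, a + T'.indicator (fun _ => b) ω + S'.indicator (fun _ => c) ω ∂P := by
    refine integral_mono_of_nonneg (Eventually.of_forall hZ0) (iaT.add iS) ?_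
    filter_upwards [h1] with ω hω
    have n1 : 0 ≤ T'.indicator (fun _ => b) ω := Set.indicator_nonneg (fun _ _ => hb) ω
    have n2 : 0 ≤ S'.indicator (fun _ => c) ω := Set.indicator_nonneg (fun _ _ => hc) ω
    by_cases hS : ω ∈ S
    · rw [Set.indicator_of_mem (subset_toMeasurable P S hS)]
      linarith
    · by_cases hT : ω ∈ T
      · rw [Set.indicator_of_mem (subset_toMeasurable P T hT)]
        linarith [h2 ω hS]
      · linarith [h3 ω hS hT]
  refine hle.trans (le_of_eq ?_)
  rw [integral_add iaT iS, integral_add (integrable_const a) iT, integral_indicator_const _ hS',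
    integral_indicator_const _ hT']
  simp only [integral_const, smul_eq_mul, one_mul, Measure.real, S', T', measure_toMeasurable,
    measure_univ, ENNReal.toReal_one]
  ring

end Measurability

/-! ### The range of levels -/

section Levels

lemma tendsto_log_natCast : Tendsto (fun n : ℕ => Real.log n) atTop atTop :=
  Real.tendsto_log_atTop.comp tendsto_natCast_atTop_atTop

lemma eventually_log_le_rpow (K : ℝ) {a : ℝ} (k : ℕ) (ha : 0 < a) :
    ∀ᶠ n : ℕ in atTop, K * Real.log n ^ k < (n : ℝ) ^ a := by
  have h : (fun x : ℝ => Real.log x ^ (k : ℝ)) =o[atTop] fun x => x ^ a :=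
    isLittleO_log_rpow_rpow_atTop _ ha
  have h2 := (h.comp_tendsto tendsto_natCast_atTop_atTop).def
    (show 0 < (|K| + 1)⁻¹ by positivity)
  filter_upwards [h2, eventually_gt_atTop 0] with n hn hn0
  simp only [Function.comp_apply, Real.rpow_natCast, Real.norm_eq_abs] at hn
  have hn' : (0 : ℝ) < n := by exact_mod_cast hn0
  have hpos : 0 < (n : ℝ) ^ a := Real.rpow_pos_of_pos hn' a
  rw [abs_of_pos hpos, inv_mul_eq_div, le_div_iff₀ (by positivity)] at hn
  have h3 : K * Real.log n ^ k ≤ |K| * |Real.log n ^ k| := by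
    rw [← abs_mul]; exact le_abs_self _
  have h4 := abs_nonneg (Real.log n ^ k)
  rcases h4.eq_or_lt with h5 | h5
  · rw [← h5, mul_zero] at h3
    linarith
  · linarith

variable {g : ℕ → ℝ} {α Cγ : ℝ} {L : ℕ} {mlo mhi : ℕ → ℕ}

/-- Below level L nothing is known about g, so the finite sum of its values there goes into the
constant. The summand 1 is why α is replaced by max α 0. -/
lemma exists_one_add_le (hg : ∀ m, 0 ≤ g m)
    (hγ : ∀ m, L ≤ m → g m ≤ Cγ * (2 : ℝ) ^ (α * (m : ℝ))) :
    ∃ K, 0 < K ∧ ∀ m, 1 + g m ≤ K * ((2 : ℝ) ^ m) ^ max α 0 := by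
  refine ⟨1 + |Cγ| + ∑ m ∈ Finset.range L, g m, ?_, fun m => ?_⟩
  · have := Finset.sum_nonneg fun m (_ : m ∈ Finset.range L) => hg m
    positivity
  have hsum := Finset.sum_nonneg fun m (_ : m ∈ Finset.range L) => hg m
  have h1 : (1 : ℝ) ≤ 2 ^ m := one_le_pow₀ one_le_two
  have h2 : 1 ≤ ((2 : ℝ) ^ m) ^ max α 0 := Real.one_le_rpow h1 (le_max_right _ _)
  rcases lt_or_ge m L with hm | hm
  · have h3 : g m ≤ ∑ m ∈ Finset.range L, g m :=
      Finset.single_le_sum (fun i _ => hg i) (Finset.mem_range.2 hm)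
    have := abs_nonneg Cγ
    calc 1 + g m ≤ 1 + |Cγ| + ∑ m ∈ Finset.range L, g m := by linarith
      _ ≤ _ := le_mul_of_one_le_right (by positivity) h2
  · have h3 : (2 : ℝ) ^ (α * (m : ℝ)) ≤ ((2 : ℝ) ^ m) ^ max α 0 := by
      rw [mul_comm, Real.rpow_mul (by norm_num), Real.rpow_natCast]
      exact Real.rpow_le_rpow_of_exponent_le h1 (le_max_left _ _)
    have h4 : g m ≤ |Cγ| * ((2 : ℝ) ^ m) ^ max α 0 :=
      (hγ m hm).trans (mul_le_mul (le_abs_self _) h3 (by positivity) (abs_nonneg _))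
    have := mul_nonneg hsum (zero_le_one.trans h2)
    linarith

lemma eventually_le_mlo (h : (fun n : ℕ => (2 : ℝ) ^ mlo n) =Θ[atTop] fun n : ℕ => Real.log n)
    (m : ℕ) : ∀ᶠ n in atTop, m ≤ mlo n := by
  obtain ⟨c, hc⟩ := h.2.bound
  filter_upwards [hc, tendsto_log_natCast.eventually_gt_atTop (|c| * 2 ^ m)] with n h1 h2
  by_contra hlt
  push Not at hlt
  have h3 : (2 : ℝ) ^ mlo n ≤ 2 ^ m := pow_le_pow_right₀ one_le_two hlt.le
  rw [Real.norm_eq_abs, Real.norm_eq_abs, abs_of_pos (show (0 : ℝ) < 2 ^ mlo n by positivity)] at h1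
  have h4 : c * (2 : ℝ) ^ mlo n ≤ |c| * 2 ^ m :=
    mul_le_mul (le_abs_self c) h3 (by positivity) (abs_nonneg c)
  linarith [le_abs_self (Real.log n)]

/-- The level that balances the bias and the worst possible variance. -/
def balancedLevel (β : ℝ) (n : ℕ) : ℕ := Nat.log 2 ⌊(n : ℝ) ^ (1 / β)⌋₊

lemma two_pow_balancedLevel_le {β : ℝ} (hβ : 0 < β) {n : ℕ} (hn : 0 < n) :
    (2 : ℝ) ^ balancedLevel β n ≤ (n : ℝ) ^ (1 / β) := by
  have h1 : (1 : ℝ) ≤ (n : ℝ) ^ (1 / β) :=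
    Real.one_le_rpow (by exact_mod_cast hn) (by positivity)
  have h2 : ⌊(n : ℝ) ^ (1 / β)⌋₊ ≠ 0 := (Nat.floor_pos.2 h1).ne'
  have h3 : 2 ^ balancedLevel β n ≤ ⌊(n : ℝ) ^ (1 / β)⌋₊ := Nat.pow_log_le_self 2 h2
  calc (2 : ℝ) ^ balancedLevel β n ≤ (⌊(n : ℝ) ^ (1 / β)⌋₊ : ℝ) := by exact_mod_cast h3
    _ ≤ _ := Nat.floor_le (by linarith)

lemma lt_two_pow_balancedLevel (β : ℝ) (n : ℕ) :
    (n : ℝ) ^ (1 / β) < 2 * 2 ^ balancedLevel β n := by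
  have h1 : ⌊(n : ℝ) ^ (1 / β)⌋₊ < 2 ^ (balancedLevel β n + 1) :=
    Nat.lt_pow_succ_log_self (by norm_num) _
  have h2 := Nat.lt_of_floor_lt h1
  rw [pow_succ'] at h2
  exact_mod_cast h2

lemma eventually_mlo_le_balancedLevel
    (h : (fun n : ℕ => (2 : ℝ) ^ mlo n) =Θ[atTop] fun n : ℕ => Real.log n) {β : ℝ} (hβ : 0 < β) :
    ∀ᶠ n in atTop, mlo n ≤ balancedLevel β n := by
  obtain ⟨c, hc⟩ := h.1.bound
  filter_upwards [hc, eventually_log_le_rpow c 1 (show 0 < 1 / β by positivity),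
    eventually_gt_atTop 0] with n h1 h2 hn
  by_contra hlt
  push Not at hlt
  have h3 : (2 : ℝ) ^ (balancedLevel β n + 1) ≤ 2 ^ mlo n := pow_le_pow_right₀ one_le_two hlt
  have h4 := lt_two_pow_balancedLevel β n
  rw [Real.norm_eq_abs, Real.norm_eq_abs, abs_of_nonneg (Real.log_natCast_nonneg n),
    abs_of_pos (show (0 : ℝ) < 2 ^ mlo n by positivity)] at h1
  rw [pow_succ'] at h3
  rw [pow_one] at h2
  linarith

/-- Otherwise 2^m (1 + g m) at the last level would be O(n^{1 - 2r/β}) with β = 2r + 1 + max α 0,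
which is eventually smaller than any multiple of n/log² n. -/
lemma eventually_balancedLevel_le_mhi (hg : ∀ m, 0 ≤ g m) {K : ℝ}
    (hK : ∀ m, 1 + g m ≤ K * ((2 : ℝ) ^ m) ^ max α 0)
    (h : (fun n : ℕ => (2 : ℝ) ^ mhi n * (g (mhi n) + 1)) =Θ[atTop]
      fun n : ℕ => (n : ℝ) / Real.log n ^ 2) {r : ℝ} (hr : 0 < r) :
    ∀ᶠ n in atTop, balancedLevel (2 * r + 1 + max α 0) n ≤ mhi n := by
  set a := max α 0 with ha
  have ha0 : 0 ≤ a := le_max_right _ _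
  have hβ : 0 < 2 * r + 1 + a := by positivity
  obtain ⟨c, hc⟩ := h.2.bound
  filter_upwards [hc, eventually_log_le_rpow (|c| * |K|) 2
    (show 0 < 2 * r / (2 * r + 1 + a) by positivity), eventually_gt_atTop 1] with n h1 h2 hn
  by_contra hlt
  push Not at hlt
  have hn' : (0 : ℝ) < n := by exact_mod_cast (by omega : 0 < n)
  have hl : 0 < Real.log n := Real.log_pos (by exact_mod_cast hn)
  have hnn : 0 ≤ (2 : ℝ) ^ mhi n * (g (mhi n) + 1) :=
    mul_nonneg (by positivity) (by linarith [hg (mhi n)])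
  rw [Real.norm_eq_abs, Real.norm_eq_abs, abs_of_pos (show 0 < (n : ℝ) / Real.log n ^ 2 by positivity),
    abs_of_nonneg hnn] at h1
  have h3 : (2 : ℝ) ^ mhi n ≤ (n : ℝ) ^ (1 / (2 * r + 1 + a)) :=
    (pow_le_pow_right₀ one_le_two hlt.le).trans (two_pow_balancedLevel_le hβ (by omega))
  have hp0 : (0 : ℝ) < 2 ^ mhi n := by positivity
  have h4 : (2 : ℝ) ^ mhi n * (g (mhi n) + 1) ≤ |K| * (n : ℝ) ^ ((1 + a) / (2 * r + 1 + a)) := by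
    calc (2 : ℝ) ^ mhi n * (g (mhi n) + 1) ≤ 2 ^ mhi n * (|K| * ((2 : ℝ) ^ mhi n) ^ a) := by
          refine mul_le_mul_of_nonneg_left ?_ hp0.le
          rw [add_comm]
          exact (hK _).trans (mul_le_mul_of_nonneg_right (le_abs_self K) (by positivity))
      _ = |K| * ((2 : ℝ) ^ mhi n) ^ (1 + a) := by
          rw [Real.rpow_add hp0, Real.rpow_one]; ring
      _ ≤ |K| * ((n : ℝ) ^ (1 / (2 * r + 1 + a))) ^ (1 + a) := by gcongr
      _ = _ := by
          rw [← Real.rpow_mul hn'.le]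
          congr 2
          ring
  have h5 : (n : ℝ) / Real.log n ^ 2 ≤ |c| * (|K| * (n : ℝ) ^ ((1 + a) / (2 * r + 1 + a))) :=
    h1.trans (mul_le_mul (le_abs_self c) h4 hnn (abs_nonneg c))
  rw [div_le_iff₀ (by positivity)] at h5
  have hp1 : 0 < (n : ℝ) ^ ((1 + a) / (2 * r + 1 + a)) := Real.rpow_pos_of_pos hn' _
  have h6 : (n : ℝ) = (n : ℝ) ^ (2 * r / (2 * r + 1 + a)) * (n : ℝ) ^ ((1 + a) / (2 * r + 1 + a)) := by
    rw [← Real.rpow_add hn', ← add_div, show 2 * r + (1 + a) = 2 * r + 1 + a by ring,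
      div_self hβ.ne', Real.rpow_one]
  have h7 := mul_lt_mul_of_pos_right h2 hp1
  rw [← h6] at h7
  linarith

lemma exists_mhi_bound
    (h : (fun n : ℕ => (2 : ℝ) ^ mhi n * (g (mhi n) + 1)) =Θ[atTop]
      fun n : ℕ => (n : ℝ) / Real.log n ^ 2) :
    ∃ C, 0 < C ∧ ∀ᶠ n in atTop, (2 : ℝ) ^ mhi n * (1 + g (mhi n)) * Real.log n ^ 2 ≤ C * n := by
  obtain ⟨c, hc⟩ := h.1.bound
  refine ⟨|c| + 1, by positivity, ?_⟩
  filter_upwards [hc, eventually_gt_atTop 1] with n h1 hn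
  have hn' : (0 : ℝ) < n := by exact_mod_cast (by omega : 0 < n)
  have hl : 0 < Real.log n := Real.log_pos (by exact_mod_cast hn)
  rw [Real.norm_eq_abs, Real.norm_eq_abs, abs_of_pos (show 0 < (n : ℝ) / Real.log n ^ 2 by positivity)]
    at h1
  have h2 : (2 : ℝ) ^ mhi n * (1 + g (mhi n)) ≤ (|c| + 1) * (n / Real.log n ^ 2) := by
    rw [add_comm 1]
    refine (le_abs_self _).trans (h1.trans (mul_le_mul_of_nonneg_right ?_ (by positivity)))
    linarith [le_abs_self c]
  calc _ ≤ (|c| + 1) * (n / Real.log n ^ 2) * Real.log n ^ 2 :=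
        mul_le_mul_of_nonneg_right h2 (by positivity)
    _ = _ := by field_simp

/-- There are O(log n) levels, so a union bound over them costs only a logarithm. -/
lemma eventually_mhi_le_log {C : ℝ} (hC : 0 < C) (hg : ∀ m, 0 ≤ g m)
    (h : ∀ᶠ n : ℕ in atTop, (2 : ℝ) ^ mhi n * (1 + g (mhi n)) * Real.log n ^ 2 ≤ C * n) :
    ∃ D, 0 < D ∧ ∀ᶠ n : ℕ in atTop, (mhi n : ℝ) + 1 ≤ D * Real.log n := by
  have hl2 : 0 < Real.log 2 := Real.log_pos one_lt_two
  refine ⟨(Real.log 2)⁻¹ * (|Real.log C| + 1) + 1, by positivity, ?_⟩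
  filter_upwards [h, tendsto_log_natCast.eventually_ge_atTop 1, eventually_gt_atTop 0]
    with n h1 hlog hn
  have hn' : (0 : ℝ) < n := by exact_mod_cast hn
  have h2 : (2 : ℝ) ^ mhi n ≤ C * n := by
    refine le_trans ?_ h1
    have e1 : 1 ≤ Real.log n ^ 2 := one_le_pow₀ hlog
    have e2 : (1 : ℝ) ≤ 1 + g (mhi n) := by linarith [hg (mhi n)]
    rw [mul_assoc]
    exact le_mul_of_one_le_right (by positivity) (one_le_mul_of_one_le_of_one_le e2 e1)
  have h3 := Real.log_le_log (by positivity) h2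
  rw [Real.log_pow, Real.log_mul hC.ne' hn'.ne'] at h3
  have h4 : (mhi n : ℝ) ≤ (Real.log 2)⁻¹ * (|Real.log C| + Real.log n) := by
    rw [inv_mul_eq_div, le_div_iff₀ hl2]
    linarith [le_abs_self (Real.log C)]
  have h5 : |Real.log C| ≤ |Real.log C| * Real.log n :=
    le_mul_of_one_le_right (abs_nonneg _) hlog
  have h6 : (Real.log 2)⁻¹ * (|Real.log C| + Real.log n) ≤
      (Real.log 2)⁻¹ * (|Real.log C| * Real.log n + Real.log n) :=
    mul_le_mul_of_nonneg_left (by linarith) (by positivity)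
  calc (mhi n : ℝ) + 1 ≤ (Real.log 2)⁻¹ * (|Real.log C| * Real.log n + Real.log n) +
        Real.log n := by linarith
    _ = _ := by ring

/-- The bias and the variance at the balanced level. -/
lemma balancedLevel_rate {K r : ℝ} (hK0 : 0 < K) (hr : 0 < r)
    (hK : ∀ m, 1 + g m ≤ K * ((2 : ℝ) ^ m) ^ max α 0) {n : ℕ} (hn : 0 < n) :
    (2 : ℝ) ^ balancedLevel (2 * r + 1 + max α 0) n *
        (1 + g (balancedLevel (2 * r + 1 + max α 0) n)) * (n : ℝ)⁻¹ ≤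
        K * (n : ℝ) ^ (-(2 * r / (2 * r + 1 + max α 0))) ∧
      (mesh (balancedLevel (2 * r + 1 + max α 0) n) ^ r) ^ 2 ≤
        ((2 : ℝ) ^ r) ^ 2 * (n : ℝ) ^ (-(2 * r / (2 * r + 1 + max α 0))) := by
  set a := max α 0 with ha
  have ha0 : 0 ≤ a := le_max_right _ _
  have hβ : 0 < 2 * r + 1 + a := by positivity
  have hn' : (0 : ℝ) < n := by exact_mod_cast hn
  set m := balancedLevel (2 * r + 1 + a) n with hm
  have hp0 : (0 : ℝ) < 2 ^ m := by positivity
  constructor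
  · calc (2 : ℝ) ^ m * (1 + g m) * (n : ℝ)⁻¹ ≤ 2 ^ m * (K * ((2 : ℝ) ^ m) ^ a) * (n : ℝ)⁻¹ := by
          gcongr
          exact hK m
      _ = K * ((2 : ℝ) ^ m) ^ (1 + a) * (n : ℝ)⁻¹ := by
          rw [Real.rpow_add hp0, Real.rpow_one]; ring
      _ ≤ K * ((n : ℝ) ^ (1 / (2 * r + 1 + a))) ^ (1 + a) * (n : ℝ)⁻¹ := by
          gcongr
          exact two_pow_balancedLevel_le hβ hn
      _ = _ := by
          rw [← Real.rpow_mul hn'.le, ← Real.rpow_neg_one, mul_assoc, ← Real.rpow_add hn']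
          congr 2
          field_simp
          ring
  · have h1 : mesh m ≤ 2 * (n : ℝ) ^ (-(1 / (2 * r + 1 + a))) := by
      rw [mesh, Real.rpow_neg hn'.le, ← div_eq_mul_inv]
      have h2 := lt_two_pow_balancedLevel (2 * r + 1 + a) n
      have h3 : 0 < (n : ℝ) ^ (1 / (2 * r + 1 + a)) := Real.rpow_pos_of_pos hn' _
      rw [inv_eq_one_div, div_le_div_iff₀ hp0 h3]
      linarith
    calc (mesh m ^ r) ^ 2 ≤ ((2 * (n : ℝ) ^ (-(1 / (2 * r + 1 + a)))) ^ r) ^ 2 := by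
          have := (mesh_pos m).le
          gcongr
      _ = _ := by
          rw [Real.mul_rpow (by norm_num) (by positivity), mul_pow, ← Real.rpow_mul hn'.le,
            ← Real.rpow_natCast ((n : ℝ) ^ _), ← Real.rpow_mul hn'.le]
          congr 2
          push_cast
          ring

end Levels

/-! ### The two events on which the estimator is controlled -/

/-- All empirical matrices are close to the population matrices, and so is the empirical vector at
the last level. -/
def CoarseEvent (φ p Ψ : ℝ → ℝ) (M₁ M₂ : ℝ) (s : ℕ) (y : ℝ) (u : ℕ → ℤ → ℝ → ℝ) (m₁ m₂ : ℕ)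
    {n : ℕ} (x : Fin n → ℝ) : Prop :=
  (∀ i : Fin (m₂ + 1), m₁ ≤ i → ∀ j k, |Bhat φ M₁ M₂ s y i x j k - popB φ p i j k| ≤
    LocalModel.tol p M₁ M₂ s y) ∧
  ∀ k, |chat M₁ M₂ s y u m₂ x k - popC φ Ψ m₂ k| ≤ (√((2 : ℝ) ^ m₂))⁻¹

/-- The deviations of the sample means at all levels from `m₀` on are of the order of their standard
deviations, up to a logarithmic factor. -/
def SharpEvent (φ p Ψ : ℝ → ℝ) (M₁ M₂ : ℝ) (s : ℕ) (y : ℝ) (u : ℕ → ℤ → ℝ → ℝ) (H : ℝ)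
    (m₀ m₂ : ℕ) {n : ℕ} (x : Fin n → ℝ) : Prop :=
  ∀ i : Fin (m₂ + 1), m₀ ≤ i →
    (∀ k, |chat M₁ M₂ s y u i x k - popC φ Ψ i k| ≤
      2 * √(supNorm p * (1 + gam M₁ M₂ s y u i ^ 2) * (Real.log n / n))) ∧
    ∀ j, |(Bhat φ M₁ M₂ s y i x).mulVec (popCoef φ p Ψ M₁ M₂ s y i) j - popC φ Ψ i j| ≤
      2 * √(supNorm p * H ^ 2 * (Real.log n / n))

namespace LocalModel

variable {p Ψ φ : ℝ → ℝ} {M₁ M₂ : ℝ} {s : ℕ} {y r : ℝ} {u : ℕ → ℤ → ℝ → ℝ} {L : ℕ}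
  {α Cγ Cu : ℝ} {m₀ m₁ m₂ n : ℕ} {Cb H lam : ℝ}

section Events

variable {Ω : Type*} [MeasurableSpace Ω] {P : Measure Ω} {X : ℕ → Ω → ℝ}

lemma measureReal_not_and_le {A B : Ω → Prop} {a b : ℝ} [IsFiniteMeasure P]
    (ha : P.real {ω | ¬ A ω} ≤ a) (hb : P.real {ω | ¬ B ω} ≤ b) :
    P.real {ω | ¬ (A ω ∧ B ω)} ≤ a + b := by
  refine (measureReal_mono (s₂ := {ω | ¬ A ω} ∪ {ω | ¬ B ω}) ?_).trans
    ((measureReal_union_le _ _).trans (add_le_add ha hb))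
  intro ω hω
  simp only [Set.mem_ofPred_eq, Set.mem_union] at hω ⊢
  tauto

lemma measureReal_not_imp_le {A : Ω → Prop} {Q : Prop} {b : ℝ} (hb : 0 ≤ b)
    (h : Q → P.real {ω | ¬ A ω} ≤ b) : P.real {ω | ¬ (Q → A ω)} ≤ b := by
  by_cases hQ : Q
  · simpa [hQ] using h hQ
  · simpa [hQ] using hb

/-- The hypothesis on R bounds all exponents at once. For the matrices n/2^m ≥ R at every level. For
the vector the squared tolerance 2^{-m₂} meets a variance of order 1 + γ², giving n/(2^{m₂} (1 +
γ²)) ≥ R. It will be applied with R of order log² n. -/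
lemma measure_not_coarse_le [IsProbabilityMeasure P] (h : LocalModel p Ψ φ M₁ M₂ s y r)
    (hX : IsSample P p X) (hu : Companion p Ψ φ M₁ M₂ s y u L α Cγ Cu) (hn : 0 < n)
    (hL : L ≤ m₂) {R : ℝ} (hR : 2 ^ m₂ * (1 + gam M₁ M₂ s y u m₂ ^ 2) * R ≤ n) (hR0 : 0 ≤ R) :
    P.real {ω | ¬ CoarseEvent φ p Ψ M₁ M₂ s y u m₁ m₂ (fun i : Fin n => X i ω)} ≤
      (m₂ + 1) * (sysSize M₁ M₂ s y * (sysSize M₁ M₂ s y *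
        (2 * Real.exp (-(tol p M₁ M₂ s y ^ 2 / (4 * varConst p φ M₁ M₂ s y) * R))))) +
      sysSize M₁ M₂ s y * (2 * Real.exp (-(1 / (4 * (supNorm p + Cu)) * R))) := by
  have hV := h.varConst_pos
  have ht := h.tol_pos
  have hP := h.supNorm_p_pos
  have hCu := hu.Cu_nonneg
  have hn' : (0 : ℝ) < n := by exact_mod_cast hn
  have hg := sq_nonneg (gam M₁ M₂ s y u m₂)
  refine measureReal_not_and_le ?_ ?_
  · refine (measureReal_not_forall_le (ι := Fin (m₂ + 1)) fun i =>
      measureReal_not_imp_le (b := sysSize M₁ M₂ s y * (sysSize M₁ M₂ s y *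
        (2 * Real.exp (-(tol p M₁ M₂ s y ^ 2 / (4 * varConst p φ M₁ M₂ s y) * R)))))
        (by positivity) fun _ => (h.measure_Bhat_dev_le hX hn).trans ?_).trans (by simp)
    have h1 : R ≤ n / 2 ^ (i : ℕ) := by
      rw [le_div_iff₀ (by positivity)]
      refine le_trans ?_ hR
      have : (2 : ℝ) ^ (i : ℕ) ≤ 2 ^ m₂ :=
        pow_le_pow_right₀ one_le_two (Nat.lt_succ_iff.1 i.2)
      calc R * 2 ^ (i : ℕ) ≤ R * 2 ^ m₂ := by gcongr
        _ = 2 ^ m₂ * 1 * R := by ring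
        _ ≤ _ := by gcongr; linarith
    gcongr
  · refine (h.measure_chat_dev_le hX hu hL hn
      (V := (supNorm p + Cu) * (1 + gam M₁ M₂ s y u m₂ ^ 2)) (t := (√((2 : ℝ) ^ m₂))⁻¹)
      ?_ (by positivity) ?_).trans ?_
    · nlinarith
    · have hs0 : 0 < √((2 : ℝ) ^ m₂) := Real.sqrt_pos.2 (by positivity)
      have h1 : √(1 + gam M₁ M₂ s y u m₂ ^ 2) ≤ 1 + gam M₁ M₂ s y u m₂ ^ 2 := by
        rw [Real.sqrt_le_left (by linarith)]
        nlinarith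
      calc (√((2 : ℝ) ^ m₂))⁻¹ * (Cu * √((2 : ℝ) ^ m₂) * √(1 + gam M₁ M₂ s y u m₂ ^ 2)) =
            Cu * √(1 + gam M₁ M₂ s y u m₂ ^ 2) := by field_simp
        _ ≤ Cu * (1 + gam M₁ M₂ s y u m₂ ^ 2) := by gcongr
        _ ≤ _ := by nlinarith
    · have h1 : 1 / (4 * (supNorm p + Cu)) * R ≤ n * (√((2 : ℝ) ^ m₂))⁻¹ ^ 2 /
          (4 * ((supNorm p + Cu) * (1 + gam M₁ M₂ s y u m₂ ^ 2))) := by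
        rw [inv_pow, Real.sq_sqrt (by positivity), le_div_iff₀ (by positivity)]
        calc _ = R * (1 + gam M₁ M₂ s y u m₂ ^ 2) := by field_simp
          _ ≤ _ := by
            rw [← div_eq_mul_inv, le_div_iff₀ (by positivity)]
            linarith
      gcongr

/-- The deviation 2√(V log n / n) makes the exponent equal to log n, so each component fails with
probability at most 2/n. `h1` and `h2` are the range conditions of the exponential inequality at the
finest level. -/
lemma measure_not_sharp_le [IsProbabilityMeasure P] (h : LocalModel p Ψ φ M₁ M₂ s y r)
    (hX : IsSample P p X) (hu : Companion p Ψ φ M₁ M₂ s y u L α Cγ Cu) (hn : 1 < n)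
    (hL : L ≤ m₀) (hfine : ∀ m, m₀ ≤ m → FineLevel p Ψ φ M₁ M₂ s y r Cb m) (hH0 : 0 < H)
    (hH : supNorm φ * √(sysSize M₁ M₂ s y) * coefConst p Ψ M₁ M₂ s y ≤ H)
    (h1 : 2 * Cu * √(2 ^ m₂ * (Real.log n / n)) ≤ √(supNorm p))
    (h2 : 2 * supNorm φ * √(2 ^ m₂ * (Real.log n / n)) ≤ √(supNorm p)) :
    P.real {ω | ¬ SharpEvent φ p Ψ M₁ M₂ s y u H m₀ m₂ (fun i : Fin n => X i ω)} ≤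
      (m₂ + 1) * (4 * sysSize M₁ M₂ s y * (n : ℝ)⁻¹) := by
  have hP := h.supNorm_p_pos
  have hCu := hu.Cu_nonneg
  have hF := supNorm_nonneg φ
  have hn' : (0 : ℝ) < n := by exact_mod_cast (by omega : 0 < n)
  have hl : 0 < Real.log n := Real.log_pos (by exact_mod_cast hn)
  have hPP : √(supNorm p) * √(supNorm p) = supNorm p := Real.mul_self_sqrt hP.le
  have hexp : ∀ V : ℝ, 0 < V → Real.exp (-(n * (2 * √(V * (Real.log n / n))) ^ 2 / (4 * V))) =
      (n : ℝ)⁻¹ := by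
    intro V hV
    have : n * (2 * √(V * (Real.log n / n))) ^ 2 / (4 * V) = Real.log n := by
      rw [mul_pow, Real.sq_sqrt (by positivity)]
      field_simp
      ring
    rw [this, Real.exp_neg, Real.exp_log hn']
  refine (measureReal_not_forall_le (ι := Fin (m₂ + 1)) fun i =>
    measureReal_not_imp_le (b := 4 * sysSize M₁ M₂ s y * (n : ℝ)⁻¹) (by positivity) fun hi =>
      (measureReal_not_and_le (a := sysSize M₁ M₂ s y * (2 * (n : ℝ)⁻¹))
        (b := sysSize M₁ M₂ s y * (2 * (n : ℝ)⁻¹)) ?_ ?_).trans (by linarith)).trans (by simp)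
  all_goals
    have hpow : (2 : ℝ) ^ (i : ℕ) ≤ 2 ^ m₂ :=
      pow_le_pow_right₀ one_le_two (Nat.lt_succ_iff.1 i.2)
    have hsq : √((2 : ℝ) ^ (i : ℕ)) * √(Real.log n / n) ≤ √(2 ^ m₂ * (Real.log n / n)) := by
      rw [← Real.sqrt_mul (by positivity)]
      gcongr
  · set G := 1 + gam M₁ M₂ s y u i ^ 2 with hG
    have hG0 : 0 < G := by positivity
    rw [← hexp (supNorm p * G) (by positivity)]
    refine h.measure_chat_dev_le hX hu (hL.trans hi) (by omega) le_rfl (by positivity) ?_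
    have hGG : √G * √G = G := Real.mul_self_sqrt hG0.le
    rw [Real.sqrt_mul (by positivity), Real.sqrt_mul hP.le, ← hG]
    calc _ = √(supNorm p) * (2 * Cu * (√((2 : ℝ) ^ (i : ℕ)) * √(Real.log n / n))) * (√G * √G) := by
          ring
      _ ≤ √(supNorm p) * √(supNorm p) * (√G * √G) := by
          gcongr
          exact (mul_le_mul_of_nonneg_left hsq (by positivity)).trans h1
      _ = _ := by rw [hPP, hGG]
  · rw [← hexp (supNorm p * H ^ 2) (by positivity)]
    refine h.measure_Bhat_mulVec_dev_le hX (hfine i hi) hH0 hH (by omega) (by positivity) ?_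
    rw [Real.sqrt_mul (by positivity), Real.sqrt_mul hP.le, Real.sqrt_sq hH0.le]
    calc _ = √(supNorm p) * (2 * supNorm φ * (√((2 : ℝ) ^ (i : ℕ)) * √(Real.log n / n))) *
          (H * H) := by ring
      _ ≤ √(supNorm p) * √(supNorm p) * (H * H) := by
          gcongr
          exact (mul_le_mul_of_nonneg_left hsq (by positivity)).trans h2
      _ = _ := by rw [hPP]; ring

end Events

variable {x : Fin n → ℝ}

lemma CoarseEvent.close (hE : CoarseEvent φ p Ψ M₁ M₂ s y u m₁ m₂ x) {m : ℕ}
    (hm : m ∈ Set.Icc m₁ m₂) (j k : idx M₁ M₂ s y m) :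
    |Bhat φ M₁ M₂ s y m x j k - popB φ p m j k| ≤ tol p M₁ M₂ s y :=
  hE.1 ⟨m, Nat.lt_succ_iff.2 hm.2⟩ hm.1 j k

lemma CoarseEvent.invNorm_le (h : LocalModel p Ψ φ M₁ M₂ s y r)
    (hE : CoarseEvent φ p Ψ M₁ M₂ s y u m₁ m₂ x)
    (hfine : ∀ m, m₁ ≤ m → FineLevel p Ψ φ M₁ M₂ s y r Cb m)
    (hδ : ∀ m, m ≤ m₂ → √((2 : ℝ) ^ m / n) ≤ tol p M₁ M₂ s y) :
    ∀ m ∈ Set.Icc m₁ m₂, invNorm φ M₁ M₂ s y m x ≤ 2 / p y := fun m hm =>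
  (h.invNorm_bounds (hfine m hm.1).pop_close (hδ m hm.2) (CoarseEvent.close hE hm)).2.1

/-- The bound for the error at the last level. -/
def lastConst (φ p Ψ : ℝ → ℝ) (M₁ M₂ : ℝ) (s : ℕ) (y Cb : ℝ) : ℝ :=
  Cphi φ * (2 / p y * (√(sysSize M₁ M₂ s y) + p y / 8 * coefConst p Ψ M₁ M₂ s y +
    tol p M₁ M₂ s y * coefConst p Ψ M₁ M₂ s y)) + Cb

lemma CoarseEvent.abs_that_mhat_sub_le (h : LocalModel p Ψ φ M₁ M₂ s y r) (hCb : 0 ≤ Cb)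
    (hE : CoarseEvent φ p Ψ M₁ M₂ s y u m₁ m₂ x)
    (hfine : ∀ m, m₁ ≤ m → FineLevel p Ψ φ M₁ M₂ s y r Cb m)
    (hδ : ∀ m, m ≤ m₂ → √((2 : ℝ) ^ m / n) ≤ tol p M₁ M₂ s y)
    (hlam : 0 ≤ lam) (hle : m₁ ≤ m₂) :
    |that φ M₁ M₂ s y u (mhat φ M₁ M₂ s y u lam m₁ m₂ x) x - Ψ y / p y| ≤
      2 * lam * (2 / p y) ^ 2 * √(rhoSq M₁ M₂ s y u m₂ n) +
        lastConst φ p Ψ M₁ M₂ s y Cb := by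
  have hm₂ : m₂ ∈ Set.Icc m₁ m₂ := ⟨hle, le_rfl⟩
  refine (_root_.abs_sub_le _ (that φ M₁ M₂ s y u m₂ x) _).trans (add_le_add ?_ ?_)
  · exact WaveletEB.abs_that_mhat_sub_le hlam hle (CoarseEvent.invNorm_le h hE hfine hδ) hm₂
      (mhat_spec hle).1.2
  · exact (hfine m₂ hle).abs_that_sub_le_const h hCb (hδ m₂ le_rfl) (CoarseEvent.close hE hm₂) hE.2

lemma SharpEvent.abs_that_mhat_sub_le (h : LocalModel p Ψ φ M₁ M₂ s y r) (hCb : 0 ≤ Cb)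
    (hE : CoarseEvent φ p Ψ M₁ M₂ s y u m₁ m₂ x)
    (hS : SharpEvent φ p Ψ M₁ M₂ s y u H m₀ m₂ x)
    (hfine : ∀ m, m₁ ≤ m → FineLevel p Ψ φ M₁ M₂ s y r Cb m)
    (hδ : ∀ m, m ≤ m₂ → √((2 : ℝ) ^ m / n) ≤ tol p M₁ M₂ s y)
    (h10 : m₁ ≤ m₀) (h02 : m₀ ≤ m₂) (hH : 0 < H)
    (hlam : 3 * p y * (Cphi φ * √(sysSize M₁ M₂ s y) * √(supNorm p)) * (1 + H) ≤ lam - 3 / 4)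
    (hn : 1 < n)
    (hlog : 3 * p y / 2 * Cphi φ * coefConst p Ψ M₁ M₂ s y ≤ 1 / 4 * √(Real.log n)) :
    |that φ M₁ M₂ s y u (mhat φ M₁ M₂ s y u lam m₁ m₂ x) x - Ψ y / p y| ≤
      (3 * lam + 1) * (2 / p y) ^ 2 * (√(rhoSq M₁ M₂ s y u m₀ n) +
        2 * (Cb * (3 * p y / 2) ^ 2) / (1 - (1 / 2 : ℝ) ^ r) * mesh m₀ ^ r) := by
  have hp := h.p_pos
  have hC := h.scaling.Cphi_nonneg
  have hlam' : 1 / 2 ≤ lam := by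
    have : 0 ≤ 3 * p y * (Cphi φ * √(sysSize M₁ M₂ s y) * √(supNorm p)) * (1 + H) := by
      positivity
    linarith
  refine abs_that_mhat_sub_le_oracle hlam' (by positivity) h.r_pos h10 h02
    (CoarseEvent.invNorm_le h hE hfine hδ) fun m hm => ?_
  have hm' : m ∈ Set.Icc m₁ m₂ := ⟨h10.trans hm.1, hm.2⟩
  have hSm := hS ⟨m, Nat.lt_succ_iff.2 hm.2⟩ hm.1
  exact (hfine m hm'.1).abs_that_sub_le_rho h hCb hH hlam hn hlog (hδ m hm.2)
    (CoarseEvent.close hE hm') hSm.1 hSm.2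

/-- A polynomial bound for the estimator that holds for almost every sample. -/
lemma ae_sq_that_mhat_le {Ω : Type*} [MeasurableSpace Ω] {P : Measure Ω} {X : ℕ → Ω → ℝ}
    (h : LocalModel p Ψ φ M₁ M₂ s y r) (hX : IsSample P p X)
    (hu : Companion p Ψ φ M₁ M₂ s y u L α Cγ Cu) (hn : 0 < n) (hL : L ≤ m₁) (hle : m₁ ≤ m₂)
    {K C : ℝ} (hK0 : 0 < K)
    (hK : ∀ m, 1 + gam M₁ M₂ s y u m ^ 2 ≤ K * ((2 : ℝ) ^ m) ^ max α 0) (hC : 0 < C)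
    (hm₂ : (2 : ℝ) ^ m₂ ≤ C * n) :
    ∀ᵐ ω ∂P, that φ M₁ M₂ s y u
        (mhat φ M₁ M₂ s y u lam m₁ m₂ (fun i : Fin n => X i ω)) (fun i : Fin n => X i ω) ^ 2 ≤
      (Cphi φ * √(sysSize M₁ M₂ s y) * Cu) ^ 2 * (K * C ^ (1 + max α 0)) *
        (n : ℝ) ^ (2 + max α 0) := by
  have hCp := h.scaling.Cphi_nonneg
  have hCu := hu.Cu_nonneg
  have hn' : (0 : ℝ) < n := by exact_mod_cast hn
  have ha : 0 ≤ max α 0 := le_max_right _ _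
  have hall : ∀ᵐ ω ∂P, ∀ m, m₁ ≤ m → ∀ k ∈ idx M₁ M₂ s y m, ∀ l : Fin n,
      |u m k (X l ω)| ≤ Cu * √((2 : ℝ) ^ m) * gam M₁ M₂ s y u m := by
    simp only [ae_all_iff]
    exact fun m hm k hk l => hX.ae_comp (hu.bdd m (hL.trans hm) k hk) l
  filter_upwards [hall] with ω hω
  set x : Fin n → ℝ := fun i => X i ω
  set m := mhat φ M₁ M₂ s y u lam m₁ m₂ x with hm
  have hmem : m ∈ Set.Icc m₁ m₂ := (mhat_spec hle).1
  have hγ0 : 0 ≤ gam M₁ M₂ s y u m := Real.sqrt_nonneg _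
  have h1 := h.scaling.abs_that_le (x := x) (y := y) hn
    (show 0 ≤ Cu * √((2 : ℝ) ^ m) * gam M₁ M₂ s y u m by positivity) (hω m hmem.1)
  have h2 := pow_le_pow_left₀ (abs_nonneg _) h1 2
  rw [sq_abs] at h2
  have hp0 : (0 : ℝ) < 2 ^ m := by positivity
  have h3 : (2 : ℝ) ^ m ≤ C * n := (pow_le_pow_right₀ one_le_two hmem.2).trans hm₂
  have h4 : (2 : ℝ) ^ m * gam M₁ M₂ s y u m ^ 2 ≤
      K * C ^ (1 + max α 0) * (n : ℝ) ^ (1 + max α 0) := by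
    calc (2 : ℝ) ^ m * gam M₁ M₂ s y u m ^ 2 ≤ 2 ^ m * (K * ((2 : ℝ) ^ m) ^ max α 0) := by
          gcongr
          linarith [hK m]
      _ = K * ((2 : ℝ) ^ m) ^ (1 + max α 0) := by
          rw [Real.rpow_add hp0, Real.rpow_one]; ring
      _ ≤ K * (C * n) ^ (1 + max α 0) := by gcongr
      _ = _ := by rw [Real.mul_rpow hC.le hn'.le]; ring
  refine h2.trans ?_
  calc _ = (Cphi φ * √(sysSize M₁ M₂ s y) * Cu) ^ 2 * (√n ^ 2 * (√((2 : ℝ) ^ m) ^ 2 *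
        gam M₁ M₂ s y u m ^ 2)) := by ring
    _ = (Cphi φ * √(sysSize M₁ M₂ s y) * Cu) ^ 2 * (n * ((2 : ℝ) ^ m *
        gam M₁ M₂ s y u m ^ 2)) := by rw [Real.sq_sqrt hn'.le, Real.sq_sqrt hp0.le]
    _ ≤ (Cphi φ * √(sysSize M₁ M₂ s y) * Cu) ^ 2 *
        (n * (K * C ^ (1 + max α 0) * (n : ℝ) ^ (1 + max α 0))) := by gcongr
    _ = _ := by
        have e : (n : ℝ) ^ (2 + max α 0) = n * (n : ℝ) ^ (1 + max α 0) := by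
          rw [show 2 + max α 0 = 1 + (1 + max α 0) by ring, Real.rpow_add hn' 1 (1 + max α 0),
            Real.rpow_one]
        rw [e]
        ring

end LocalModel

/-! ### Assembly of the risk bound -/

namespace LocalModel

variable {p Ψ φ : ℝ → ℝ} {M₁ M₂ : ℝ} {s : ℕ} {y r : ℝ} {u : ℕ → ℤ → ℝ → ℝ} {L : ℕ}
  {α Cγ Cu : ℝ}

lemma two_mul_sqrt_le {w C S ℓ q : ℝ} (hS : 0 < S) (hC : 0 < C) (hq : 0 ≤ q)
    (hℓ : 4 * w ^ 2 * C / S ≤ ℓ) (hqℓ : q * ℓ ≤ C) : 2 * w * √q ≤ √S := by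
  refine Real.le_sqrt_of_sq_le ?_
  rw [mul_pow, Real.sq_sqrt hq]
  have h1 : q * (4 * w ^ 2 * C / S) ≤ C := (mul_le_mul_of_nonneg_left hℓ hq).trans hqℓ
  have h2 : q * (4 * w ^ 2 * C / S) = (2 * w) ^ 2 * q / S * C := by ring
  rw [h2] at h1
  have h3 : (2 * w) ^ 2 * q / S ≤ 1 := le_of_mul_le_mul_right (by linarith) hC
  rwa [div_le_one hS] at h3

lemma le_quarter_sqrt {w ℓ : ℝ} (h : 16 * w ^ 2 ≤ ℓ) : w ≤ 1 / 4 * √ℓ := by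
  have := Real.le_sqrt_of_sq_le (x := 4 * w) (y := ℓ) (by linarith [mul_pow 4 w 2])
  linarith

set_option maxHeartbeats 800000 in
/-- The risk of the adaptive estimator for large samples. -/
theorem exists_risk_le {Ω : Type*} [MeasurableSpace Ω] {P : Measure Ω} [IsProbabilityMeasure P]
    {X : ℕ → Ω → ℝ} (h : LocalModel p Ψ φ M₁ M₂ s y r) (hX : IsSample P p X)
    (hu : Companion p Ψ φ M₁ M₂ s y u L α Cγ Cu) {H lam : ℝ} (hH0 : 0 < H)
    (hH : supNorm φ * √(sysSize M₁ M₂ s y) * coefConst p Ψ M₁ M₂ s y ≤ H)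
    (hlam : 3 * p y * (Cphi φ * √(sysSize M₁ M₂ s y) * √(supNorm p)) * (1 + H) ≤ lam - 3 / 4)
    {mlo mhi : ℕ → ℕ} (hmlo : (fun n : ℕ => (2 : ℝ) ^ mlo n) =Θ[atTop] fun n : ℕ => Real.log n)
    (hmhi : (fun n : ℕ => (2 : ℝ) ^ mhi n * (gam M₁ M₂ s y u (mhi n) ^ 2 + 1))
      =Θ[atTop] fun n : ℕ => (n : ℝ) / Real.log n ^ 2) :
    ∃ K, ∀ᶠ n : ℕ in atTop,
      Integrable (fun ω => |that φ M₁ M₂ s y u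
        (mhat φ M₁ M₂ s y u lam (mlo n) (mhi n) (fun i : Fin n => X i ω))
        (fun i : Fin n => X i ω) - Ψ y / p y| ^ 2) P ∧
      ∫ ω, |that φ M₁ M₂ s y u
        (mhat φ M₁ M₂ s y u lam (mlo n) (mhi n) (fun i : Fin n => X i ω))
        (fun i : Fin n => X i ω) - Ψ y / p y| ^ 2 ∂P ≤
        K * ((n : ℝ) ^ (-(2 * r / (2 * r + 1 + max α 0))) * Real.log n) := by
  have hp := h.p_pos
  have hM := h.sysSize_pos
  have hS := h.supNorm_p_pos
  have ht := h.tol_pos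
  have hV := h.varConst_pos
  have hCu := hu.Cu_nonneg
  have hF := supNorm_nonneg φ
  have hCp := h.scaling.Cphi_nonneg
  have hKa := h.coefConst_nonneg
  have hr := h.r_pos
  have ha : 0 ≤ max α 0 := le_max_right _ _
  set T := Ψ y / p y with hT
  set M : ℝ := (sysSize M₁ M₂ s y : ℝ) with hMdef
  have hg : ∀ m, 0 ≤ gam M₁ M₂ s y u m ^ 2 := fun m => sq_nonneg _
  have hlam0 : 0 ≤ lam := by
    have : 0 ≤ 3 * p y * (Cphi φ * √M * √(supNorm p)) * (1 + H) := by positivity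
    linarith
  obtain ⟨Cb, hCb, hfine⟩ := h.exists_fineLevel
  obtain ⟨N, hN⟩ := eventually_atTop.1 (hfine.and (eventually_ge_atTop L))
  obtain ⟨K, hK0, hK⟩ := exists_one_add_le hg hu.gam_le
  obtain ⟨C, hC, hCev⟩ := exists_mhi_bound (g := fun m => gam M₁ M₂ s y u m ^ 2) hmhi
  obtain ⟨D, hD, hDev⟩ := eventually_mhi_le_log hC hg hCev
  set β := 2 * r + 1 + max α 0 with hβ
  have hβ0 : 0 < β := by positivity
  set c₁ := tol p M₁ M₂ s y ^ 2 / (4 * varConst p φ M₁ M₂ s y) with hc₁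
  set c₂ := 1 / (4 * (supNorm p + Cu)) with hc₂
  have hc₁0 : 0 < c₁ := by positivity
  have hc₂0 : 0 < c₂ := by positivity
  set A₀ := (3 * lam + 1) * (2 / p y) ^ 2 with hA₀
  set B₀ := 2 * (Cb * (3 * p y / 2) ^ 2) / (1 - (1 / 2 : ℝ) ^ r) with hB₀
  set b := (2 * lam * (2 / p y) ^ 2 * √C + lastConst φ p Ψ M₁ M₂ s y Cb) ^ 2 with hb
  set K₆ := (Cphi φ * √M * Cu) ^ 2 * (K * C ^ (1 + max α 0)) with hK₆
  have hK₆0 : 0 ≤ K₆ := by positivity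
  set K₇ := 2 * K₆ + 2 * T ^ 2 with hK₇
  have hK₇0 : 0 ≤ K₇ := by positivity
  have hlast0 : 0 ≤ lastConst φ p Ψ M₁ M₂ s y Cb := by
    unfold lastConst
    positivity
  -- The three summands belong to both events together, to the failure of the sharp event, and to
  -- the failure of the coarse event.
  refine ⟨2 * A₀ ^ 2 * (K + B₀ ^ 2 * ((2 : ℝ) ^ r) ^ 2) + b * (D * (4 * M)) +
    K₇ * (D * (2 * M ^ 2) + 2 * M), ?_⟩
  filter_upwards [eventually_le_mlo hmlo N, eventually_mlo_le_balancedLevel hmlo hβ0,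
    eventually_balancedLevel_le_mhi hg hK hmhi hr, hCev, hDev,
    tendsto_log_natCast.eventually_ge_atTop 1,
    tendsto_log_natCast.eventually_ge_atTop
      (16 * (3 * p y / 2 * Cphi φ * coefConst p Ψ M₁ M₂ s y) ^ 2),
    tendsto_log_natCast.eventually_ge_atTop (C / tol p M₁ M₂ s y ^ 2),
    tendsto_log_natCast.eventually_ge_atTop (4 * Cu ^ 2 * C / supNorm p),
    tendsto_log_natCast.eventually_ge_atTop (4 * supNorm φ ^ 2 * C / supNorm p),
    tendsto_log_natCast.eventually_ge_atTop ((3 + max α 0) * C / c₁),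
    tendsto_log_natCast.eventually_ge_atTop ((3 + max α 0) * C / c₂),
    eventually_gt_atTop 1]
    with n hNlo hlo0 h0hi hCn hDn hl1 hl2 hl3 hl4 hl5 hl6 hl7 hn
  have hn' : (0 : ℝ) < n := by exact_mod_cast (by omega : 0 < n)
  set ℓ := Real.log n with hℓ
  have hℓ0 : 0 < ℓ := by linarith
  set m₁ := mlo n with hm₁
  set m₂ := mhi n with hm₂
  set m₀ := balancedLevel β n with hm₀
  set rate := (n : ℝ) ^ (-(2 * r / β)) with hrate
  have hrate0 : 0 < rate := Real.rpow_pos_of_pos hn' _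
  have hle : m₁ ≤ m₂ := hlo0.trans h0hi
  have hfineN : ∀ m, m₁ ≤ m → FineLevel p Ψ φ M₁ M₂ s y r Cb m := fun m hm =>
    (hN m (hNlo.trans hm)).1
  have hL : L ≤ m₁ := (hN m₁ hNlo).2
  set g := gam M₁ M₂ s y u m₂ ^ 2 with hgdef
  have hg0 : 0 ≤ g := sq_nonneg _
  have hpow : (0 : ℝ) < 2 ^ m₂ := by positivity
  have hℓsq : ℓ ≤ ℓ ^ 2 := le_self_pow₀ hl1 two_ne_zero
  have hCn' : (2 : ℝ) ^ m₂ * ℓ ^ 2 ≤ C * n := by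
    refine le_trans ?_ hCn
    have : (2 : ℝ) ^ m₂ * 1 ≤ 2 ^ m₂ * (1 + g) := by gcongr; linarith
    rw [mul_one] at this
    gcongr
  have hm₂n : (2 : ℝ) ^ m₂ ≤ C * n :=
    (le_mul_of_one_le_right hpow.le (one_le_pow₀ hl1)).trans hCn'
  have hδ : ∀ m, m ≤ m₂ → √((2 : ℝ) ^ m / n) ≤ tol p M₁ M₂ s y := by
    intro m hm
    rw [Real.sqrt_le_left ht.le, div_le_iff₀ hn']
    have e1 : (2 : ℝ) ^ m ≤ 2 ^ m₂ := pow_le_pow_right₀ one_le_two hm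
    have e2 : (2 : ℝ) ^ m₂ * (C / tol p M₁ M₂ s y ^ 2) ≤ C * n :=
      (mul_le_mul_of_nonneg_left (hl3.trans hℓsq) hpow.le).trans hCn'
    rw [← mul_div_assoc, div_le_iff₀ (by positivity)] at e2
    have e3 : (2 : ℝ) ^ m₂ ≤ tol p M₁ M₂ s y ^ 2 * n := by
      refine le_of_mul_le_mul_right ?_ hC
      linarith
    linarith
  have hqℓ : 2 ^ m₂ * (ℓ / n) * ℓ ≤ C := by
    have : 2 ^ m₂ * (ℓ / n) * ℓ = 2 ^ m₂ * ℓ ^ 2 / n := by ring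
    rw [this, div_le_iff₀ hn']
    exact hCn'
  have hq0 : 0 ≤ 2 ^ m₂ * (ℓ / n) := by positivity
  have hlogc : 3 * p y / 2 * Cphi φ * coefConst p Ψ M₁ M₂ s y ≤ 1 / 4 * √ℓ :=
    le_quarter_sqrt hl2
  have hR : (2 : ℝ) ^ m₂ * (1 + g) * (ℓ ^ 2 / C) ≤ n := by
    rw [← mul_div_assoc, div_le_iff₀ hC, mul_comm (n : ℝ)]
    exact hCn
  -- Because the exponent is of order log² n, any power of 1/n is available; 3 + max α 0 is one more
  -- than the exponent of the almost sure bound `hZ1`.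
  have hexp : ∀ c, 0 < c → (3 + max α 0) * C / c ≤ ℓ →
      Real.exp (-(c * (ℓ ^ 2 / C))) ≤ (n : ℝ) ^ (-(3 + max α 0)) := by
    intro c hc hcl
    rw [Real.rpow_def_of_pos hn', ← hℓ]
    refine Real.exp_le_exp.2 ?_
    rw [div_le_iff₀ hc] at hcl
    have : (3 + max α 0) * ℓ ≤ c * (ℓ ^ 2 / C) := by
      rw [← mul_div_assoc, le_div_iff₀ hC]
      calc _ = (3 + max α 0) * C * ℓ := by ring
        _ ≤ ℓ * c * ℓ := by gcongr
        _ = _ := by ring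
    linarith
  have hPS : P.real {ω | ¬ CoarseEvent φ p Ψ M₁ M₂ s y u m₁ m₂ (fun i : Fin n => X i ω)} ≤
      (D * (2 * M ^ 2) + 2 * M) * (ℓ * (n : ℝ) ^ (-(3 + max α 0))) := by
    refine (h.measure_not_coarse_le hX hu (by omega) (hL.trans hle) hR (by positivity)).trans ?_
    have e1 := hexp c₁ hc₁0 hl6
    have e2 := hexp c₂ hc₂0 hl7
    set w := (n : ℝ) ^ (-(3 + max α 0)) with hw
    have hw0 : 0 < w := Real.rpow_pos_of_pos hn' _
    calc _ ≤ D * ℓ * (M * (M * (2 * w))) + M * (2 * w) := by gcongr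
      _ ≤ D * ℓ * (M * (M * (2 * w))) + M * (2 * w) * ℓ := by
          linarith [le_mul_of_one_le_right (by positivity : 0 ≤ M * (2 * w)) hl1]
      _ = _ := by ring
  have hPT : P.real {ω | ¬ SharpEvent φ p Ψ M₁ M₂ s y u H m₀ m₂ (fun i : Fin n => X i ω)} ≤
      D * (4 * M) * (ℓ * (n : ℝ)⁻¹) := by
    refine (h.measure_not_sharp_le hX hu hn (hL.trans hlo0)
      (fun m hm => hfineN m (hlo0.trans hm)) hH0 hH
      (two_mul_sqrt_le hS hC hq0 hl4 hqℓ)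
      (two_mul_sqrt_le hS hC hq0 hl5 hqℓ)).trans ?_
    calc _ ≤ D * ℓ * (4 * M * (n : ℝ)⁻¹) := by gcongr
      _ = _ := by ring
  set Z : Ω → ℝ := fun ω => |that φ M₁ M₂ s y u
    (mhat φ M₁ M₂ s y u lam m₁ m₂ (fun i : Fin n => X i ω)) (fun i : Fin n => X i ω) - T| ^ 2
    with hZ
  have hZm : Measurable Z := by
    have := h.scaling.measurable_that_mhat (n := n) (y := y) (u := u) (lam := lam) hX.meas hle
      (fun m hm => hu.meas m (hL.trans hm))
    exact (continuous_abs.measurable.comp (this.sub_const T)).pow_const 2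
  have hZ1 : ∀ᵐ ω ∂P, Z ω ≤ K₇ * (n : ℝ) ^ (2 + max α 0) := by
    filter_upwards [h.ae_sq_that_mhat_le (lam := lam) hX hu (by omega) hL hle hK0 hK hC hm₂n]
      with ω hω
    set t := that φ M₁ M₂ s y u
      (mhat φ M₁ M₂ s y u lam m₁ m₂ (fun i : Fin n => X i ω)) (fun i : Fin n => X i ω)
    have e1 : (1 : ℝ) ≤ (n : ℝ) ^ (2 + max α 0) :=
      Real.one_le_rpow (by exact_mod_cast hn.le) (by positivity)
    have e2 : T ^ 2 ≤ T ^ 2 * (n : ℝ) ^ (2 + max α 0) := le_mul_of_one_le_right (sq_nonneg T) e1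
    have e3 : |t - T| ^ 2 ≤ 2 * t ^ 2 + 2 * T ^ 2 := by
      rw [sq_abs]
      linarith only [add_sq t T, sub_sq t T, sq_nonneg (t + T)]
    calc Z ω ≤ 2 * t ^ 2 + 2 * T ^ 2 := e3
      _ ≤ 2 * (K₆ * (n : ℝ) ^ (2 + max α 0)) + 2 * (T ^ 2 * (n : ℝ) ^ (2 + max α 0)) := by
          gcongr
      _ = _ := by rw [hK₇]; ring
  have hρ₂ : rhoSq M₁ M₂ s y u m₂ n ≤ C := by
    rw [rhoSq, ← hgdef, ← hℓ]
    have : (2 : ℝ) ^ m₂ * (1 + g) * ℓ ≤ C * n := by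
      refine le_trans ?_ hCn
      gcongr
    calc _ = (2 : ℝ) ^ m₂ * (1 + g) * ℓ / n := by ring
      _ ≤ C := by rwa [div_le_iff₀ hn']
  have hZ2 : ∀ ω, ω ∉ {ω | ¬ CoarseEvent φ p Ψ M₁ M₂ s y u m₁ m₂ (fun i : Fin n => X i ω)} →
      Z ω ≤ b := by
    intro ω hω
    have hE : CoarseEvent φ p Ψ M₁ M₂ s y u m₁ m₂ (fun i : Fin n => X i ω) := by
      simpa using hω
    refine pow_le_pow_left₀ (abs_nonneg _)
      ((CoarseEvent.abs_that_mhat_sub_le h hCb hE hfineN hδ hlam0 hle).trans ?_) 2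
    gcongr
  have hZ3 : ∀ ω, ω ∉ {ω | ¬ CoarseEvent φ p Ψ M₁ M₂ s y u m₁ m₂ (fun i : Fin n => X i ω)} →
      ω ∉ {ω | ¬ SharpEvent φ p Ψ M₁ M₂ s y u H m₀ m₂ (fun i : Fin n => X i ω)} →
      Z ω ≤ 2 * A₀ ^ 2 * (K + B₀ ^ 2 * ((2 : ℝ) ^ r) ^ 2) * (rate * ℓ) := by
    intro ω hω hω'
    have hE : CoarseEvent φ p Ψ M₁ M₂ s y u m₁ m₂ (fun i : Fin n => X i ω) := by
      simpa using hω
    have hE' : SharpEvent φ p Ψ M₁ M₂ s y u H m₀ m₂ (fun i : Fin n => X i ω) := by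
      simpa using hω'
    refine (pow_le_pow_left₀ (abs_nonneg _) (SharpEvent.abs_that_mhat_sub_le h hCb hE hE' hfineN hδ
      hlo0 h0hi hH0 hlam hn hlogc) 2).trans ?_
    obtain ⟨e1, e2⟩ := balancedLevel_rate (g := fun m => gam M₁ M₂ s y u m ^ 2) (n := n) hK0 hr hK
      (by omega)
    have e3 : rhoSq M₁ M₂ s y u m₀ n ≤ K * (rate * ℓ) := by
      rw [rhoSq, ← mul_assoc]
      exact mul_le_mul_of_nonneg_right e1 hℓ0.le
    have e4 : (mesh m₀ ^ r) ^ 2 ≤ ((2 : ℝ) ^ r) ^ 2 * (rate * ℓ) := by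
      refine e2.trans ?_
      gcongr
      exact le_mul_of_one_le_right hrate0.le hl1
    have e5 := Real.sq_sqrt (rhoSq_nonneg M₁ M₂ s y u m₀ n)
    calc (A₀ * (√(rhoSq M₁ M₂ s y u m₀ n) + B₀ * mesh m₀ ^ r)) ^ 2 ≤
          A₀ ^ 2 * (2 * √(rhoSq M₁ M₂ s y u m₀ n) ^ 2 + 2 * (B₀ * mesh m₀ ^ r) ^ 2) := by
          rw [mul_pow]
          gcongr
          rw [← mul_add]
          exact add_sq_le
      _ = A₀ ^ 2 * (2 * rhoSq M₁ M₂ s y u m₀ n + 2 * (B₀ ^ 2 * (mesh m₀ ^ r) ^ 2)) := by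
          rw [e5]; ring
      _ ≤ A₀ ^ 2 * (2 * (K * (rate * ℓ)) + 2 * (B₀ ^ 2 * (((2 : ℝ) ^ r) ^ 2 * (rate * ℓ)))) := by
          gcongr
      _ = _ := by ring
  obtain ⟨hint, hfin⟩ := integral_le_of_bounds (P := P) hZm (fun ω => sq_nonneg _)
    (a := 2 * A₀ ^ 2 * (K + B₀ ^ 2 * ((2 : ℝ) ^ r) ^ 2) * (rate * ℓ)) (b := b)
    (c := K₇ * (n : ℝ) ^ (2 + max α 0)) (by positivity) (sq_nonneg _) (by positivity) hZ1 hZ2 hZ3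
  refine ⟨hint, hfin.trans ?_⟩
  -- The two exceptional contributions are O(log n / n), which is within the rate because 2r/β ≤ 1.
  have hninv : (n : ℝ)⁻¹ ≤ rate := by
    rw [← Real.rpow_neg_one]
    refine Real.rpow_le_rpow_of_exponent_le (by exact_mod_cast hn.le) ?_
    rw [neg_le_neg_iff, div_le_one hβ0]
    linarith
  have hcS : K₇ * (n : ℝ) ^ (2 + max α 0) *
      P.real {ω | ¬ CoarseEvent φ p Ψ M₁ M₂ s y u m₁ m₂ (fun i : Fin n => X i ω)} ≤
      K₇ * (D * (2 * M ^ 2) + 2 * M) * (rate * ℓ) := by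
    have e : (n : ℝ) ^ (2 + max α 0) * (n : ℝ) ^ (-(3 + max α 0)) = (n : ℝ)⁻¹ := by
      rw [← Real.rpow_add hn', ← Real.rpow_neg_one]
      congr 1
      ring
    calc _ ≤ K₇ * (n : ℝ) ^ (2 + max α 0) *
          ((D * (2 * M ^ 2) + 2 * M) * (ℓ * (n : ℝ) ^ (-(3 + max α 0)))) := by gcongr
      _ = K₇ * (D * (2 * M ^ 2) + 2 * M) *
          (((n : ℝ) ^ (2 + max α 0) * (n : ℝ) ^ (-(3 + max α 0))) * ℓ) := by ring
      _ ≤ _ := by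
          rw [e]
          gcongr
  have hbT : b * P.real {ω | ¬ SharpEvent φ p Ψ M₁ M₂ s y u H m₀ m₂ (fun i : Fin n => X i ω)} ≤
      b * (D * (4 * M)) * (rate * ℓ) := by
    have hb0 : 0 ≤ b := sq_nonneg _
    calc _ ≤ b * (D * (4 * M) * (ℓ * (n : ℝ)⁻¹)) := by gcongr
      _ ≤ b * (D * (4 * M) * (ℓ * rate)) := by gcongr
      _ = _ := by ring
  linarith

end LocalModel

/-! ### The marginal model of the observations -/

section Joint

variable {q : ℝ → ℝ → ℝ} {g : ℝ → ℝ} {Ω : Type*} [MeasurableSpace Ω] {P : Measure Ω}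

lemma measurable_joint (hq : Measurable (Function.uncurry q)) (hg : Measurable g) :
    Measurable fun z : ℝ × ℝ => q z.1 z.2 * g z.2 :=
  hq.mul (hg.comp measurable_snd)

lemma measurable_marginal (hq : Measurable (Function.uncurry q)) (hg : Measurable g) :
    Measurable (marginal q g) :=
  (measurable_joint hq hg).stronglyMeasurable.integral_prod_right'.measurable

/-- The integrand is nonnegative and its total mass is 1, being that of the law of (X, ϑ). -/
lemma integrable_joint [IsProbabilityMeasure P] (hq : Measurable (Function.uncurry q))
    (hg : Measurable g) (h0 : ∀ x θ, 0 ≤ q x θ * g θ) {X ϑ : Ω → ℝ} (hX : Measurable X)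
    (hϑ : Measurable ϑ) (hlaw : P.map (fun ω => (X ω, ϑ ω)) =
      (volume : Measure (ℝ × ℝ)).withDensity fun z => ENNReal.ofReal (q z.1 z.2 * g z.2)) :
    Integrable fun z : ℝ × ℝ => q z.1 z.2 * g z.2 := by
  refine ⟨(measurable_joint hq hg).aestronglyMeasurable, ?_⟩
  refine (hasFiniteIntegral_iff_ofReal (Eventually.of_forall fun z : ℝ × ℝ => h0 z.1 z.2)).2 ?_
  have : IsProbabilityMeasure (P.map fun ω => (X ω, ϑ ω)) :=
    Measure.isProbabilityMeasure_map (hX.prodMk hϑ).aemeasurable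
  have h1 : P.map (fun ω => (X ω, ϑ ω)) Set.univ = 1 := measure_univ
  rw [hlaw, withDensity_apply _ MeasurableSet.univ, Measure.restrict_univ] at h1
  rw [h1]
  exact ENNReal.one_lt_top

/-- Tonelli on a strip S × ℝ. Integrability of almost every section is needed to identify the inner
Lebesgue integral with the Bochner integral in `marginal`. -/
lemma map_fst_withDensity_joint (hq : Measurable (Function.uncurry q)) (hg : Measurable g)
    (h0 : ∀ x θ, 0 ≤ q x θ * g θ) (hi : Integrable fun z : ℝ × ℝ => q z.1 z.2 * g z.2) :
    ((volume : Measure (ℝ × ℝ)).withDensity fun z =>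
      ENNReal.ofReal (q z.1 z.2 * g z.2)).map Prod.fst =
      volume.withDensity fun x => ENNReal.ofReal (marginal q g x) := by
  have hm := (measurable_joint hq hg).ennreal_ofReal
  ext S hS
  rw [Measure.map_apply measurable_fst hS, withDensity_apply _ (measurable_fst hS),
    withDensity_apply _ hS, ← Set.prod_univ, Measure.volume_eq_prod,
    setLIntegral_prod _ hm.aemeasurable]
  refine lintegral_congr_ae (ae_restrict_of_ae ?_)
  rw [Measure.volume_eq_prod] at hi
  filter_upwards [hi.prod_right_ae] with x hx
  rw [Measure.restrict_univ, marginal,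
    ofReal_integral_eq_lintegral_ofReal hx (Eventually.of_forall fun θ => h0 x θ)]

lemma isSample_marginal (hq : Measurable (Function.uncurry q)) (hg : Measurable g)
    (h0 : ∀ x θ, 0 ≤ q x θ * g θ) (hi : Integrable fun z : ℝ × ℝ => q z.1 z.2 * g z.2)
    {X ϑ : ℕ → Ω → ℝ} (hX : ∀ i, Measurable (X i)) (hϑ : ∀ i, Measurable (ϑ i))
    (hindep : iIndepFun (fun i ω => (X i ω, ϑ i ω)) P)
    (hlaw : ∀ i, P.map (fun ω => (X i ω, ϑ i ω)) =
      (volume : Measure (ℝ × ℝ)).withDensity fun z => ENNReal.ofReal (q z.1 z.2 * g z.2)) :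
    IsSample P (marginal q g) X where
  meas := hX
  indep := hindep.comp (fun _ => Prod.fst) fun _ => measurable_fst
  law i := by
    rw [← map_fst_withDensity_joint hq hg h0 hi, ← hlaw i,
      Measure.map_map measurable_fst ((hX i).prodMk (hϑ i))]
    rfl

/-- Integrating a bounded function against the marginal density. -/
lemma integral_mul_marginal (hi : Integrable fun z : ℝ × ℝ => q z.1 z.2 * g z.2) {v : ℝ → ℝ}
    (hv : Measurable v) {b : ℝ} (hb : ∀ᵐ x, |v x| ≤ b) :
    ∫ x, v x * marginal q g x = ∫ θ, g θ * ∫ x, q x θ * v x := by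
  rw [Measure.volume_eq_prod] at hi
  have h1 : Integrable (Function.uncurry fun x θ => v x * (q x θ * g θ))
      ((volume : Measure ℝ).prod volume) :=
    hi.bdd_mul (f := fun z : ℝ × ℝ => v z.1) (c := b)
      (hv.comp measurable_fst).aestronglyMeasurable (Measure.quasiMeasurePreserving_fst.ae hb)
  calc _ = ∫ x, ∫ θ, v x * (q x θ * g θ) := by simp_rw [marginal, integral_const_mul]
    _ = ∫ θ, ∫ x, v x * (q x θ * g θ) := integral_integral_swap h1
    _ = _ := by
      simp_rw [← integral_const_mul]
      congr! 4 with θ x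
      ring

/-- Integrating a continuous function of compact support against `Ψ`. -/
lemma integral_mul_bayesNum (hi : ∀ a b : ℝ, IntegrableOn
      (fun z : ℝ × ℝ => z.2 * q z.1 z.2 * g z.2) (Set.Icc a b ×ˢ Set.univ) volume)
    {v : ℝ → ℝ} (hv : Continuous v) (hc : HasCompactSupport v) :
    ∫ x, v x * bayesNum q g x = ∫ θ, g θ * ∫ x, θ * q x θ * v x := by
  obtain ⟨C, hC⟩ := hc.exists_bound_of_continuous hv
  obtain ⟨R, hR⟩ := hc.isCompact.isBounded.subset_closedBall 0
  rw [Real.closedBall_eq_Icc] at hR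
  -- Integrability over strips of bounded x suffices, because v vanishes outside [-R, R].
  have h1 : Integrable (Function.uncurry fun x θ => v x * (θ * q x θ * g θ))
      ((volume : Measure ℝ).prod volume) := by
    rw [← Measure.volume_eq_prod]
    have h2 : IntegrableOn (fun z : ℝ × ℝ => v z.1 * (z.2 * q z.1 z.2 * g z.2))
        (Set.Icc (0 - R) (0 + R) ×ˢ Set.univ) volume :=
      (hi _ _).bdd_mul (f := fun z : ℝ × ℝ => v z.1) (c := C)
        (hv.comp continuous_fst).aestronglyMeasurable (Eventually.of_forall fun z => hC z.1)
    refine (integrableOn_iff_integrable_of_support_subset ?_).1 h2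
    intro z hz
    refine ⟨hR (subset_tsupport v fun h0 => hz ?_), Set.mem_univ _⟩
    change v z.1 * _ = 0
    rw [h0, zero_mul]
  calc _ = ∫ x, ∫ θ, v x * (θ * q x θ * g θ) := by simp_rw [bayesNum, integral_const_mul]
    _ = ∫ θ, ∫ x, v x * (θ * q x θ * g θ) := integral_integral_swap h1
    _ = _ := by
      simp_rw [← integral_const_mul]
      congr! 4 with θ x
      ring

end Joint

end WaveletEB

end

/-! ### Reduction of the theorem to the marginal model -/

theorem theorem3
    -- the model: parameter set, conditional densities and prior density
    (Θ : Set ℝ) (q : ℝ → ℝ → ℝ) (g : ℝ → ℝ)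
    (hq_meas : Measurable (Function.uncurry q))
    (hq_nonneg : ∀ θ ∈ Θ, ∀ x, 0 ≤ q x θ)
    (hq_int : ∀ θ ∈ Θ, ∫ x, q x θ = 1)
    (hg_meas : Measurable g) (hg_nonneg : ∀ θ, 0 ≤ g θ)
    (hg_supp : ∀ θ, θ ∉ Θ → g θ = 0) (hg_int : ∫ θ, g θ = 1)
    -- the numerator of the Bayes estimator is well defined
    (hΨ_int : ∀ a b : ℝ, IntegrableOn (fun z : ℝ × ℝ => z.2 * q z.1 z.2 * g z.2)
      (Set.Icc a b ×ˢ Set.univ) volume)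
    (hp_bdd : MemLp (WaveletEB.marginal q g) ⊤ volume)
    (hΨ_bdd : MemLp (WaveletEB.bayesNum q g) ⊤ volume)
    -- independent pairs with density `q(x|θ) g(θ)`, of which the first components are observed
    {Ω : Type*} [MeasurableSpace Ω] (P : Measure Ω) [IsProbabilityMeasure P]
    (X ϑ : ℕ → Ω → ℝ) (hX : ∀ i, Measurable (X i)) (hϑ : ∀ i, Measurable (ϑ i))
    (hindep : iIndepFun (fun i ω => (X i ω, ϑ i ω)) P)
    (hlaw : ∀ i, P.map (fun ω => (X i ω, ϑ i ω)) =
      (volume : Measure (ℝ × ℝ)).withDensity fun z => ENNReal.ofReal (q z.1 z.2 * g z.2))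
    -- the scaling function, the point and the smoothness
    (φ : ℝ → ℝ) (M₁ M₂ : ℝ) (s : ℕ) (hφ : WaveletEB.IsScaling φ M₁ M₂ s)
    (y : ℝ) (hy : 0 < WaveletEB.marginal q g y)
    (r : ℝ) (hr : 1 / 2 ≤ r) (hrs : r ≤ (s : ℝ) - 1)
    (hp_smooth : WaveletEB.SmoothNear r (WaveletEB.marginal q g) y)
    (hΨ_smooth : WaveletEB.SmoothNear r (WaveletEB.bayesNum q g) y)
    -- the functions `u_{m,k}`, from some level on
    (u : ℕ → ℤ → ℝ → ℝ) (L : ℕ) (α Cγ Cu : ℝ)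
    (hu_meas : ∀ m, L ≤ m → ∀ k ∈ WaveletEB.idx M₁ M₂ s y m, Measurable (u m k))
    (hu_L2 : ∀ m, L ≤ m → ∀ k ∈ WaveletEB.idx M₁ M₂ s y m, MemLp (u m k) 2 volume)
    (hu_eq : ∀ m, L ≤ m → ∀ k ∈ WaveletEB.idx M₁ M₂ s y m, ∀ θ ∈ Θ,
      ∫ x, q x θ * u m k x = ∫ x, θ * q x θ * WaveletEB.phi φ m k x)
    (hγ : ∀ m, L ≤ m → WaveletEB.gam M₁ M₂ s y u m ^ 2 ≤ Cγ * (2 : ℝ) ^ (α * (m : ℝ)))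
    (hu_bdd : ∀ m, L ≤ m → ∀ k ∈ WaveletEB.idx M₁ M₂ s y m,
      ∀ᵐ x, |u m k x| ≤ Cu * √((2 : ℝ) ^ m) * WaveletEB.gam M₁ M₂ s y u m)
    -- the range of levels and the constants in Lepski's rule
    (mlo mhi : ℕ → ℕ)
    (hmlo : (fun n : ℕ => (2 : ℝ) ^ mlo n) =Θ[atTop] fun n : ℕ => Real.log n)
    (hmhi : (fun n : ℕ => (2 : ℝ) ^ mhi n * (WaveletEB.gam M₁ M₂ s y u (mhi n) ^ 2 + 1))
      =Θ[atTop] fun n : ℕ => (n : ℝ) / Real.log n ^ 2)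
    (ν₁ ν₂ : ℝ) (hν₁ : 0 < ν₁) (hν₂ : 0 < ν₂) (hν : ν₁ + ν₂ < 1) :
    (∀ᶠ n : ℕ in atTop, Integrable (fun ω =>
      |WaveletEB.thatAdaptive q g φ M₁ M₂ s y u ν₁ ν₂ (mlo n) (mhi n) (fun i : Fin n => X i ω)
        - WaveletEB.bayesEst q g y| ^ 2) P) ∧
    (fun n : ℕ => ∫ ω,
      |WaveletEB.thatAdaptive q g φ M₁ M₂ s y u ν₁ ν₂ (mlo n) (mhi n) (fun i : Fin n => X i ω)
        - WaveletEB.bayesEst q g y| ^ 2 ∂P)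
      =O[atTop] fun n : ℕ => (n : ℝ) ^ (-(2 * r / (2 * r + 1 + max α 0))) * Real.log n := by
  have h0 : ∀ x θ, 0 ≤ q x θ * g θ := by
    intro x θ
    by_cases hθ : θ ∈ Θ
    · exact mul_nonneg (hq_nonneg θ hθ x) (hg_nonneg θ)
    · rw [hg_supp θ hθ, mul_zero]
  have hi := WaveletEB.integrable_joint hq_meas hg_meas h0 (hX 0) (hϑ 0) (hlaw 0)
  have hS := WaveletEB.isSample_marginal hq_meas hg_meas h0 hi hX hϑ hindep hlaw
  have hM : WaveletEB.LocalModel (WaveletEB.marginal q g) (WaveletEB.bayesNum q g) φ M₁ M₂ s y r :=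
    { scaling := hφ
      p_meas := WaveletEB.measurable_marginal hq_meas hg_meas
      p_nonneg := fun x => integral_nonneg fun θ => h0 x θ
      p_mem := hp_bdd
      Ψ_mem := hΨ_bdd
      p_pos := hy
      half_le := hr
      le_sub_one := hrs
      p_smooth := hp_smooth
      Ψ_smooth := hΨ_smooth }
  have hC : WaveletEB.Companion (WaveletEB.marginal q g) (WaveletEB.bayesNum q g) φ M₁ M₂ s y u L
      α Cγ |Cu| :=
    { meas := hu_meas
      sq_int := fun m hm k hk => (hu_L2 m hm k hk).integrable_sq
      -- Both means are averages over θ with weight g. The inner integrals agree on Θ by the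
      -- equation for u, and g vanishes off Θ.
      mean := fun m hm k hk => by
        rw [WaveletEB.integral_mul_marginal hi (hu_meas m hm k hk) (hu_bdd m hm k hk),
          WaveletEB.popC, WaveletEB.integral_mul_bayesNum hΨ_int (hφ.continuous_phi m k)
            (hφ.hasCompactSupport_phi m k)]
        refine integral_congr_ae (Eventually.of_forall fun θ => ?_)
        by_cases hθ : θ ∈ Θ
        · simp only [hu_eq m hm k hk θ hθ]
        · simp only [hg_supp θ hθ, zero_mul]
      gam_le := hγ
      bdd := fun m hm k hk => by
        filter_upwards [hu_bdd m hm k hk] with x hx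
        refine hx.trans ?_
        rw [mul_assoc, mul_assoc]
        exact mul_le_mul_of_nonneg_right (le_abs_self Cu)
          (mul_nonneg (Real.sqrt_nonneg _) (Real.sqrt_nonneg _))
      Cu_nonneg := abs_nonneg Cu }
  obtain ⟨H, hH0, hH, hlam⟩ := hM.exists_height hν₁ hν₂ hν
  obtain ⟨K, hK⟩ := hM.exists_risk_le hS hC hH0 hH hlam hmlo hmhi
  refine ⟨hK.mono fun n hn => hn.1, IsBigO.of_bound K ?_⟩
  filter_upwards [hK] with n hn
  have hlog : 0 ≤ Real.log n := Real.log_natCast_nonneg n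
  rw [Real.norm_of_nonneg (integral_nonneg fun ω => sq_nonneg _),
    Real.norm_of_nonneg (mul_nonneg (Real.rpow_nonneg n.cast_nonneg _) hlog)]
  exact hn.2
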